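/- Let $l\ge 2$ be an integer. Let $B_{X1},B_{X2},\dots$ and $B_{Y1},B_{Y2},\dots$ be independent random variables, each uniform on $\{l-1,l,l+1\}$. Let $X^\infty$ be the random binary sequence whose $i$-th block (maximal run of equal letters) has length $B_{Xi}$ and whose first letter is $0$ or $1$ with probability $1/2$ each, and let $Y^\infty$ be built in the same way from the $B_{Yi}$; the two first letters and all block lengths are independent. Let $X$ and $Y$ be the first $n$ letters of $X^\infty$ and $Y^\infty$, and let $L_n$ be the length of a longest common subsequence of $X$ and $Y$. Given $X$ and $Y$, choose a block of length $l-1$ of $X$ and a block of length $l+1$ of $X$, independently and uniformly among all such blocks, and change the length of both to $l$ (if $X$ lacks a block of one of the two lengths, leave $X$ unchanged). Let $\tilde X$ be the resulting string and $\tilde L_n$ the length of a longest common subsequence of $\tilde X$ and $Y$. An alignment of $X$ and $Y$ is a set of pairs of positions, strictly increasing in both coordinates, that carry equal letters; it is optimal if it has the largest possible number of pairs; it leaves out a block if no letter of that block belongs to an aligned pair. Let $F^n(q)$ be the event that every optimal alignment of $X$ and $Y$ leaves out at most a proportion $q$ of the blocks of $X$ and at most a proportion $q$ of the blocks of $Y$,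 and let $F^{nc}(q)$ be its complement. Let $I=\{l-1,l,l+1\}$, $H(q)=q\ln\frac1q+(1-q)\ln\frac1{1-q}$ and $H(p)=\sum_{i,j\in I}p_{ij}\ln\frac1{p_{ij}}$, where $0\ln\frac10=0$. Theorem. Let $q_0\in[0,\tfrac13)$ and $\varepsilon>0$ be such that the minimum of $$\frac{p_{l-1,l}+p_{l-1,l+1}}{p_{l-1,l-1}+p_{l-1,l}+p_{l-1,l+1}}(1-9q)-\frac{p_{l+1,l+1}}{p_{l+1,l-1}+p_{l+1,l}+p_{l+1,l+1}}(1-3q)-3q$$ over all $q$ and $(p_{ij})_{i,j\in I}$ subject to $$q\in[0,q_0],\qquad \sum_{j}p_{l-1,j}\ge\tfrac12\left(\tfrac13-q_0\right),\qquad \sum_{j}p_{l+1,j}\ge\tfrac12\left(\tfrac13-q_0\right),$$ $$\sum_{i,j\in I}p_{ij}=1,\qquad p_{ij}\ge0\ \text{ for all } i,j\in I,$$ $$2H(q)+(1-4q)\left(\ln\tfrac19+H(p)\right)\ge0$$ equals $2\varepsilon$. Then there is a constant $\beta>0$, not depending on $n$, such that for all sufficiently large $n$ $$\mathrm P\left(\mathrm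 E[\tilde L_n-L_n\mid X,Y]\ge\varepsilon\right)\ \ge\ 1-e^{-n^\beta}-\mathrm P\left(F^{nc}(q_0)\right).$$ -/

import Mathlib

open MeasureTheory ProbabilityTheory Filter

namespace BlockLCS

/-! ### Strings, blocks, common subsequences and alignments -/

/-- The blocks of a binary string: its maximal runs of equal letters, from left to right. -/
def blocks (x : List Bool) : List (List Bool) := x.splitBy (· == ·)

/-- The positions (counted from `0`) of `x` that are occupied by its `k`-th block. -/
def blockPositions (x : List Bool) (k : ℕ) : Finset ℕ :=
  Finset.Ico ((blocks x).take k).flatten.length ((blocks x).take (k + 1)).flatten.length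

/-- The length of a longest common subsequence of `x` and `y`. -/
noncomputable def lcsLength (x y : List Bool) : ℕ :=
  sSup {k | ∃ z : List Bool, z.Sublist x ∧ z.Sublist y ∧ z.length = k}

/-- An alignment with gaps of `x` and `y`, given by its set of aligned pairs of positions: aligned
positions carry the same letter, and the aligned pairs are strictly increasing in both coordinates.
All other letters are aligned with gaps. -/
def IsAlignment (x y : List Bool) (a : Finset (ℕ × ℕ)) : Prop :=
  (∀ p ∈ a, ∃ b : Bool, x[p.1]? = some b ∧ y[p.2]? = some b) ∧
    ∀ p ∈ a, ∀ p' ∈ a, p.1 < p'.1 ↔ p.2 < p'.2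

/-- An alignment that aligns a maximal number of pairs of letters. -/
def IsOptimalAlignment (x y : List Bool) (a : Finset (ℕ × ℕ)) : Prop :=
  IsAlignment x y a ∧ ∀ a' : Finset (ℕ × ℕ), IsAlignment x y a' → a'.card ≤ a.card

/-- The proportion, among all blocks of `x`, of the blocks that are left out when `s` is the set of
positions of `x` that are not aligned with a gap. -/
noncomputable def leftOutProportion (x : List Bool) (s : Finset ℕ) : ℝ :=
  (((Finset.range (blocks x).length).filter fun k => Disjoint (blockPositions x k) s).card : ℝ) /
    ((blocks x).length : ℝ)

/-- Every optimal alignment of `x` and `y` leaves out at most a proportion `q` of the blocks of `x`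
and at most a proportion `q` of the blocks of `y`. -/
def LeavesOutAtMost (x y : List Bool) (q : ℝ) : Prop :=
  ∀ a : Finset (ℕ × ℕ), IsOptimalAlignment x y a →
    leftOutProportion x (a.image Prod.fst) ≤ q ∧ leftOutProportion y (a.image Prod.snd) ≤ q

/-! ### The random modification -/

/-- The length of the `k`-th block of `x` (`0` if there is no such block). -/
def blockLength (x : List Bool) (k : ℕ) : ℕ := ((blocks x).getD k []).length

/-- The pairs `(i, j)` such that the `i`-th block of `x` has length `l - 1` and the `j`-th block of
`x` has length `l + 1`. -/
def choices (l : ℕ) (x : List Bool) : Finset (ℕ × ℕ) :=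
  ((Finset.range (blocks x).length) ×ˢ (Finset.range (blocks x).length)).filter fun c =>
    blockLength x c.1 = l - 1 ∧ blockLength x c.2 = l + 1

/-- Replace the `k`-th block of a list of blocks by a block of the same letter and of length `l`. -/
def resizeBlock (l : ℕ) (bs : List (List Bool)) (k : ℕ) : List (List Bool) :=
  bs.modify k fun b => List.replicate l (b.headD false)

/-- Change the length of the block `c.1` (of length `l - 1`) and of the block `c.2` (of length
`l + 1`) to `l`. A string without such a pair of blocks is left unchanged. -/
def modifyString (l : ℕ) (x : List Bool) (c : ℕ × ℕ) : List Bool :=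
  if c ∈ choices l x then (resizeBlock l (resizeBlock l (blocks x) c.1) c.2).flatten else x

/-! ### The probabilistic model -/

/-- The first `n` letters of the binary sequence with first letter `s` whose successive blocks have
the (positive) lengths `B 0, B 1, B 2, …`; the first `n` blocks contain at least `n` letters. -/
def blockString (s : Bool) (B : ℕ → ℕ) (n : ℕ) : List Bool :=
  ((List.range n).flatMap fun i => List.replicate (B i) (if Even i then s else !s)).take n

/-- The block model with parameter `l`: the block lengths `BX i`, `BY i` are uniform on
`{l - 1, l, l + 1}`, the first letters `sX`, `sY` are uniform, and all of these are independent. -/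
structure IsBlockModel {Ω : Type*} [MeasurableSpace Ω] (μ : Measure Ω) (l : ℕ)
    (sX sY : Ω → Bool) (BX BY : ℕ → Ω → ℕ) : Prop where
  measurable_sX : Measurable sX
  measurable_sY : Measurable sY
  measurable_BX : ∀ i, Measurable (BX i)
  measurable_BY : ∀ i, Measurable (BY i)
  law_sX : ∀ b : Bool, μ {ω | sX ω = b} = 1 / 2
  law_sY : ∀ b : Bool, μ {ω | sY ω = b} = 1 / 2
  law_BX : ∀ i, ∀ k ∈ ({l - 1, l, l + 1} : Finset ℕ), μ {ω | BX i ω = k} = 1 / 3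
  law_BY : ∀ i, ∀ k ∈ ({l - 1, l, l + 1} : Finset ℕ), μ {ω | BY i ω = k} = 1 / 3
  indep_lengths : iIndepFun (Sum.elim BX BY : ℕ ⊕ ℕ → Ω → ℕ) μ
  indep_letters : IndepFun sX sY μ
  indep_letters_lengths :
    IndepFun (fun ω => (sX ω, sY ω)) (fun ω => (fun i => BX i ω, fun i => BY i ω)) μ

/-- Given the random strings `X` and `Y`, the random pair of blocks `C` is uniformly distributed on
the pairs (block of `X` of length `l - 1`, block of `X` of length `l + 1`). -/
structure IsUniformChoice {Ω : Type*} [MeasurableSpace Ω] (μ : Measure Ω) (l : ℕ)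
    (X Y : Ω → List Bool) (C : Ω → ℕ × ℕ) : Prop where
  measurable_choice : Measurable C
  law_choice : ∀ x y : List Bool, ∀ c ∈ choices l x,
    μ {ω | X ω = x ∧ Y ω = y ∧ C ω = c} =
      μ {ω | X ω = x ∧ Y ω = y} / ((choices l x).card : ENNReal)

/-- The σ-algebra generated by the pair of random strings `(X, Y)`. -/
@[reducible] def sigmaXY {Ω : Type*} (X Y : Ω → List Bool) : MeasurableSpace Ω :=
  MeasurableSpace.comap (fun ω => (X ω, Y ω)) ⊤

/-- The conditional expectation, given `X` and `Y`, of the change of the length of the longest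
common subsequence under the random modification of `X` with chosen pair of blocks `C`. -/
noncomputable def expectedChange {Ω : Type*} [MeasurableSpace Ω] (μ : Measure Ω) (l : ℕ)
    (X Y : Ω → List Bool) (C : Ω → ℕ × ℕ) : Ω → ℝ :=
  μ[fun ω => (lcsLength (modifyString l (X ω) (C ω)) (Y ω) : ℝ) - (lcsLength (X ω) (Y ω) : ℝ) |
    sigmaXY X Y]

/-! ### The minimisation problem

A distribution on the pairs of block lengths is `p : Fin 3 → Fin 3 → ℝ`; the indices `0`, `1`, `2`
stand for the lengths `l - 1`, `l`, `l + 1`. -/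

/-- The objective function. -/
noncomputable def objective (p : Fin 3 → Fin 3 → ℝ) (q : ℝ) : ℝ :=
  (p 0 1 + p 0 2) / (p 0 0 + p 0 1 + p 0 2) * (1 - 9 * q)
    - p 2 2 / (p 2 0 + p 2 1 + p 2 2) * (1 - 3 * q) - 3 * q

/-- The entropy `∑ p_ij ln (1 / p_ij)`, with `0 ln (1 / 0) = 0`. -/
noncomputable def entropy (p : Fin 3 → Fin 3 → ℝ) : ℝ :=
  ∑ i, ∑ j, p i j * Real.log (1 / p i j)

/-- The entropy `q ln (1 / q) + (1 - q) ln (1 / (1 - q))`. -/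
noncomputable def entropyTwo (q : ℝ) : ℝ :=
  q * Real.log (1 / q) + (1 - q) * Real.log (1 / (1 - q))

/-- The constraints. -/
structure IsFeasible (q₀ : ℝ) (p : Fin 3 → Fin 3 → ℝ) (q : ℝ) : Prop where
  q_mem : q ∈ Set.Icc 0 q₀
  short_mass : (1 / 3 - q₀) / 2 ≤ ∑ j, p 0 j
  long_mass : (1 / 3 - q₀) / 2 ≤ ∑ j, p 2 j
  nonneg : ∀ i j, 0 ≤ p i j
  total_mass : ∑ i, ∑ j, p i j = 1
  entropy_nonneg : 0 ≤ 2 * entropyTwo q + (1 - 4 * q) * (Real.log (1 / 9) + entropy p)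

/-- The values of the objective function at the feasible points. -/
def feasibleValues (q₀ : ℝ) : Set ℝ :=
  {v | ∃ (p : Fin 3 → Fin 3 → ℝ) (q : ℝ), IsFeasible q₀ p q ∧ objective p q = v}

end BlockLCS

open BlockLCS

/-!
An optimal alignment of `X` and `Y` amounts to a plan that says how many letters of each block of
`X` are aligned with each block of `Y`. If few blocks are left out, then most blocks of `X` are
aligned one-to-one with blocks of `Y`, and which ones are is determined by the sets of left-out
blocks. A block of length `l - 1` aligned with a longer block gains a pair of letters when it is
lengthened; a block of length `l + 1` loses a pair when it is shortened only if all its letters are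
aligned. The expected change is therefore bounded below by `objective p q`, up to an error that
vanishes as `n → ∞`, where `p` is the distribution of the pairs of lengths of the blocks that are
aligned one-to-one.

The number of ways to choose the left-out blocks is about `exp (2 * entropyTwo q * k)`, with `k`
the number of blocks, while for each choice the probability to see the pairs of lengths distributed
as `p` is about `exp ((1 - 4 * q) * (log (1 / 9) + entropy p) * k)`. By the union bound, outside an
event of exponentially small probability, `(p, q)` satisfies the entropy constraint up to an
arbitrarily small slack, and by compactness a small slack in the constraints costs at most `ε` in
the value of the minimum.
-/

namespace BlockLCS

/-! ### Strings with prescribed block lengths -/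

/-- The letter of the `i`-th block of a string that starts with the letter `s`. -/
def letter (s : Bool) (i : ℕ) : Bool := if Even i then s else !s

lemma letter_succ (s : Bool) (i : ℕ) : letter s (i + 1) = !letter s i := by
  unfold letter
  by_cases h : Even i <;> simp [h, Nat.even_add_one]

lemma letter_eq_iff (s : Bool) (i j : ℕ) : letter s i = letter s j ↔ (Even i ↔ Even j) := by
  unfold letter
  by_cases hi : Even i <;> by_cases hj : Even j <;> simp [hi, hj]

/-- The list of `K` alternating blocks with lengths `f 0, …, f (K - 1)`, the first letter being
`s`; every nonempty string is of the form `(blockList s f K).flatten`. -/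
def blockList (s : Bool) (f : ℕ → ℕ) (K : ℕ) : List (List Bool) :=
  (List.range K).map fun i => List.replicate (f i) (letter s i)

section BlockList

variable (s : Bool) (f : ℕ → ℕ) {k K : ℕ}

@[simp] lemma length_blockList (K : ℕ) : (blockList s f K).length = K := by simp [blockList]

lemma blockList_succ (K : ℕ) :
    blockList s f (K + 1) = blockList s f K ++ [List.replicate (f K) (letter s K)] := by
  simp [blockList, List.range_succ]

variable {s f} in
lemma blockList_congr {f' : ℕ → ℕ} (h : ∀ i < K, f i = f' i) :
    blockList s f K = blockList s f' K :=
  List.map_congr_left fun i hi => by rw [h i (List.mem_range.1 hi)]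

lemma getD_blockList (hk : k < K) :
    (blockList s f K).getD k [] = List.replicate (f k) (letter s k) := by
  simp [blockList, List.getD_eq_getElem?_getD, hk]

lemma length_flatten_blockList (K : ℕ) :
    (blockList s f K).flatten.length = ∑ i ∈ Finset.range K, f i := by
  induction K with
  | zero => simp [blockList]
  | succ K ih => simp [blockList_succ, ih, Finset.sum_range_succ]

lemma take_blockList (h : k ≤ K) : (blockList s f K).take k = blockList s f k := by
  simp [blockList, ← List.map_take, List.take_range, h]

variable {f} in
lemma blocks_flatten_blockList (hf : ∀ i < K, 0 < f i) :
    blocks (blockList s f K).flatten = blockList s f K := by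
  refine List.splitBy_flatten ?_ ?_ ?_
  · simp only [blockList, List.mem_map, List.mem_range, not_exists, not_and]
    intro i hi h
    exact (hf i hi).ne' (by simpa using congrArg List.length h)
  · simp only [blockList, List.mem_map, List.mem_range]
    rintro _ ⟨i, -, rfl⟩
    exact List.isChain_replicate_of_rel _ (by simp)
  · rw [List.isChain_iff_getElem]
    intro i hi
    rw [length_blockList] at hi
    have hi₀ := hf i (by omega)
    have hi₁ := hf (i + 1) hi
    refine ⟨by simp [blockList]; omega, by simp [blockList]; omega, ?_⟩
    simp [blockList, letter_succ]

variable {f} in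
lemma take_flatten_blockList {r : ℕ} (hk : k < K) (hr : r ≤ f k) :
    (blockList s f K).flatten.take (∑ i ∈ Finset.range k, f i + r) =
      (blockList s (Function.update f k r) (k + 1)).flatten := by
  have hsplit : (blockList s f K).flatten = (blockList s f k).flatten ++
      (List.replicate (f k) (letter s k) ++ ((blockList s f K).drop (k + 1)).flatten) := by
    conv_lhs => rw [← List.take_append_drop (k + 1) (blockList s f K), take_blockList s f hk]
    simp [blockList_succ]
  have hinit : blockList s (Function.update f k r) k = blockList s f k :=
    blockList_congr fun i hi => Function.update_of_ne hi.ne _ _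
  rw [hsplit, ← length_flatten_blockList s f k, List.take_length_add_append,
    List.take_append_of_le_length (by simpa using hr), blockList_succ, hinit]
  simp [hr]

end BlockList

/-! ### Positions of the blocks -/

/-- The positions occupied by the `k`-th of consecutive blocks of lengths `f 0, f 1, …`. -/
def blockRange (f : ℕ → ℕ) (k : ℕ) : Finset ℕ :=
  Finset.Ico (∑ i ∈ Finset.range k, f i) (∑ i ∈ Finset.range (k + 1), f i)

/-- The index of the block that contains the position `u`, among consecutive blocks of lengths
`f 0, f 1, …`. It is meaningful only if the blocks reach beyond `u`. -/
noncomputable def blockIndex (f : ℕ → ℕ) (u : ℕ) : ℕ :=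
  sInf {k | u < ∑ i ∈ Finset.range (k + 1), f i}

section BlockRange

variable {f : ℕ → ℕ} {k k' K u u' : ℕ}

lemma card_blockRange (f : ℕ → ℕ) (k : ℕ) : (blockRange f k).card = f k := by
  simp [blockRange, Finset.sum_range_succ]

lemma le_of_mem_blockRange (hu : u ∈ blockRange f k) (hu' : u' ∈ blockRange f k') (h : u ≤ u') :
    k ≤ k' := by
  by_contra hk
  have := Finset.sum_le_sum_of_subset (f := f) (Finset.range_mono (by omega : k' + 1 ≤ k))
  rw [blockRange, Finset.mem_Ico] at hu hu'
  omega

lemma blockIndex_eq (hu : u ∈ blockRange f k) : blockIndex f u = k := by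
  refine le_antisymm (Nat.sInf_le (Finset.mem_Ico.1 hu).2) ?_
  refine le_csInf ⟨k, (Finset.mem_Ico.1 hu).2⟩ fun k' hk' => ?_
  by_contra h
  have := Finset.sum_le_sum_of_subset (f := f) (Finset.range_mono (by omega : k' + 1 ≤ k))
  rw [blockRange, Finset.mem_Ico] at hu
  rw [Set.mem_ofPred_eq] at hk'
  omega

lemma exists_mem_blockRange (hu : u < ∑ i ∈ Finset.range K, f i) :
    ∃ k < K, u ∈ blockRange f k := by
  induction K with
  | zero => simp at hu
  | succ K ih =>
    by_cases h : u < ∑ i ∈ Finset.range K, f i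
    · obtain ⟨k, hk, hku⟩ := ih h
      exact ⟨k, hk.trans K.lt_succ_self, hku⟩
    · exact ⟨K, K.lt_succ_self, Finset.mem_Ico.2 ⟨not_lt.1 h, hu⟩⟩

lemma blockIndex_lt (hu : u < ∑ i ∈ Finset.range K, f i) : blockIndex f u < K := by
  obtain ⟨k, hk, hku⟩ := exists_mem_blockRange hu
  rwa [blockIndex_eq hku]

lemma mem_blockRange_blockIndex (hu : u < ∑ i ∈ Finset.range K, f i) :
    u ∈ blockRange f (blockIndex f u) := by
  obtain ⟨k, -, hku⟩ := exists_mem_blockRange hu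
  rwa [blockIndex_eq hku]

lemma blockPositions_flatten_blockList (s : Bool) (hf : ∀ i < K, 0 < f i) (hk : k < K) :
    blockPositions (blockList s f K).flatten k = blockRange f k := by
  rw [blockPositions, blocks_flatten_blockList s hf, take_blockList s f hk.le,
    take_blockList s f hk, length_flatten_blockList, length_flatten_blockList, blockRange]

lemma getElem?_flatten_blockList (s : Bool) (hk : k < K) (hu : u ∈ blockRange f k) :
    (blockList s f K).flatten[u]? = some (letter s k) := by
  induction K with
  | zero => omega
  | succ K ih =>
    obtain ⟨hlow, hup⟩ := Finset.mem_Ico.1 hu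
    rw [blockList_succ, List.flatten_append]
    rcases Nat.lt_succ_iff_lt_or_eq.1 hk with h | rfl
    · rw [List.getElem?_append_left, ih h]
      rw [length_flatten_blockList]
      exact hup.trans_le (Finset.sum_le_sum_of_subset (Finset.range_mono h))
    · rw [List.getElem?_append_right, length_flatten_blockList]
      · rw [Finset.sum_range_succ] at hup
        simp [List.getElem?_replicate]
        omega
      · rwa [length_flatten_blockList]

end BlockRange

lemma length_blockString_le (s : Bool) (B : ℕ → ℕ) (n : ℕ) : (blockString s B n).length ≤ n := by
  simp [blockString]

lemma blockString_congr (s : Bool) {B B' : ℕ → ℕ} {n : ℕ} (h : ∀ i < n, B i = B' i) :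
    blockString s B n = blockString s B' n := by
  unfold blockString
  exact congrArg _ (List.flatMap_congr fun i hi => by rw [h i (List.mem_range.1 hi)])

lemma exists_blockString_eq_flatten_blockList (s : Bool) {B : ℕ → ℕ} (hB : ∀ i, 0 < B i) {n : ℕ}
    (hn : 0 < n) : ∃ k f, k < n ∧ (∀ i < k, f i = B i) ∧ 0 < f k ∧ f k ≤ B k ∧
      ∑ i ∈ Finset.range (k + 1), f i = n ∧
      blockString s B n = (blockList s f (k + 1)).flatten := by
  have hn_le : n ≤ ∑ i ∈ Finset.range n, B i := by
    simpa using Finset.card_nsmul_le_sum (Finset.range n) B 1 fun i _ => hB i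
  obtain ⟨k, hk, hnk⟩ := exists_mem_blockRange (f := B) (K := n) (u := n - 1) (by omega)
  rw [blockRange, Finset.mem_Ico, Finset.sum_range_succ] at hnk
  obtain ⟨r, hr⟩ := Nat.exists_eq_add_of_lt (by omega : ∑ i ∈ Finset.range k, B i < n)
  have hinit : ∀ i < k, Function.update B k (r + 1) i = B i := fun i hi =>
    Function.update_of_ne hi.ne _ _
  have hsum : ∑ i ∈ Finset.range k, Function.update B k (r + 1) i = ∑ i ∈ Finset.range k, B i :=
    Finset.sum_congr rfl fun i hi => hinit i (Finset.mem_range.1 hi)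
  have hstring : blockString s B n = (blockList s B n).flatten.take n := rfl
  refine ⟨k, Function.update B k (r + 1), hk, hinit, by simp, by simp; omega, ?_, ?_⟩
  · rw [Finset.sum_range_succ, hsum, Function.update_self, hr, add_assoc]
  · rw [hstring, ← take_flatten_blockList s hk (by omega)]
    congr 1

/-! ### Longest common subsequences and alignments -/

section Alignment

variable {x y : List Bool} {a : Finset (ℕ × ℕ)}

lemma bddAbove_length_common_sublist (x y : List Bool) :
    BddAbove {k | ∃ z : List Bool, z.Sublist x ∧ z.Sublist y ∧ z.length = k} := by
  refine ⟨x.length, ?_⟩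
  rintro k ⟨z, h, -, rfl⟩
  exact h.length_le

lemma length_le_lcsLength {z : List Bool} (hx : z.Sublist x) (hy : z.Sublist y) :
    z.length ≤ lcsLength x y :=
  le_csSup (bddAbove_length_common_sublist x y) ⟨z, hx, hy, rfl⟩

lemma exists_common_sublist_length_eq (x y : List Bool) :
    ∃ z : List Bool, z.Sublist x ∧ z.Sublist y ∧ z.length = lcsLength x y :=
  Nat.sSup_mem (s := {k | ∃ z : List Bool, z.Sublist x ∧ z.Sublist y ∧ z.length = k})
    ⟨0, [], by simp⟩ (bddAbove_length_common_sublist x y)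

lemma lcsLength_le_length (x y : List Bool) : lcsLength x y ≤ y.length := by
  obtain ⟨z, -, hy, hz⟩ := exists_common_sublist_length_eq x y
  exact hz ▸ hy.length_le

lemma ofFn_sublist {α : Type*} {m : ℕ} {x : List α} {v : Fin m → ℕ} (hv : StrictMono v)
    {b : Fin m → α} (hb : ∀ k, x[v k]? = some (b k)) : (List.ofFn b).Sublist x := by
  rw [List.sublist_iff_exists_fin_orderEmbedding_get_eq]
  have hx : ∀ k, v k < x.length := fun k => (List.getElem?_eq_some_iff.1 (hb k)).1
  have hmono : StrictMono fun k : Fin (List.ofFn b).length =>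
      (⟨v (k.cast List.length_ofFn), hx _⟩ : Fin x.length) := fun k k' h => hv (by simpa using h)
  refine ⟨OrderEmbedding.ofStrictMono _ hmono, fun k => ?_⟩
  rw [List.get_eq_getElem, List.getElem_ofFn]
  exact (List.getElem?_eq_some_iff.1 (hb (k.cast List.length_ofFn))).2.symm

namespace IsAlignment

lemma swap (ha : IsAlignment x y a) :
    IsAlignment y x (a.map (Equiv.prodComm ℕ ℕ).toEmbedding) := by
  simp only [IsAlignment, Finset.forall_mem_map, Equiv.coe_toEmbedding, Equiv.prodComm_apply,
    Prod.fst_swap, Prod.snd_swap]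
  exact ⟨fun p hp => (ha.1 p hp).imp fun _ h => h.symm, fun p hp p' hp' => (ha.2 p hp p' hp').symm⟩

lemma fst_injOn (ha : IsAlignment x y a) : Set.InjOn Prod.fst (a : Set (ℕ × ℕ)) := by
  intro p hp p' hp' h
  have h₁ := ha.2 p hp p' hp'
  have h₂ := ha.2 p' hp' p hp
  exact Prod.ext h (by omega)

lemma card_le_lcsLength (ha : IsAlignment x y a) : a.card ≤ lcsLength x y := by
  have hcard : (a.image Prod.fst).card = a.card := Finset.card_image_of_injOn ha.fst_injOn
  let e := (a.image Prod.fst).orderEmbOfFin hcard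
  have hpartner : ∀ k, ∃ v, (e k, v) ∈ a := by
    intro k
    obtain ⟨p, hp, hpe⟩ := Finset.mem_image.1 (Finset.orderEmbOfFin_mem _ hcard k)
    exact ⟨p.2, by simpa [e, ← hpe] using hp⟩
  choose v hv using hpartner
  choose b hb using fun k => ha.1 _ (hv k)
  have hv_mono : StrictMono v := fun k k' h => (ha.2 _ (hv k) _ (hv k')).1 (e.strictMono h)
  simpa using length_le_lcsLength (ofFn_sublist e.strictMono fun k => (hb k).1)
    (ofFn_sublist hv_mono fun k => (hb k).2)

end IsAlignment

lemma exists_isAlignment_card_eq (x y : List Bool) :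
    ∃ a, IsAlignment x y a ∧ a.card = lcsLength x y := by
  obtain ⟨z, hx, hy, hz⟩ := exists_common_sublist_length_eq x y
  rw [List.sublist_iff_exists_fin_orderEmbedding_get_eq] at hx hy
  obtain ⟨e, he⟩ := hx
  obtain ⟨g, hg⟩ := hy
  have hinj : Function.Injective fun k => ((e k : ℕ), (g k : ℕ)) := fun k k' h =>
    e.injective (Fin.ext (Prod.ext_iff.1 h).1)
  refine ⟨Finset.univ.image fun k => ((e k : ℕ), (g k : ℕ)), ⟨?_, ?_⟩, ?_⟩
  · simp only [Finset.forall_mem_image]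
    exact fun k _ => ⟨z.get k, by simpa using (he k).symm, by simpa using (hg k).symm⟩
  · simp only [Finset.forall_mem_image, Fin.val_fin_lt, OrderEmbedding.lt_iff_lt, implies_true]
  · rw [Finset.card_image_of_injective _ hinj, Finset.card_univ, Fintype.card_fin, hz]

lemma IsOptimalAlignment.card_eq_lcsLength (ha : IsOptimalAlignment x y a) :
    a.card = lcsLength x y := by
  obtain ⟨a', ha', hcard⟩ := exists_isAlignment_card_eq x y
  exact le_antisymm ha.1.card_le_lcsLength (hcard ▸ ha.2 a' ha')

lemma exists_isOptimalAlignment (x y : List Bool) : ∃ a, IsOptimalAlignment x y a := by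
  obtain ⟨a, ha, hcard⟩ := exists_isAlignment_card_eq x y
  exact ⟨a, ha, fun a' ha' => hcard ▸ ha'.card_le_lcsLength⟩

end Alignment

/-! ### Alignments counted block by block -/

/-- A plan records how many pairs of letters are aligned between the `i`-th block of one string and
the `j`-th block of another one. The strings start with the letters `s`, `t` and have `K`, `K'`
blocks of the lengths `f`, `g`. -/
structure IsPlan (s t : Bool) (f g : ℕ → ℕ) (K K' : ℕ) (w : ℕ → ℕ → ℕ) : Prop where
  bound : ∀ i j, w i j ≠ 0 → i < K ∧ j < K'
  color : ∀ i j, w i j ≠ 0 → letter s i = letter t j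
  chain : ∀ i j i' j', w i j ≠ 0 → w i' j' ≠ 0 → i < i' → j ≤ j'
  row : ∀ i < K, ∑ j ∈ Finset.range K', w i j ≤ f i
  col : ∀ j < K', ∑ i ∈ Finset.range K, w i j ≤ g j

/-- The number of pairs of letters aligned by the plan `w`. -/
def weight (K K' : ℕ) (w : ℕ → ℕ → ℕ) : ℕ := ∑ i ∈ Finset.range K, ∑ j ∈ Finset.range K', w i j

/-- The list of the pairs `(i, j)` with `i < K` and `j < K'` in lexicographic order, each `(i, j)`
being repeated `w i j` times. -/
def rowMajorPairs (K K' : ℕ) (w : ℕ → ℕ → ℕ) : List (ℕ × ℕ) :=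
  (List.range K).flatMap fun i => (List.range K').flatMap fun j => List.replicate (w i j) (i, j)

section Plan

variable {s t : Bool} {f g : ℕ → ℕ} {K K' : ℕ} {w : ℕ → ℕ → ℕ}

lemma IsPlan.swap (hw : IsPlan s t f g K K' w) : IsPlan t s g f K' K fun j i => w i j where
  bound j i h := (hw.bound i j h).symm
  color j i h := (hw.color i j h).symm
  chain j i j' i' h h' hlt := by
    by_contra hi
    have := hw.chain i' j' i j h' h (not_le.1 hi)
    omega
  row := hw.col
  col := hw.row

lemma length_rowMajorPairs (K K' : ℕ) (w : ℕ → ℕ → ℕ) :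
    (rowMajorPairs K K' w).length = weight K K' w := by
  simp only [rowMajorPairs, weight, List.length_flatMap, List.length_replicate]
  rfl

lemma map_letter_rowMajorPairs (s : Bool) (K K' : ℕ) (w : ℕ → ℕ → ℕ) :
    (rowMajorPairs K K' w).map (fun e => letter s e.1) =
      (blockList s (fun i => ∑ j ∈ Finset.range K', w i j) K).flatten := by
  rw [rowMajorPairs, List.map_flatMap, blockList, ← List.flatMap_def]
  refine List.flatMap_congr fun i _ => List.eq_replicate_iff.2 ⟨?_, ?_⟩
  · simp only [List.length_map, List.length_flatMap, List.length_replicate]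
    rfl
  · simp only [List.mem_map, List.mem_flatMap, List.mem_replicate]
    rintro _ ⟨_, ⟨j, -, -, rfl⟩, rfl⟩
    rfl

lemma IsPlan.pairwise_rowMajorPairs (hw : IsPlan s t f g K K' w) :
    (rowMajorPairs K K' w).Pairwise (· ≤ ·) := by
  simp only [rowMajorPairs, List.pairwise_flatMap, List.mem_flatMap, List.mem_replicate]
  refine ⟨fun i _ => ⟨fun j _ => List.pairwise_replicate.2 (Or.inr le_rfl), ?_⟩, ?_⟩
  · refine List.pairwise_lt_range.imp fun {j j'} hj => ?_
    rintro _ ⟨-, rfl⟩ _ ⟨-, rfl⟩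
    exact Prod.mk_le_mk.2 ⟨le_rfl, hj.le⟩
  · refine List.pairwise_lt_range.imp fun {i i'} hi => ?_
    rintro _ ⟨j, -, h, rfl⟩ _ ⟨j', -, h', rfl⟩
    exact Prod.mk_le_mk.2 ⟨hi.le, hw.chain i j i' j' h h' hi⟩

lemma map_swap_rowMajorPairs_perm (K K' : ℕ) (w : ℕ → ℕ → ℕ) :
    ((rowMajorPairs K' K fun j i => w i j).map Prod.swap).Perm (rowMajorPairs K K' w) := by
  simp only [rowMajorPairs, List.map_flatMap, List.map_replicate, Prod.swap_prod_mk]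
  rw [← Multiset.coe_eq_coe]
  simp only [← Multiset.coe_bind]
  exact Multiset.bind_bind _ _

lemma flatten_blockList_sublist {f' : ℕ → ℕ} (s : Bool) (h : ∀ i < K, f i ≤ f' i) :
    (blockList s f K).flatten.Sublist (blockList s f' K).flatten := by
  simp only [blockList, ← List.flatMap_def]
  exact List.Sublist.flatMap_right _ fun i hi =>
    List.replicate_sublist_replicate _ |>.2 (h i (List.mem_range.1 hi))

/-- The row-major and the column-major list of aligned pairs of blocks are both sorted for the
product order, so they coincide, and so do the subsequences of the two strings they spell. -/
theorem IsPlan.weight_le_lcsLength (hw : IsPlan s t f g K K' w) :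
    weight K K' w ≤ lcsLength (blockList s f K).flatten (blockList t g K').flatten := by
  have hswap : (rowMajorPairs K' K fun j i => w i j).map Prod.swap = rowMajorPairs K K' w := by
    refine (map_swap_rowMajorPairs_perm K K' w).eq_of_pairwise (fun _ _ _ _ => le_antisymm) ?_
      hw.pairwise_rowMajorPairs
    exact List.pairwise_map.2 (hw.swap.pairwise_rowMajorPairs.imp Prod.swap_le_swap.2)
  have hletter : (rowMajorPairs K K' w).map (fun e => letter s e.1) =
      (rowMajorPairs K K' w).map (fun e => letter t e.2) := by
    refine List.map_congr_left fun e he => ?_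
    simp only [rowMajorPairs, List.mem_flatMap, List.mem_replicate] at he
    obtain ⟨i, -, j, -, h, rfl⟩ := he
    exact hw.color i j h
  have hX := map_letter_rowMajorPairs s K K' w
  have hY := map_letter_rowMajorPairs t K' K fun j i => w i j
  have hspell : (rowMajorPairs K' K fun j i => w i j).map (fun e => letter t e.1) =
      (rowMajorPairs K K' w).map (fun e => letter t e.2) := by
    rw [← hswap, List.map_map]
    rfl
  rw [← length_rowMajorPairs, ← List.length_map (f := fun e => letter s e.1)]
  refine length_le_lcsLength ?_ ?_
  · exact hX ▸ flatten_blockList_sublist s hw.row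
  · rw [hletter, ← hspell, hY]
    exact flatten_blockList_sublist t hw.col

end Plan

section OfAlignment

variable {s t : Bool} {f g : ℕ → ℕ} {K K' : ℕ} {a : Finset (ℕ × ℕ)}

/-- The plan of an alignment `a` of two strings with the block lengths `f`, `g`. -/
noncomputable def alignmentPlan (f g : ℕ → ℕ) (a : Finset (ℕ × ℕ)) (i j : ℕ) : ℕ :=
  (a.filter fun p => blockIndex f p.1 = i ∧ blockIndex g p.2 = j).card

lemma alignmentPlan_ne_zero_iff {i j : ℕ} :
    alignmentPlan f g a i j ≠ 0 ↔ ∃ p ∈ a, blockIndex f p.1 = i ∧ blockIndex g p.2 = j := by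
  rw [alignmentPlan, ne_eq, Finset.card_eq_zero, ← ne_eq, ← Finset.nonempty_iff_ne_empty]
  simp only [Finset.Nonempty, Finset.mem_filter]

lemma alignmentPlan_map_swap (f g : ℕ → ℕ) (a : Finset (ℕ × ℕ)) :
    alignmentPlan g f (a.map (Equiv.prodComm ℕ ℕ).toEmbedding) =
      fun j i => alignmentPlan f g a i j := by
  funext j i
  rw [alignmentPlan, alignmentPlan, Finset.filter_map, Finset.card_map]
  exact congrArg _ (Finset.filter_congr fun p _ => and_comm)

namespace IsAlignment

lemma fst_lt (ha : IsAlignment (blockList s f K).flatten (blockList t g K').flatten a)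
    {p : ℕ × ℕ} (hp : p ∈ a) : p.1 < ∑ i ∈ Finset.range K, f i := by
  obtain ⟨b, h, -⟩ := ha.1 p hp
  rw [← length_flatten_blockList s f]
  exact (List.getElem?_eq_some_iff.1 h).1

lemma snd_lt (ha : IsAlignment (blockList s f K).flatten (blockList t g K').flatten a)
    {p : ℕ × ℕ} (hp : p ∈ a) : p.2 < ∑ j ∈ Finset.range K', g j := by
  obtain ⟨b, -, h⟩ := ha.1 p hp
  rw [← length_flatten_blockList t g]
  exact (List.getElem?_eq_some_iff.1 h).1

lemma sum_alignmentPlan (ha : IsAlignment (blockList s f K).flatten (blockList t g K').flatten a)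
    (i : ℕ) :
    ∑ j ∈ Finset.range K', alignmentPlan f g a i j =
      (a.filter fun p => blockIndex f p.1 = i).card := by
  rw [Finset.card_eq_sum_card_fiberwise (f := fun p => blockIndex g p.2) (t := Finset.range K')]
  · simp only [alignmentPlan, Finset.filter_filter]
  · intro p hp
    exact Finset.mem_coe.2 (Finset.mem_range.2
      (blockIndex_lt (ha.snd_lt (Finset.mem_filter.1 hp).1)))

lemma sum_alignmentPlan_le
    (ha : IsAlignment (blockList s f K).flatten (blockList t g K').flatten a) (i : ℕ) :
    ∑ j ∈ Finset.range K', alignmentPlan f g a i j ≤ f i := by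
  rw [ha.sum_alignmentPlan, ← card_blockRange f i]
  refine Finset.card_le_card_of_injOn Prod.fst (fun p hp => ?_)
    (ha.fst_injOn.mono (Finset.filter_subset _ _))
  obtain ⟨hpa, rfl⟩ := Finset.mem_filter.1 hp
  exact mem_blockRange_blockIndex (ha.fst_lt hpa)

theorem isPlan_alignmentPlan
    (ha : IsAlignment (blockList s f K).flatten (blockList t g K').flatten a) :
    IsPlan s t f g K K' (alignmentPlan f g a) where
  bound i j h := by
    obtain ⟨p, hp, rfl, rfl⟩ := alignmentPlan_ne_zero_iff.1 h
    exact ⟨blockIndex_lt (ha.fst_lt hp), blockIndex_lt (ha.snd_lt hp)⟩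
  color i j h := by
    obtain ⟨p, hp, rfl, rfl⟩ := alignmentPlan_ne_zero_iff.1 h
    obtain ⟨b, hX, hY⟩ := ha.1 p hp
    rw [getElem?_flatten_blockList s (blockIndex_lt (ha.fst_lt hp))
      (mem_blockRange_blockIndex (ha.fst_lt hp))] at hX
    rw [getElem?_flatten_blockList t (blockIndex_lt (ha.snd_lt hp))
      (mem_blockRange_blockIndex (ha.snd_lt hp))] at hY
    exact Option.some_injective _ (hX.trans hY.symm)
  chain i j i' j' h h' hlt := by
    obtain ⟨p, hp, rfl, rfl⟩ := alignmentPlan_ne_zero_iff.1 h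
    obtain ⟨p', hp', rfl, rfl⟩ := alignmentPlan_ne_zero_iff.1 h'
    have hfst : p.1 < p'.1 := by
      by_contra hle
      have := le_of_mem_blockRange (mem_blockRange_blockIndex (ha.fst_lt hp'))
        (mem_blockRange_blockIndex (ha.fst_lt hp)) (not_lt.1 hle)
      omega
    exact le_of_mem_blockRange (mem_blockRange_blockIndex (ha.snd_lt hp))
      (mem_blockRange_blockIndex (ha.snd_lt hp')) ((ha.2 p hp p' hp').1 hfst).le
  row i _ := ha.sum_alignmentPlan_le i
  col j _ := by
    have := ha.swap.sum_alignmentPlan_le j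
    rwa [alignmentPlan_map_swap] at this

lemma weight_alignmentPlan
    (ha : IsAlignment (blockList s f K).flatten (blockList t g K').flatten a) :
    weight K K' (alignmentPlan f g a) = a.card := by
  simp only [weight, ha.sum_alignmentPlan]
  refine (Finset.card_eq_sum_card_fiberwise fun p hp => ?_).symm
  exact Finset.mem_coe.2 (Finset.mem_range.2 (blockIndex_lt (ha.fst_lt hp)))

lemma disjoint_blockPositions_image_fst_iff
    (ha : IsAlignment (blockList s f K).flatten (blockList t g K').flatten a)
    (hf : ∀ i < K, 0 < f i) {i : ℕ} (hi : i < K) :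
    Disjoint (blockPositions (blockList s f K).flatten i) (a.image Prod.fst) ↔
      ∀ j, alignmentPlan f g a i j = 0 := by
  rw [blockPositions_flatten_blockList s hf hi, Finset.disjoint_right, Finset.forall_mem_image]
  constructor
  · intro h j
    by_contra hne
    obtain ⟨p, hp, rfl, rfl⟩ := alignmentPlan_ne_zero_iff.1 hne
    exact h hp (mem_blockRange_blockIndex (ha.fst_lt hp))
  · intro h p hp hpi
    exact alignmentPlan_ne_zero_iff.2 ⟨p, hp, blockIndex_eq hpi, rfl⟩ (h (blockIndex g p.2))

lemma disjoint_blockPositions_image_snd_iff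
    (ha : IsAlignment (blockList s f K).flatten (blockList t g K').flatten a)
    (hg : ∀ j < K', 0 < g j) {j : ℕ} (hj : j < K') :
    Disjoint (blockPositions (blockList t g K').flatten j) (a.image Prod.snd) ↔
      ∀ i, alignmentPlan f g a i j = 0 := by
  have := ha.swap.disjoint_blockPositions_image_fst_iff hg hj
  rwa [Finset.map_eq_image, Finset.image_image, ← Finset.map_eq_image, alignmentPlan_map_swap]
    at this

end IsAlignment

end OfAlignment

/-! ### Changes of parity among the blocks that are not left out -/

/-- `k` is the element of `R` that immediately precedes `i`. -/
structure IsPred (R : Finset ℕ) (k i : ℕ) : Prop where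
  mem : k ∈ R
  lt : k < i
  le : ∀ m ∈ R, m < i → m ≤ k

open Classical in
/-- The elements of `R` whose parity differs from that of the preceding element of `R`. -/
noncomputable def changePoints (R : Finset ℕ) : Finset ℕ :=
  R.filter fun i => ∃ k, IsPred R k i ∧ ¬ (Even k ↔ Even i)

/-- The number of changes of parity between consecutive elements of `R` up to `i`. -/
noncomputable def changes (R : Finset ℕ) (i : ℕ) : ℕ := ((changePoints R).filter (· ≤ i)).card

section Changes

variable {R : Finset ℕ} {i i' k K : ℕ}

lemma IsPred.unique {k' : ℕ} (h : IsPred R k i) (h' : IsPred R k' i) : k = k' :=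
  le_antisymm (h'.le k h.mem h.lt) (h.le k' h'.mem h'.lt)

lemma exists_isPred (hk : k ∈ R) (hki : k < i) : ∃ p, IsPred R p i ∧ k ≤ p := by
  have hne : (R.filter (· < i)).Nonempty := ⟨k, Finset.mem_filter.2 ⟨hk, hki⟩⟩
  have hmem := Finset.mem_filter.1 (Finset.max'_mem _ hne)
  have hle : ∀ m ∈ R, m < i → m ≤ (R.filter (· < i)).max' hne := fun m hm hmi =>
    Finset.le_max' _ _ (Finset.mem_filter.2 ⟨hm, hmi⟩)
  exact ⟨_, ⟨hmem.1, hmem.2, hle⟩, hle k hk hki⟩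

lemma exists_isPred_of_lt (hi : i ∈ R) (hk : k ∈ R) (hik : i < k) :
    ∃ p ∈ R, IsPred R i p ∧ p ≤ k := by
  have hne : (R.filter (i < ·)).Nonempty := ⟨k, Finset.mem_filter.2 ⟨hk, hik⟩⟩
  have hmem := Finset.mem_filter.1 (Finset.min'_mem _ hne)
  have hle : ∀ m ∈ R, i < m → (R.filter (i < ·)).min' hne ≤ m := fun m hm him =>
    Finset.min'_le _ _ (Finset.mem_filter.2 ⟨hm, him⟩)
  exact ⟨_, hmem.1, ⟨hi, hmem.2, fun m hm hlt => not_lt.1 fun h => hlt.not_ge (hle m hm h)⟩,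
    hle k hk hik⟩

lemma mem_changePoints :
    i ∈ changePoints R ↔ i ∈ R ∧ ∃ k, IsPred R k i ∧ ¬ (Even k ↔ Even i) := by
  classical exact Finset.mem_filter

lemma changes_mono (R : Finset ℕ) : Monotone (changes R) := fun _ _ h =>
  Finset.card_le_card (Finset.monotone_filter_right _ fun _ _ hk => hk.trans h)

lemma changes_eq_zero (h : ∀ k ∈ R, i ≤ k) : changes R i = 0 := by
  rw [changes, Finset.card_eq_zero, Finset.filter_eq_empty_iff]
  intro k hk hki
  obtain ⟨-, k', hk', -⟩ := mem_changePoints.1 hk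
  exact ((h k' hk'.mem).trans_lt hk'.lt).not_ge hki

lemma IsPred.changes_eq (h : IsPred R k i) (hi : i ∈ R) :
    changes R i = changes R k + if (Even k ↔ Even i) then 0 else 1 := by
  have hmem : i ∈ changePoints R ↔ ¬ (Even k ↔ Even i) := by
    rw [mem_changePoints]
    exact ⟨fun ⟨_, _, hp, hpar⟩ => h.unique hp ▸ hpar, fun hpar => ⟨hi, k, h, hpar⟩⟩
  have hsplit : (changePoints R).filter (· ≤ i) =
      (changePoints R).filter (· ≤ k) ∪ (changePoints R).filter (· = i) := by
    rw [← Finset.filter_or]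
    refine Finset.filter_congr fun m hm => ⟨fun hmi => ?_, ?_⟩
    · exact hmi.lt_or_eq.imp_left (h.le m (mem_changePoints.1 hm).1)
    · rintro (hmk | rfl)
      exacts [hmk.trans h.lt.le, le_rfl]
  have hdisj : Disjoint ((changePoints R).filter (· ≤ k)) ((changePoints R).filter (· = i)) :=
    Finset.disjoint_filter.2 fun m _ hmk hmi => (hmi ▸ hmk).not_gt h.lt
  rw [changes, hsplit, Finset.card_union_of_disjoint hdisj, Finset.filter_eq']
  by_cases hpar : Even k ↔ Even i <;> simp [hmem, hpar, changes]

lemma changes_lt_changes_succ (hi : i ∈ R) (hi' : i + 1 ∈ R) :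
    changes R i < changes R (i + 1) := by
  have hpred : IsPred R i (i + 1) := ⟨hi, i.lt_succ_self, fun m _ h => Nat.lt_succ_iff.1 h⟩
  have hpar : ¬ (Even i ↔ Even (i + 1)) := by rw [Nat.even_add_one]; tauto
  rw [hpred.changes_eq hi', if_neg hpar]
  exact Nat.lt_succ_self _

lemma succ_notMem_of_changes_eq (hi : i ∈ R) (hlt : i < i') (h : changes R i = changes R i') :
    i + 1 ∉ R := fun hi' =>
  (changes_lt_changes_succ hi hi').not_ge (h ▸ changes_mono R (Nat.succ_le_of_lt hlt))

lemma pred_notMem_of_changes_eq (hi' : i' ∈ R) (hlt : i < i') (h : changes R i = changes R i') :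
    i' - 1 ∉ R := by
  obtain ⟨k, rfl⟩ := Nat.exists_eq_add_of_lt hlt
  exact fun hk =>
    (changes_lt_changes_succ hk hi').not_ge (h ▸ changes_mono R (Nat.le_add_right i k))

lemma card_filter_succ_notMem_le (R : Finset ℕ) (K : ℕ) :
    (R.filter fun i => i + 1 < K ∧ i + 1 ∉ R).card ≤ (Finset.range K \ R).card := by
  refine Finset.card_le_card_of_injOn (· + 1) (fun i hi => ?_) (add_left_injective 1).injOn
  exact Finset.mem_sdiff.2 ⟨Finset.mem_range.2 (Finset.mem_filter.1 hi).2.1,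
    (Finset.mem_filter.1 hi).2.2⟩

lemma card_filter_pred_notMem_le (hR : R ⊆ Finset.range K) :
    (R.filter fun i => 0 < i ∧ i - 1 ∉ R).card ≤ (Finset.range K \ R).card := by
  refine Finset.card_le_card_of_injOn (· - 1) (fun i hi => ?_) fun i hi i' hi' h => ?_
  · obtain ⟨hiR, hi⟩ := Finset.mem_filter.1 hi
    have hiK := Finset.mem_range.1 (hR hiR)
    exact Finset.mem_sdiff.2 ⟨Finset.mem_range.2 ((Nat.sub_le i 1).trans_lt hiK), hi.2⟩
  · have hpos := (Finset.mem_filter.1 hi).2.1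
    have hpos' := (Finset.mem_filter.1 hi').2.1
    simp only at h
    omega

lemma card_filter_changes_eq_le (hR : R ⊆ Finset.range K) :
    (R.filter fun i => ∃ i' ∈ R, i' ≠ i ∧ changes R i' = changes R i).card ≤
      2 * (Finset.range K \ R).card := by
  have hsubset : (R.filter fun i => ∃ i' ∈ R, i' ≠ i ∧ changes R i' = changes R i) ⊆
      (R.filter fun i => i + 1 < K ∧ i + 1 ∉ R) ∪ R.filter fun i => 0 < i ∧ i - 1 ∉ R := by
    intro i hi
    obtain ⟨hi, i', hi', hne, h⟩ := Finset.mem_filter.1 hi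
    rw [Finset.mem_union, Finset.mem_filter, Finset.mem_filter]
    have := Finset.mem_range.1 (hR hi')
    rcases hne.lt_or_gt with hlt | hlt
    · exact Or.inr ⟨hi, by omega, pred_notMem_of_changes_eq hi hlt h⟩
    · exact Or.inl ⟨hi, by omega, succ_notMem_of_changes_eq hi hlt h.symm⟩
  have := (Finset.card_le_card hsubset).trans (Finset.card_union_le _ _)
  have := card_filter_succ_notMem_le R K
  have := card_filter_pred_notMem_le hR
  omega

end Changes

/-! ### The graph of the aligned pairs of blocks -/

/-- The pairs of blocks, among the blocks that are not left out, that have to be aligned one to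
one. -/
noncomputable def singlePairs (R R' : Finset ℕ) : Finset (ℕ × ℕ) :=
  (R ×ˢ R').filter fun e => changes R e.1 = changes R' e.2 ∧
    (∀ i ∈ R, changes R i = changes R e.1 → i = e.1) ∧
    ∀ j ∈ R', changes R' j = changes R' e.2 → j = e.2

lemma mem_singlePairs {R R' : Finset ℕ} {i j : ℕ} :
    (i, j) ∈ singlePairs R R' ↔ (i ∈ R ∧ j ∈ R') ∧ changes R i = changes R' j ∧
      (∀ i' ∈ R, changes R i' = changes R i → i' = i) ∧
      ∀ j' ∈ R', changes R' j' = changes R' j → j' = j := by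
  rw [singlePairs, Finset.mem_filter, Finset.mem_product]

lemma swap_mem_singlePairs {R R' : Finset ℕ} {i j : ℕ} :
    (j, i) ∈ singlePairs R' R ↔ (i, j) ∈ singlePairs R R' := by
  simp only [mem_singlePairs]
  tauto

lemma fst_injOn_singlePairs (R R' : Finset ℕ) :
    Set.InjOn Prod.fst (singlePairs R R' : Set (ℕ × ℕ)) := by
  rintro ⟨i, j⟩ h ⟨i', j'⟩ h' rfl
  rw [Finset.mem_coe, mem_singlePairs] at h h'
  exact Prod.ext rfl (h'.2.2.2 j h.1.2 (h.2.1.symm.trans h'.2.1))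

lemma snd_injOn_singlePairs (R R' : Finset ℕ) :
    Set.InjOn Prod.snd (singlePairs R R' : Set (ℕ × ℕ)) := by
  rintro ⟨i, j⟩ h ⟨i', j'⟩ h' rfl
  rw [Finset.mem_coe, mem_singlePairs] at h h'
  exact Prod.ext (h'.2.2.1 i h.1.1 (h.2.1.trans h'.2.1.symm)) rfl

/-- The relation "some letters of the two blocks are aligned" of an alignment; `R` and `R'` are the
sets of the blocks that are not left out. -/
structure IsBlockGraph (s t : Bool) (R R' : Finset ℕ) (E : ℕ → ℕ → Prop) : Prop where
  chain : ∀ {i j i' j'}, E i j → E i' j' → i < i' → j ≤ j'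
  color : ∀ {i j}, E i j → letter s i = letter t j
  left : ∀ {i}, i ∈ R ↔ ∃ j, E i j
  right : ∀ {j}, j ∈ R' ↔ ∃ i, E i j

/-- Any two left out blocks of the same letter are separated by an edge of the block graph, unless
one of them comes after all the blocks that are not left out. -/
def IsSaturated (s t : Bool) (R R' : Finset ℕ) (E : ℕ → ℕ → Prop) : Prop :=
  ∀ u v, u ∉ R → v ∉ R' → (∃ i ∈ R, u < i) → (∃ j ∈ R', v < j) → letter s u = letter t v →
    ∃ i j, E i j ∧ ((i < u ∧ v < j) ∨ (u < i ∧ j < v))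

/-- The `i`-th block is aligned with two blocks that are aligned with no other block. -/
def HasTwoOwnNeighbors (E : ℕ → ℕ → Prop) (i : ℕ) : Prop :=
  ∃ j j', j ≠ j' ∧ E i j ∧ E i j' ∧ (∀ i', E i' j → i' = i) ∧ ∀ i', E i' j' → i' = i

namespace IsBlockGraph

variable {s t : Bool} {R R' : Finset ℕ} {E : ℕ → ℕ → Prop} {i j p q : ℕ}

lemma swap (h : IsBlockGraph s t R R' E) : IsBlockGraph t s R' R fun j i => E i j where
  chain {_ _ _ _} h₁ h₂ hlt := not_lt.1 fun hi => (h.chain h₂ h₁ hi).not_gt hlt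
  color hE := (h.color hE).symm
  left := h.right
  right := h.left

lemma exists_edge_isPred (h : IsBlockGraph s t R R' E) (hE : E i j) (hp : IsPred R p i)
    (hq : IsPred R' q j) : E p q ∨ E i q ∨ E p j := by
  obtain ⟨b, hb⟩ := h.left.1 hp.mem
  obtain ⟨a, ha⟩ := h.right.1 hq.mem
  rcases (h.chain hb hE hp.lt).eq_or_lt with rfl | hbj
  · exact Or.inr (Or.inr hb)
  rcases (h.swap.chain ha hE hq.lt).eq_or_lt with rfl | hai
  · exact Or.inr (Or.inl ha)
  rcases (hp.le a (h.left.2 ⟨q, ha⟩) hai).eq_or_lt with rfl | hap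
  · exact Or.inl ha
  · rw [le_antisymm (h.chain ha hb hap) (hq.le b (h.right.2 ⟨p, hb⟩) hbj)]
    exact Or.inl hb

lemma edge_of_isPred_left (h : IsBlockGraph s t R R' E) (hE : E i j) (hp : IsPred R p i)
    (hj : ∀ k ∈ R', j ≤ k) : E p j := by
  obtain ⟨b, hb⟩ := h.left.1 hp.mem
  rwa [le_antisymm (hj b (h.right.2 ⟨p, hb⟩)) (h.chain hb hE hp.lt)]

lemma even_iff_even_left (h : IsBlockGraph s t R R' E) (h₁ : E p j) (h₂ : E i j) :
    Even p ↔ Even i :=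
  (letter_eq_iff s p i).1 ((h.color h₁).trans (h.color h₂).symm)

lemma changes_eq_of_isPred_left (h : IsBlockGraph s t R R' E) (hp : IsPred R p i)
    (hpj : E p j) (hE : E i j) : changes R i = changes R p := by
  rw [hp.changes_eq (h.left.2 ⟨j, hE⟩), if_pos (h.even_iff_even_left hpj hE), add_zero]

lemma changes_eq_of_isPred (h : IsBlockGraph s t R R' E) (hp : IsPred R p i)
    (hq : IsPred R' q j) (hpq : E p q) (hE : E i j) (hc : changes R p = changes R' q) :
    changes R i = changes R' j := by
  have hparity : (Even p ↔ Even i) ↔ (Even q ↔ Even j) := by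
    rw [← letter_eq_iff s, ← letter_eq_iff t, h.color hpq, h.color hE]
  rw [hp.changes_eq (h.left.2 ⟨j, hE⟩), hq.changes_eq (h.right.2 ⟨i, hE⟩), hc]
  simp only [hparity]

/-- By induction along the edges: the preceding edge differs in one or in both of its ends, and as
aligned blocks carry the same letter, the parity changes at both ends or at none. -/
theorem changes_eq (h : IsBlockGraph s t R R' E) {i j : ℕ} (hE : E i j) :
    changes R i = changes R' j := by
  by_cases hi : ∃ p, IsPred R p i <;> by_cases hj : ∃ q, IsPred R' q j
  · obtain ⟨p, hp⟩ := hi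
    obtain ⟨q, hq⟩ := hj
    have := hp.lt
    have := hq.lt
    rcases h.exists_edge_isPred hE hp hq with hpq | hiq | hpj
    · exact h.changes_eq_of_isPred hp hq hpq hE (h.changes_eq hpq)
    · exact (h.changes_eq hiq).trans (h.swap.changes_eq_of_isPred_left hq hiq hE).symm
    · exact (h.changes_eq_of_isPred_left hp hpj hE).trans (h.changes_eq hpj)
  · obtain ⟨p, hp⟩ := hi
    have := hp.lt
    have hpj := h.edge_of_isPred_left hE hp fun k hk => not_lt.1 fun hkj =>
      hj ((exists_isPred hk hkj).imp fun _ => And.left)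
    exact (h.changes_eq_of_isPred_left hp hpj hE).trans (h.changes_eq hpj)
  · obtain ⟨q, hq⟩ := hj
    have := hq.lt
    have hiq := h.swap.edge_of_isPred_left hE hq fun k hk => not_lt.1 fun hki =>
      hi ((exists_isPred hk hki).imp fun _ => And.left)
    exact (h.changes_eq hiq).trans (h.swap.changes_eq_of_isPred_left hq hiq hE).symm
  · rw [changes_eq_zero fun k hk => not_lt.1 fun hki =>
        hi ((exists_isPred hk hki).imp fun _ => And.left),
      changes_eq_zero fun k hk => not_lt.1 fun hkj =>
        hj ((exists_isPred hk hkj).imp fun _ => And.left)]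
termination_by i + j

lemma eq_left_of_mem_singlePairs (h : IsBlockGraph s t R R' E) {i' : ℕ}
    (hs : (i, j) ∈ singlePairs R R') (hE : E i' j) : i' = i := by
  rw [mem_singlePairs] at hs
  exact hs.2.2.1 i' (h.left.2 ⟨j, hE⟩) ((h.changes_eq hE).trans hs.2.1.symm)

lemma eq_right_of_mem_singlePairs (h : IsBlockGraph s t R R' E) {j' : ℕ}
    (hs : (i, j) ∈ singlePairs R R') (hE : E i j') : j' = j :=
  h.swap.eq_left_of_mem_singlePairs (swap_mem_singlePairs.2 hs) hE

lemma edge_of_mem_singlePairs (h : IsBlockGraph s t R R' E) (hs : (i, j) ∈ singlePairs R R') :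
    E i j := by
  obtain ⟨j', hE⟩ := h.left.1 (mem_singlePairs.1 hs).1.1
  rwa [h.eq_right_of_mem_singlePairs hs hE] at hE

lemma trichotomy (h : IsBlockGraph s t R R' E) (hi : i ∈ R) :
    (∃ i' ∈ R, i' ≠ i ∧ changes R i' = changes R i) ∨ (∃ j, (i, j) ∈ singlePairs R R') ∨
      HasTwoOwnNeighbors E i := by
  refine or_iff_not_imp_left.2 fun hshared => ?_
  have hclass : ∀ i' ∈ R, changes R i' = changes R i → i' = i := fun i' hi' he =>
    by_contra fun hne => hshared ⟨i', hi', hne, he⟩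
  obtain ⟨j, hE⟩ := h.left.1 hi
  have hnbr : ∀ j', changes R' j' = changes R' j → ∀ i', E i' j' → i' = i := fun j' hc i' hE' =>
    hclass i' (h.left.2 ⟨j', hE'⟩) (by rw [h.changes_eq hE', hc, h.changes_eq hE])
  by_cases htwo : ∃ j' ∈ R', j' ≠ j ∧ changes R' j' = changes R' j
  · obtain ⟨j', hj', hne, hc⟩ := htwo
    obtain ⟨i', hE'⟩ := h.right.1 hj'
    obtain rfl := hnbr j' hc i' hE'
    exact Or.inr ⟨j, j', hne.symm, hE, hE', hnbr j rfl, hnbr j' hc⟩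
  · exact Or.inl ⟨j, mem_singlePairs.2 ⟨⟨hi, h.right.2 ⟨i, hE⟩⟩, h.changes_eq hE, hclass,
      fun j' hj' he => by_contra fun hne => htwo ⟨j', hj', hne, he⟩⟩⟩

lemma card_le_of_forall_two_edges (h : IsBlockGraph s t R R' E) {K' : ℕ}
    (hR' : R' ⊆ Finset.range K') {A : Finset ℕ} (hA : ∀ i ∈ A, ∃ j j', j ≠ j' ∧ E i j ∧ E i j') :
    A.card ≤ (Finset.range K' \ R').card := by
  have hordered : ∀ i ∈ A, ∃ j j', j < j' ∧ E i j ∧ E i j' := fun i hi => by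
    obtain ⟨j, j', hne, hj, hj'⟩ := hA i hi
    rcases hne.lt_or_gt with hlt | hlt
    exacts [⟨j, j', hlt, hj, hj'⟩, ⟨j', j, hlt, hj', hj⟩]
  choose! u v huv using hordered
  have hgap : ∀ i ∈ A, u i + 1 ∈ Finset.range K' \ R' := fun i hi => by
    obtain ⟨hlt, hu, hv⟩ := huv i hi
    have := Finset.mem_range.1 (hR' (h.right.2 ⟨i, hv⟩))
    exact Finset.mem_sdiff.2 ⟨Finset.mem_range.2 (by omega), succ_notMem_of_changes_eq
      (h.right.2 ⟨i, hu⟩) hlt ((h.changes_eq hu).symm.trans (h.changes_eq hv))⟩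
  have hlt_of_lt : ∀ i ∈ A, ∀ i' ∈ A, i < i' → u i < u i' := fun i hi i' hi' hlt =>
    (huv i hi).1.trans_le (h.chain (huv i hi).2.2 (huv i' hi').2.1 hlt)
  have hmono : StrictMonoOn u A := fun i hi i' hi' hlt => hlt_of_lt i hi i' hi' hlt
  exact Finset.card_le_card_of_injOn (fun i => u i + 1) hgap
    fun i hi i' hi' he => hmono.injOn hi hi' (Nat.succ_injective he)

lemma changes_lt_of_isSaturated (h : IsBlockGraph s t R R' E) (hsat : IsSaturated s t R R' E)
    (hp : IsPred R p i) (hq : IsPred R' q j) (hpq : E p q) (hij : E i j)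
    (hsep : ∀ u v, E u v → (u ≤ p ↔ v ≤ q)) : changes R p < changes R i := by
  refine (changes_mono R hp.lt.le).lt_of_ne fun hc => ?_
  have hc' : changes R' q = changes R' j := by rw [← h.changes_eq hpq, hc, h.changes_eq hij]
  have hpR := succ_notMem_of_changes_eq hp.mem hp.lt hc
  have hqR := succ_notMem_of_changes_eq hq.mem hq.lt hc'
  have hpi : p + 1 < i := lt_of_le_of_ne hp.lt fun he => hpR (he ▸ h.left.2 ⟨j, hij⟩)
  have hqj : q + 1 < j := lt_of_le_of_ne hq.lt fun he => hqR (he ▸ h.right.2 ⟨i, hij⟩)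
  obtain ⟨u, v, huv, hcross⟩ := hsat (p + 1) (q + 1) hpR hqR ⟨i, h.left.2 ⟨j, hij⟩, hpi⟩
    ⟨j, h.right.2 ⟨i, hij⟩, hqj⟩ (by rw [letter_succ, letter_succ, h.color hpq])
  have := hsep u v huv
  omega

lemma exists_next_edge (h : IsBlockGraph s t R R' E) (hE : E i j)
    (hi : ∀ j', E i j' → j' = j) (hj : ∀ i', E i' j → i' = i) (hp : IsPred R i p) (hpR : p ∈ R) :
    ∃ q, IsPred R' j q ∧ E p q := by
  obtain ⟨b, hb⟩ := h.left.1 hpR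
  have hjb : j < b := (h.chain hE hb hp.lt).lt_of_ne fun he => hp.lt.ne' (hj p (he ▸ hb))
  obtain ⟨q, hqR, hq, hqb⟩ := exists_isPred_of_lt (h.right.2 ⟨i, hE⟩) (h.right.2 ⟨p, hb⟩) hjb
  obtain ⟨a, ha⟩ := h.right.1 hqR
  have hia : i < a := (h.swap.chain hE ha hq.lt).lt_of_ne fun he => hq.lt.ne' (hi q (he ▸ ha))
  have hpa : p ≤ a := not_lt.1 fun hap => hia.not_ge (hp.le a (h.left.2 ⟨q, ha⟩) hap)
  rcases hpa.eq_or_lt with rfl | hpa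
  · exact ⟨q, hq, ha⟩
  · exact ⟨q, hq, le_antisymm hqb (h.chain hb ha hpa) ▸ hb⟩

lemma exists_prev_edge (h : IsBlockGraph s t R R' E) (hE : E i j)
    (hi : ∀ j', E i j' → j' = j) (hj : ∀ i', E i' j → i' = i) (hp : IsPred R p i) :
    ∃ q, IsPred R' q j ∧ E p q := by
  obtain ⟨b, hb⟩ := h.left.1 hp.mem
  have hbj : b < j := (h.chain hb hE hp.lt).lt_of_ne fun he => hp.lt.ne (hj p (he ▸ hb))
  obtain ⟨q, hq, -⟩ := exists_isPred (h.right.2 ⟨p, hb⟩) hbj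
  rcases h.exists_edge_isPred hE hp hq with hpq | hiq | hpj
  · exact ⟨q, hq, hpq⟩
  · exact absurd (hi q hiq) hq.lt.ne
  · exact absurd (hj p hpj) hp.lt.ne

lemma eq_of_changes_eq (h : IsBlockGraph s t R R' E) (hsat : IsSaturated s t R R' E)
    (hE : E i j) (hi : ∀ j', E i j' → j' = j) (hj : ∀ i', E i' j → i' = i) {i' : ℕ} (hi' : i' ∈ R)
    (hc : changes R i' = changes R i) : i' = i := by
  have hiR := h.left.2 ⟨j, hE⟩
  rcases lt_trichotomy i' i with hlt | heq | hlt
  · obtain ⟨p, hp, hip⟩ := exists_isPred hi' hlt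
    obtain ⟨q, hq, hpq⟩ := h.exists_prev_edge hE hi hj hp
    have := hp.lt
    have := hq.lt
    have := h.changes_lt_of_isSaturated hsat hp hq hpq hE fun u v huv => by
      have := hp.le u (h.left.2 ⟨v, huv⟩)
      have := hq.le v (h.right.2 ⟨u, huv⟩)
      have := h.chain huv hE
      have := h.chain hE huv
      have hleft : v = j → u = i := fun he => hj u (he ▸ huv)
      have hright : u = i → v = j := fun he => hi v (he ▸ huv)
      omega
    have := changes_mono R hip
    omega
  · exact heq
  · obtain ⟨p, hpR, hp, hpi⟩ := exists_isPred_of_lt hiR hi' hlt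
    obtain ⟨q, hq, hpq⟩ := h.exists_next_edge hE hi hj hp hpR
    have := h.changes_lt_of_isSaturated hsat hp hq hE hpq fun u v huv => by
      have := h.chain huv hE
      have := h.chain hE huv
      have hleft : v = j → u = i := fun he => hj u (he ▸ huv)
      have hright : u = i → v = j := fun he => hi v (he ▸ huv)
      omega
    have := changes_mono R hpi
    omega

lemma mem_singlePairs_of_isSaturated (h : IsBlockGraph s t R R' E)
    (hsat : IsSaturated s t R R' E) (hE : E i j) (hi : ∀ j', E i j' → j' = j)
    (hj : ∀ i', E i' j → i' = i) : (i, j) ∈ singlePairs R R' := by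
  have hclass : ∀ i' ∈ R, changes R i' = changes R i → i' = i := fun i' hi' =>
    h.eq_of_changes_eq hsat hE hi hj hi'
  refine mem_singlePairs.2 ⟨⟨h.left.2 ⟨j, hE⟩, h.right.2 ⟨i, hE⟩⟩, h.changes_eq hE, hclass,
    fun j' hj' hc => ?_⟩
  obtain ⟨i', hE'⟩ := h.right.1 hj'
  obtain rfl := hclass i' (h.left.2 ⟨j', hE'⟩) (by rw [h.changes_eq hE', hc, h.changes_eq hE])
  exact hi j' hE'

end IsBlockGraph

/-! ### Changing the length of a block -/

/-- Some letter of a block aligned with the `i`-th block is free. -/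
def HasFreeNeighbor (g : ℕ → ℕ) (K : ℕ) (w : ℕ → ℕ → ℕ) (i : ℕ) : Prop :=
  ∃ j, w i j ≠ 0 ∧ ∑ i' ∈ Finset.range K, w i' j < g j

/-- All letters of the `i`-th block are aligned. -/
def IsFull (f : ℕ → ℕ) (K' : ℕ) (w : ℕ → ℕ → ℕ) (i : ℕ) : Prop :=
  ∑ j ∈ Finset.range K', w i j = f i

/-- The plan `w` with one more aligned pair of letters in the blocks `u` and `v`. -/
def addPair (w : ℕ → ℕ → ℕ) (u v i j : ℕ) : ℕ := w i j + if i = u ∧ j = v then 1 else 0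

section AddPair

variable {w : ℕ → ℕ → ℕ} {K K' u v i j : ℕ}

lemma addPair_ne_zero (h : addPair w u v i j ≠ 0) : w i j ≠ 0 ∨ (i = u ∧ j = v) := by
  rw [addPair] at h
  split_ifs at h with hij
  exacts [Or.inr hij, Or.inl h]

lemma sum_addPair_row (hv : v < K') (i : ℕ) :
    ∑ j ∈ Finset.range K', addPair w u v i j =
      ∑ j ∈ Finset.range K', w i j + if i = u then 1 else 0 := by
  simp only [addPair, Finset.sum_add_distrib]
  by_cases hi : i = u <;> simp [hi, hv]

lemma sum_addPair_col (hu : u < K) (j : ℕ) :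
    ∑ i ∈ Finset.range K, addPair w u v i j =
      ∑ i ∈ Finset.range K, w i j + if j = v then 1 else 0 := by
  simp only [addPair, Finset.sum_add_distrib]
  by_cases hj : j = v <;> simp [hj, hu]

lemma weight_addPair (hu : u < K) (hv : v < K') :
    weight K K' (addPair w u v) = weight K K' w + 1 := by
  simp only [weight, sum_addPair_row hv, Finset.sum_add_distrib]
  simp [hu]

lemma exists_eq_addPair (h : w u v ≠ 0) : ∃ w', w = addPair w' u v := by
  refine ⟨fun i j => w i j - if i = u ∧ j = v then 1 else 0, ?_⟩
  funext i j
  rw [addPair, Nat.sub_add_cancel]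
  split_ifs with hij
  · exact hij.1 ▸ hij.2 ▸ Nat.one_le_iff_ne_zero.2 h
  · exact Nat.zero_le _

end AddPair

namespace IsPlan

variable {s t : Bool} {f g : ℕ → ℕ} {K K' : ℕ} {w w' : ℕ → ℕ → ℕ}

lemma of_le (hw : IsPlan s t f g K K' w) {f' : ℕ → ℕ} (hle : ∀ i j, w' i j ≤ w i j)
    (hrow : ∀ i < K, ∑ j ∈ Finset.range K', w' i j ≤ f' i) : IsPlan s t f' g K K' w' where
  bound i j h := hw.bound i j (Nat.ne_zero_of_lt ((Nat.pos_of_ne_zero h).trans_le (hle i j)))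
  color i j h := hw.color i j (Nat.ne_zero_of_lt ((Nat.pos_of_ne_zero h).trans_le (hle i j)))
  chain i j i' j' h h' :=
    hw.chain i j i' j' (Nat.ne_zero_of_lt ((Nat.pos_of_ne_zero h).trans_le (hle i j)))
      (Nat.ne_zero_of_lt ((Nat.pos_of_ne_zero h').trans_le (hle i' j')))
  row := hrow
  col j hj := (Finset.sum_le_sum fun i _ => hle i j).trans (hw.col j hj)

lemma addPair (hw : IsPlan s t f g K K' w) {f' : ℕ → ℕ} {u v : ℕ} (hu : u < K) (hv : v < K')
    (hcolor : letter s u = letter t v)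
    (hchain : ∀ i j, w i j ≠ 0 → (i < u → j ≤ v) ∧ (u < i → v ≤ j))
    (hf : ∀ i < K, i ≠ u → f i ≤ f' i) (hfu : ∑ j ∈ Finset.range K', w u j < f' u)
    (hgv : ∑ i ∈ Finset.range K, w i v < g v) : IsPlan s t f' g K K' (addPair w u v) where
  bound i j h := by
    rcases addPair_ne_zero h with h | ⟨rfl, rfl⟩
    exacts [hw.bound i j h, ⟨hu, hv⟩]
  color i j h := by
    rcases addPair_ne_zero h with h | ⟨rfl, rfl⟩
    exacts [hw.color i j h, hcolor]
  chain i j i' j' h h' hlt := by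
    rcases addPair_ne_zero h with hij | ⟨rfl, rfl⟩ <;>
      rcases addPair_ne_zero h' with hij' | ⟨rfl, rfl⟩
    exacts [hw.chain i j i' j' hij hij' hlt, (hchain i j hij).1 hlt, (hchain i' j' hij').2 hlt,
      le_rfl]
  row i hi := by
    rw [sum_addPair_row hv]
    split_ifs with h
    exacts [h ▸ hfu, (hw.row i hi).trans (hf i hi h)]
  col j hj := by
    rw [sum_addPair_col hu]
    split_ifs with h
    exacts [h ▸ hgv, hw.col j hj]

lemma exists_lengthen (hw : IsPlan s t f g K K' w) {i : ℕ} (h : HasFreeNeighbor g K w i) :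
    ∃ w', IsPlan s t (Function.update f i (f i + 1)) g K K' w' ∧
      weight K K' w' = weight K K' w + 1 := by
  obtain ⟨j, hne, hlt⟩ := h
  obtain ⟨hi, hj⟩ := hw.bound i j hne
  refine ⟨_, hw.addPair hi hj (hw.color i j hne) (fun i' j' h' =>
    ⟨hw.chain i' j' i j h' hne, hw.chain i j i' j' hne h'⟩) (fun i' _ hi' => ?_) ?_ hlt,
    weight_addPair hi hj⟩
  · rw [Function.update_of_ne hi']
  · rw [Function.update_self]
    exact Nat.lt_succ_of_le (hw.row i hi)

open Classical in
lemma exists_shorten (hw : IsPlan s t f g K K' w) {i : ℕ} (hi : i < K) (hf : 0 < f i) :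
    ∃ w', IsPlan s t (Function.update f i (f i - 1)) g K K' w' ∧ (∀ a b, w' a b ≤ w a b) ∧
      (∀ a b, a ≠ i → w' a b = w a b) ∧
      weight K K' w ≤ weight K K' w' + if IsFull f K' w i then 1 else 0 := by
  by_cases hfull : IsFull f K' w i
  · obtain ⟨j, hj, hne⟩ := Finset.exists_ne_zero_of_sum_ne_zero (hfull.trans_ne hf.ne')
    rw [Finset.mem_range] at hj
    obtain ⟨w', rfl⟩ := exists_eq_addPair hne
    refine ⟨w', hw.of_le (fun _ _ => Nat.le_add_right _ _) fun a ha => ?_,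
      fun _ _ => Nat.le_add_right _ _, fun a b ha => ?_, ?_⟩
    · have hrow := hw.row a ha
      rw [sum_addPair_row hj] at hrow
      rcases eq_or_ne a i with rfl | hai
      · rw [Function.update_self]
        exact Nat.le_sub_one_of_lt (by simpa using hrow)
      · simpa [hai] using hrow
    · simp [BlockLCS.addPair, ha]
    · rw [weight_addPair hi hj, if_pos hfull]
  · refine ⟨w, hw.of_le (fun _ _ => le_rfl) fun a ha => ?_, fun _ _ => le_rfl, fun _ _ _ => rfl,
      Nat.le_add_right _ _⟩
    rcases eq_or_ne a i with rfl | hai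
    · rw [Function.update_self]
      exact Nat.le_sub_one_of_lt ((hw.row a ha).lt_of_ne hfull)
    · rw [Function.update_of_ne hai]
      exact hw.row a ha

open Classical in
theorem weight_le_lcsLength_update (hw : IsPlan s t f g K K' w) {i j : ℕ} (hj : j < K)
    (hij : i ≠ j) (hf : 0 < f j) :
    weight K K' w + (if HasFreeNeighbor g K w i then 1 else 0) ≤
      lcsLength (blockList s (Function.update (Function.update f i (f i + 1)) j (f j - 1))
        K).flatten (blockList t g K').flatten + (if IsFull f K' w j then 1 else 0) := by
  obtain ⟨w₁, hw₁, hle, hother, hweight⟩ := hw.exists_shorten hj hf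
  have hupdate : Function.update (Function.update f i (f i + 1)) j (f j - 1) =
      Function.update (Function.update f j (f j - 1)) i (Function.update f j (f j - 1) i + 1) := by
    rw [Function.update_comm hij, Function.update_of_ne hij]
  rw [hupdate]
  by_cases hfree : HasFreeNeighbor g K w i
  · have hfree₁ : HasFreeNeighbor g K w₁ i := by
      obtain ⟨b, hb, hlt⟩ := hfree
      exact ⟨b, by rwa [hother i b hij], (Finset.sum_le_sum fun a _ => hle a b).trans_lt hlt⟩
    obtain ⟨w₂, hw₂, hweight₂⟩ := hw₁.exists_lengthen hfree₁
    have := hw₂.weight_le_lcsLength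
    rw [if_pos hfree]
    omega
  · have hw₂ := hw₁.of_le (f' := Function.update (Function.update f j (f j - 1)) i
        (Function.update f j (f j - 1) i + 1)) (fun _ _ => le_rfl) fun a ha =>
      (hw₁.row a ha).trans (le_update_iff.2 ⟨Nat.le_succ _, fun _ _ => le_rfl⟩ a)
    have := hw₂.weight_le_lcsLength
    rw [if_neg hfree]
    omega

end IsPlan

/-- The blocks of the first string that are not left out. -/
def usedRows (K K' : ℕ) (w : ℕ → ℕ → ℕ) : Finset ℕ :=
  (Finset.range K).filter fun i => ∃ j < K', w i j ≠ 0

/-- The blocks of the second string that are not left out. -/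
def usedCols (K K' : ℕ) (w : ℕ → ℕ → ℕ) : Finset ℕ := usedRows K' K fun j i => w i j

lemma usedRows_subset (K K' : ℕ) (w : ℕ → ℕ → ℕ) : usedRows K K' w ⊆ Finset.range K :=
  Finset.filter_subset _ _

lemma usedCols_subset (K K' : ℕ) (w : ℕ → ℕ → ℕ) : usedCols K K' w ⊆ Finset.range K' :=
  usedRows_subset _ _ _

namespace IsPlan

variable {s t : Bool} {f g : ℕ → ℕ} {K K' : ℕ} {w : ℕ → ℕ → ℕ}

lemma mem_usedRows (hw : IsPlan s t f g K K' w) {i : ℕ} :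
    i ∈ usedRows K K' w ↔ ∃ j, w i j ≠ 0 := by
  rw [usedRows, Finset.mem_filter, Finset.mem_range]
  exact ⟨fun ⟨_, j, _, h⟩ => ⟨j, h⟩, fun ⟨j, h⟩ => ⟨(hw.bound i j h).1, j, (hw.bound i j h).2, h⟩⟩

lemma mem_usedCols (hw : IsPlan s t f g K K' w) {j : ℕ} :
    j ∈ usedCols K K' w ↔ ∃ i, w i j ≠ 0 :=
  hw.swap.mem_usedRows

lemma isBlockGraph (hw : IsPlan s t f g K K' w) :
    IsBlockGraph s t (usedRows K K' w) (usedCols K K' w) fun i j => w i j ≠ 0 where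
  chain h h' := hw.chain _ _ _ _ h h'
  color h := hw.color _ _ h
  left := hw.mem_usedRows
  right := hw.mem_usedCols

lemma isSaturated (hw : IsPlan s t f g K K' w) (hf : ∀ i < K, 0 < f i) (hg : ∀ j < K', 0 < g j)
    (hopt : lcsLength (blockList s f K).flatten (blockList t g K').flatten ≤ weight K K' w) :
    IsSaturated s t (usedRows K K' w) (usedCols K K' w) fun i j => w i j ≠ 0 := by
  rintro u v hu hv ⟨i, hi, hui⟩ ⟨j, hj, hvj⟩ hcolor
  by_contra hcross
  push Not at hcross
  have huK : u < K := hui.trans (Finset.mem_range.1 (usedRows_subset _ _ _ hi))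
  have hvK : v < K' := hvj.trans (Finset.mem_range.1 (usedCols_subset _ _ _ hj))
  have hrow : ∀ b, w u b = 0 := fun b => not_not.1 fun h => hu (hw.mem_usedRows.2 ⟨b, h⟩)
  have hcol : ∀ a, w a v = 0 := fun a => not_not.1 fun h => hv (hw.mem_usedCols.2 ⟨a, h⟩)
  have hplan := hw.addPair (f' := f) huK hvK hcolor hcross (fun _ _ _ => le_rfl)
    (by simpa [hrow] using hf u huK) (by simpa [hcol] using hg v hvK)
  have := hplan.weight_le_lcsLength
  have := weight_addPair (w := w) huK hvK
  omega

end IsPlan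

/-! ### Counting blocks of the different kinds -/

/-- All lengths `f 0, …, f (k - 1)` are `l - 1`, `l` or `l + 1`, and `f k` is the length of a
possibly truncated block. -/
structure IsBlockLengths (l k : ℕ) (f : ℕ → ℕ) : Prop where
  mem : ∀ i < k, f i = l - 1 ∨ f i = l ∨ f i = l + 1
  pos : 0 < f k
  le : f k ≤ l + 1

/-- The blocks of the first string that are last or form a single pair with a last block. -/
noncomputable def outerRows (k k' : ℕ) (R R' : Finset ℕ) : Finset ℕ :=
  {k} ∪ ((singlePairs R R').filter fun e => e.2 = k').image Prod.fst

/-- The number of pairs of blocks of lengths `x` and `y`. -/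
def pairCount (M : Finset (ℕ × ℕ)) (f g : ℕ → ℕ) (x y : ℕ) : ℕ :=
  (M.filter fun e => f e.1 = x ∧ g e.2 = y).card

/-- The blocks of length `x` among the first `K` ones. -/
def blocksOfLength (f : ℕ → ℕ) (K x : ℕ) : Finset ℕ := (Finset.range K).filter fun i => f i = x

/-- The single pairs that contain neither of the last, possibly truncated blocks. -/
noncomputable def innerPairs (k k' : ℕ) (R R' : Finset ℕ) : Finset (ℕ × ℕ) :=
  (singlePairs R R').filter fun e => e.1 < k ∧ e.2 < k'

section Counting

variable {l k k' K : ℕ} {f g : ℕ → ℕ} {R R' : Finset ℕ}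

lemma mem_blocksOfLength {x i : ℕ} : i ∈ blocksOfLength f K x ↔ i < K ∧ f i = x := by
  rw [blocksOfLength, Finset.mem_filter, Finset.mem_range]

lemma mem_innerPairs {i j : ℕ} :
    (i, j) ∈ innerPairs k k' R R' ↔ (i, j) ∈ singlePairs R R' ∧ i < k ∧ j < k' :=
  Finset.mem_filter

lemma IsBlockLengths.pos_of_lt (h : IsBlockLengths l k f) (hl : 2 ≤ l) : ∀ i < k + 1, 0 < f i := by
  intro i hi
  rcases (Nat.lt_succ_iff.1 hi).lt_or_eq with hik | rfl
  · have := h.mem i hik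
    omega
  · exact h.pos

lemma IsBlockLengths.le_of_lt (h : IsBlockLengths l k f) : ∀ i < k + 1, f i ≤ l + 1 := by
  intro i hi
  rcases (Nat.lt_succ_iff.1 hi).lt_or_eq with hik | rfl
  · have := h.mem i hik
    omega
  · exact h.le

lemma IsBlockLengths.lt_add (h : IsBlockLengths l k f) (hl : 2 ≤ l) {i i' : ℕ} (hne : i ≠ i')
    (hi : i < k + 1) (hi' : i' < k + 1) : l - 1 < f i + f i' := by
  have := h.pos_of_lt hl i hi
  have := h.pos_of_lt hl i' hi'
  rcases (Nat.lt_succ_iff.1 hi).lt_or_eq with hik | rfl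
  · have := h.mem i hik
    omega
  · have := h.mem i' (by omega)
    omega

lemma sum_pairCount (M : Finset (ℕ × ℕ)) (f g : ℕ → ℕ) (x : ℕ) (T : Finset ℕ) :
    ∑ y ∈ T, pairCount M f g x y = (M.filter fun e => f e.1 = x ∧ g e.2 ∈ T).card := by
  rw [Finset.card_eq_sum_card_fiberwise (f := fun e => g e.2) (t := T)
    fun e he => (Finset.mem_filter.1 he).2.2]
  refine Finset.sum_congr rfl fun y hy => congrArg Finset.card ?_
  rw [Finset.filter_filter]
  exact Finset.filter_congr fun e _ => ⟨fun h => ⟨⟨h.1, h.2 ▸ hy⟩, h.2⟩, fun h => ⟨h.1.1, h.2⟩⟩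

lemma pairCount_add {x y y' : ℕ} (M : Finset (ℕ × ℕ)) (h : y ≠ y') :
    pairCount M f g x y + pairCount M f g x y' =
      (M.filter fun e => f e.1 = x ∧ g e.2 ∈ ({y, y'} : Finset ℕ)).card := by
  rw [← sum_pairCount, Finset.sum_pair h]

lemma pairCount_add_add (M : Finset (ℕ × ℕ)) {x l : ℕ} (hl : 1 ≤ l) :
    pairCount M f g x (l - 1) + pairCount M f g x l + pairCount M f g x (l + 1) =
      (M.filter fun e => f e.1 = x ∧ g e.2 ∈ ({l - 1, l, l + 1} : Finset ℕ)).card := by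
  rw [← sum_pairCount, Finset.sum_insert (by simp; omega), Finset.sum_pair (by simp), add_assoc]

lemma card_image_fst_innerPairs {M : Finset (ℕ × ℕ)} (hM : M ⊆ innerPairs k k' R R') :
    (M.image Prod.fst).card = M.card :=
  Finset.card_image_of_injOn ((fst_injOn_singlePairs R R').mono
    (Finset.coe_subset.2 (hM.trans (Finset.filter_subset _ _))))

lemma card_outerRows_le (k k' : ℕ) (R R' : Finset ℕ) : (outerRows k k' R R').card ≤ 2 := by
  refine (Finset.card_union_le _ _).trans ?_
  rw [Finset.card_singleton, add_comm]
  refine Nat.succ_le_succ (Finset.card_image_le.trans (Finset.card_le_one.2 fun e he e' he' => ?_))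
  rw [Finset.mem_filter] at he he'
  exact snd_injOn_singlePairs R R' he.1 he'.1 (he.2.trans he'.2.symm)

lemma mem_outerRows_or_mem_innerPairs (hR : R ⊆ Finset.range (k + 1))
    (hR' : R' ⊆ Finset.range (k' + 1)) {i j : ℕ} (h : (i, j) ∈ singlePairs R R') :
    i ∈ outerRows k k' R R' ∨ (i, j) ∈ innerPairs k k' R R' := by
  obtain ⟨hiR, hjR⟩ := (mem_singlePairs.1 h).1
  have hi := Nat.lt_succ_iff_lt_or_eq.1 (Finset.mem_range.1 (hR hiR))
  have hj := Nat.lt_succ_iff_lt_or_eq.1 (Finset.mem_range.1 (hR' hjR))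
  rcases hi with hi | rfl
  · rcases hj with hj | rfl
    · exact Or.inr (mem_innerPairs.2 ⟨h, hi, hj⟩)
    · exact Or.inl (Finset.mem_union_right _ (Finset.mem_image.2
        ⟨(i, j), Finset.mem_filter.2 ⟨h, rfl⟩, rfl⟩))
  · exact Or.inl (Finset.mem_union_left _ (Finset.mem_singleton_self i))

end Counting

namespace IsBlockGraph

variable {s t : Bool} {R R' : Finset ℕ} {E : ℕ → ℕ → Prop} {k k' : ℕ} {A : Finset ℕ}

lemma card_le [DecidablePred (HasTwoOwnNeighbors E)] (h : IsBlockGraph s t R R' E)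
    (hR : R ⊆ Finset.range (k + 1))
    (hR' : R' ⊆ Finset.range (k' + 1)) (hA : A ⊆ Finset.range (k + 1)) :
    A.card ≤ ((innerPairs k k' R R').filter fun e => e.1 ∈ A).card +
      3 * (Finset.range (k + 1) \ R).card + (A.filter (HasTwoOwnNeighbors E)).card + 2 := by
  set inner := (innerPairs k k' R R').filter fun e => e.1 ∈ A
  set shared := R.filter fun i => ∃ i' ∈ R, i' ≠ i ∧ changes R i' = changes R i
  set twoOwn := A.filter (HasTwoOwnNeighbors E)
  have hcover : A ⊆ inner.image Prod.fst ∪ ((Finset.range (k + 1) \ R) ∪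
      (shared ∪ (twoOwn ∪ outerRows k k' R R'))) := fun i hi => by
    simp only [Finset.mem_union]
    by_cases hiR : i ∈ R
    · rcases h.trichotomy hiR with hshared | ⟨j, hj⟩ | htwo
      · exact Or.inr (Or.inr (Or.inl (Finset.mem_filter.2 ⟨hiR, hshared⟩)))
      · rcases mem_outerRows_or_mem_innerPairs hR hR' hj with hout | hin
        · exact Or.inr (Or.inr (Or.inr (Or.inr hout)))
        · exact Or.inl (Finset.mem_image.2 ⟨(i, j), Finset.mem_filter.2 ⟨hin, hi⟩, rfl⟩)
      · exact Or.inr (Or.inr (Or.inr (Or.inl (Finset.mem_filter.2 ⟨hi, htwo⟩))))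
    · exact Or.inr (Or.inl (Finset.mem_sdiff.2 ⟨hA hi, hiR⟩))
  have := Finset.card_le_card hcover
  have := Finset.card_union_le (inner.image Prod.fst) ((Finset.range (k + 1) \ R) ∪
    (shared ∪ (twoOwn ∪ outerRows k k' R R')))
  have := Finset.card_union_le (Finset.range (k + 1) \ R)
    (shared ∪ (twoOwn ∪ outerRows k k' R R'))
  have := Finset.card_union_le shared (twoOwn ∪ outerRows k k' R R')
  have := Finset.card_union_le twoOwn (outerRows k k' R R')
  have : (inner.image Prod.fst).card = inner.card :=
    card_image_fst_innerPairs (Finset.filter_subset _ _)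
  have : shared.card ≤ 2 * (Finset.range (k + 1) \ R).card := card_filter_changes_eq_le hR
  have := card_outerRows_le k k' R R'
  omega

lemma card_le_add_card_sdiff (h : IsBlockGraph s t R R' E) (hR : R ⊆ Finset.range (k + 1))
    (hR' : R' ⊆ Finset.range (k' + 1)) (hA : A ⊆ Finset.range (k + 1)) :
    A.card ≤ ((innerPairs k k' R R').filter fun e => e.1 ∈ A).card +
      3 * (Finset.range (k + 1) \ R).card + (Finset.range (k' + 1) \ R').card + 2 := by
  classical
  have := h.card_le hR hR' hA
  have := h.card_le_of_forall_two_edges hR' (A := A.filter (HasTwoOwnNeighbors E)) fun i hi =>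
    let ⟨j, j', hne, hj, hj', _⟩ := (Finset.mem_filter.1 hi).2
    ⟨j, j', hne, hj, hj'⟩
  omega

end IsBlockGraph

namespace IsPlan

/-- The inner pairs of the graph of the aligned pairs of blocks of the plan `w`. -/
noncomputable abbrev innerPairs (k k' : ℕ) (w : ℕ → ℕ → ℕ) : Finset (ℕ × ℕ) :=
  BlockLCS.innerPairs k k' (usedRows (k + 1) (k' + 1) w) (usedCols (k + 1) (k' + 1) w)

variable {l k k' K K' i j : ℕ} {s t : Bool} {f g : ℕ → ℕ} {w : ℕ → ℕ → ℕ}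

lemma sum_col_eq (hw : IsPlan s t f g K K' w) (hij : w i j ≠ 0)
    (h : ∀ i', w i' j ≠ 0 → i' = i) : ∑ i' ∈ Finset.range K, w i' j = w i j :=
  Finset.sum_eq_single_of_mem i (Finset.mem_range.2 (hw.bound i j hij).1)
    fun i' _ hne => not_not.1 (mt (h i') hne)

lemma sum_row_eq (hw : IsPlan s t f g K K' w) (hij : w i j ≠ 0)
    (h : ∀ j', w i j' ≠ 0 → j' = j) : ∑ j' ∈ Finset.range K', w i j' = w i j :=
  hw.swap.sum_col_eq hij h

lemma le_sum_row (hw : IsPlan s t f g K K' w) (T : Finset ℕ) (i : ℕ) :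
    ∑ j ∈ T, w i j ≤ ∑ j ∈ Finset.range K', w i j := by
  refine Finset.sum_le_sum_of_ne_zero fun j _ hne => ?_
  exact Finset.mem_range.2 (hw.bound i j hne).2

lemma hasFreeNeighbor_of_mem_singlePairs (hw : IsPlan s t f g K K' w)
    (h : (i, j) ∈ singlePairs (usedRows K K' w) (usedCols K K' w)) (hlt : f i < g j) :
    HasFreeNeighbor g K w i := by
  have hij : w i j ≠ 0 := hw.isBlockGraph.edge_of_mem_singlePairs h
  refine ⟨j, hij, ?_⟩
  calc ∑ i' ∈ Finset.range K, w i' j = w i j :=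
        hw.sum_col_eq hij fun _ => hw.isBlockGraph.eq_left_of_mem_singlePairs h
    _ = ∑ j' ∈ Finset.range K', w i j' :=
        (hw.sum_row_eq hij fun _ => hw.isBlockGraph.eq_right_of_mem_singlePairs h).symm
    _ ≤ f i := hw.row i (hw.bound i j hij).1
    _ < g j := hlt

lemma not_isFull_of_mem_singlePairs (hw : IsPlan s t f g K K' w)
    (h : (i, j) ∈ singlePairs (usedRows K K' w) (usedCols K K' w)) (hlt : g j < f i) :
    ¬ IsFull f K' w i := by
  have hij : w i j ≠ 0 := hw.isBlockGraph.edge_of_mem_singlePairs h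
  refine ne_of_lt ?_
  calc ∑ j' ∈ Finset.range K', w i j' = w i j :=
        hw.sum_row_eq hij fun _ => hw.isBlockGraph.eq_right_of_mem_singlePairs h
    _ = ∑ i' ∈ Finset.range K, w i' j :=
        (hw.sum_col_eq hij fun _ => hw.isBlockGraph.eq_left_of_mem_singlePairs h).symm
    _ ≤ g j := hw.col j (hw.bound i j hij).2
    _ < f i := hlt

lemma hasFreeNeighbor_of_hasTwoOwnNeighbors (hw : IsPlan s t f g K K' w)
    (h : HasTwoOwnNeighbors (fun i j => w i j ≠ 0) i)
    (hlt : ∀ j j', j ≠ j' → j < K' → j' < K' → f i < g j + g j') : HasFreeNeighbor g K w i := by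
  obtain ⟨j, j', hne, hj, hj', hown, hown'⟩ := h
  have hsum : w i j + w i j' ≤ f i := calc
    w i j + w i j' = ∑ b ∈ {j, j'}, w i b := (Finset.sum_pair hne).symm
    _ ≤ ∑ b ∈ Finset.range K', w i b := hw.le_sum_row _ i
    _ ≤ f i := hw.row i (hw.bound i j hj).1
  have := hlt j j' hne (hw.bound i j hj).2 (hw.bound i j' hj').2
  by_cases hfree : w i j < g j
  · exact ⟨j, hj, by rwa [hw.sum_col_eq hj hown]⟩
  · refine ⟨j', hj', ?_⟩
    rw [hw.sum_col_eq hj' hown']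
    omega

lemma card_short_le [DecidablePred (HasFreeNeighbor g (k + 1) w)]
    (hw : IsPlan s t f g (k + 1) (k' + 1) w) (hl : 2 ≤ l) (hg : IsBlockLengths l k' g) :
    (blocksOfLength f (k + 1) (l - 1)).card ≤
      ((blocksOfLength f (k + 1) (l - 1)).filter (HasFreeNeighbor g (k + 1) w)).card +
      pairCount (innerPairs k k' w) f g (l - 1) (l - 1) +
      3 * (Finset.range (k + 1) \ usedRows (k + 1) (k' + 1) w).card + 2 := by
  classical
  set A := (blocksOfLength f (k + 1) (l - 1)).filter fun i => ¬ HasFreeNeighbor g (k + 1) w i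
  have hA : ∀ i ∈ A, f i = l - 1 ∧ ¬ HasFreeNeighbor g (k + 1) w i := fun i hi =>
    ⟨(mem_blocksOfLength.1 (Finset.mem_filter.1 hi).1).2, (Finset.mem_filter.1 hi).2⟩
  have hsplit : ((blocksOfLength f (k + 1) (l - 1)).filter (HasFreeNeighbor g (k + 1) w)).card +
      A.card = (blocksOfLength f (k + 1) (l - 1)).card :=
    Finset.card_filter_add_card_filter_not _
  have htwo : A.filter (HasTwoOwnNeighbors fun i j => w i j ≠ 0) = ∅ :=
    Finset.filter_eq_empty_iff.2 fun i hi h => (hA i hi).2 <|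
      hw.hasFreeNeighbor_of_hasTwoOwnNeighbors h fun j j' hne hj hj' =>
        (hA i hi).1 ▸ hg.lt_add hl hne hj hj'
  have hinner : ((innerPairs k k' w).filter fun e => e.1 ∈ A).card ≤
      pairCount (innerPairs k k' w) f g (l - 1) (l - 1) := by
    refine Finset.card_le_card fun ⟨i, j⟩ he => ?_
    obtain ⟨he, hi⟩ := Finset.mem_filter.1 he
    obtain ⟨hsingle, -, hj⟩ := mem_innerPairs.1 he
    have hle : g j ≤ f i := not_lt.1 (mt (hw.hasFreeNeighbor_of_mem_singlePairs hsingle)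
      (hA i hi).2)
    have := hg.mem j hj
    have := (hA i hi).1
    exact Finset.mem_filter.2 ⟨he, (hA i hi).1, show g j = l - 1 by omega⟩
  have hcard : A.card ≤ ((innerPairs k k' w).filter fun e => e.1 ∈ A).card +
      3 * (Finset.range (k + 1) \ usedRows (k + 1) (k' + 1) w).card +
      (A.filter (HasTwoOwnNeighbors fun i j => w i j ≠ 0)).card + 2 :=
    hw.isBlockGraph.card_le (usedRows_subset _ _ _) (usedCols_subset _ _ _)
      ((Finset.filter_subset _ _).trans (Finset.filter_subset _ _))
  rw [htwo, Finset.card_empty] at hcard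
  omega

lemma card_filter_innerPairs_le {x : ℕ} {T : Finset ℕ} {P : ℕ → Prop} [DecidablePred P]
    (h : ∀ i j, (i, j) ∈ innerPairs k k' w → f i = x → g j ∈ T → P i) :
    ((innerPairs k k' w).filter fun e => f e.1 = x ∧ g e.2 ∈ T).card ≤
      ((blocksOfLength f (k + 1) x).filter P).card := by
  rw [← card_image_fst_innerPairs (Finset.filter_subset _ _)]
  refine Finset.card_le_card (Finset.image_subset_iff.2 fun ⟨i, j⟩ he => ?_)
  obtain ⟨he, hi, hj⟩ := Finset.mem_filter.1 he
  exact Finset.mem_filter.2 ⟨mem_blocksOfLength.2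
    ⟨(mem_innerPairs.1 he).2.1.trans k.lt_succ_self, hi⟩, h i j he hi hj⟩

lemma le_card_short_filter [DecidablePred (HasFreeNeighbor g (k + 1) w)]
    (hw : IsPlan s t f g (k + 1) (k' + 1) w) (hl : 1 ≤ l) :
    pairCount (innerPairs k k' w) f g (l - 1) l +
        pairCount (innerPairs k k' w) f g (l - 1) (l + 1) ≤
      ((blocksOfLength f (k + 1) (l - 1)).filter (HasFreeNeighbor g (k + 1) w)).card := by
  rw [pairCount_add _ l.lt_succ_self.ne]
  refine card_filter_innerPairs_le fun i j hij hi hj => ?_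
  refine hw.hasFreeNeighbor_of_mem_singlePairs (mem_innerPairs.1 hij).1 ?_
  rw [Finset.mem_insert, Finset.mem_singleton] at hj
  omega

lemma card_long_filter_add_le [DecidablePred (IsFull f (k' + 1) w)]
    (hw : IsPlan s t f g (k + 1) (k' + 1) w) (hl : 1 ≤ l) :
    ((blocksOfLength f (k + 1) (l + 1)).filter (IsFull f (k' + 1) w)).card +
      (pairCount (innerPairs k k' w) f g (l + 1) (l - 1) +
        pairCount (innerPairs k k' w) f g (l + 1) l) ≤ (blocksOfLength f (k + 1) (l + 1)).card := by
  rw [pairCount_add _ (by omega), ← Finset.card_filter_add_card_filter_not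
    (s := blocksOfLength f (k + 1) (l + 1)) (IsFull f (k' + 1) w)]
  refine Nat.add_le_add_left (card_filter_innerPairs_le fun i j hij hi hj => ?_) _
  refine hw.not_isFull_of_mem_singlePairs (mem_innerPairs.1 hij).1 ?_
  rw [Finset.mem_insert, Finset.mem_singleton] at hj
  omega

lemma eq_of_isFull (hw : IsPlan s t f g K K' w) (hfull : IsFull f K' w i) (hij : w i j ≠ 0)
    (hown : ∀ j', w i j' ≠ 0 → j' = j) (hle : g j ≤ f i) :
    g j = f i ∧ ∀ i', w i' j ≠ 0 → i' = i := by
  obtain ⟨hi, hj⟩ := hw.bound i j hij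
  have hwij : w i j = f i := (hw.sum_row_eq hij hown).symm.trans hfull
  have hcol := hw.col j hj
  rw [← Finset.add_sum_erase _ _ (Finset.mem_range.2 hi)] at hcol
  refine ⟨by omega, fun i' hi' => by_contra fun hne => ?_⟩
  have : w i' j ≤ ∑ a ∈ (Finset.range K).erase i, w a j :=
    Finset.single_le_sum (f := fun a => w a j) (fun _ _ => Nat.zero_le _)
      (Finset.mem_erase.2 ⟨hne, Finset.mem_range.2 (hw.bound i' j hi').1⟩)
  omega

lemma exists_mem_singlePairs_of_isFull (hw : IsPlan s t f g (k + 1) (k' + 1) w) (hl : 2 ≤ l)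
    (hf : IsBlockLengths l k f) (hg : IsBlockLengths l k' g)
    (hopt : lcsLength (blockList s f (k + 1)).flatten (blockList t g (k' + 1)).flatten ≤
      weight (k + 1) (k' + 1) w) (hfi : f i = l + 1) (hfull : IsFull f (k' + 1) w i)
    (hone : ¬ ∃ j j', j ≠ j' ∧ w i j ≠ 0 ∧ w i j' ≠ 0) :
    ∃ j, g j = l + 1 ∧
      (i, j) ∈ singlePairs (usedRows (k + 1) (k' + 1) w) (usedCols (k + 1) (k' + 1) w) := by
  obtain ⟨j, hj, hij⟩ := Finset.exists_ne_zero_of_sum_ne_zero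
    (hfull.trans_ne (hfi ▸ l.succ_ne_zero))
  have hown : ∀ j', w i j' ≠ 0 → j' = j := fun j' hij' =>
    by_contra fun hne => hone ⟨j', j, hne, hij', hij⟩
  obtain ⟨hgj, hown'⟩ := hw.eq_of_isFull hfull hij hown
    (hfi ▸ hg.le_of_lt j (Finset.mem_range.1 hj))
  exact ⟨j, hgj.trans hfi, hw.isBlockGraph.mem_singlePairs_of_isSaturated
    (hw.isSaturated (hf.pos_of_lt hl) (hg.pos_of_lt hl) hopt) hij hown hown'⟩

lemma card_long_filter_le [DecidablePred (IsFull f (k' + 1) w)]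
    (hw : IsPlan s t f g (k + 1) (k' + 1) w) (hl : 2 ≤ l)
    (hf : IsBlockLengths l k f) (hg : IsBlockLengths l k' g)
    (hopt : lcsLength (blockList s f (k + 1)).flatten (blockList t g (k' + 1)).flatten ≤
      weight (k + 1) (k' + 1) w) :
    ((blocksOfLength f (k + 1) (l + 1)).filter (IsFull f (k' + 1) w)).card ≤
      pairCount (innerPairs k k' w) f g (l + 1) (l + 1) +
      (Finset.range (k' + 1) \ usedCols (k + 1) (k' + 1) w).card + 2 := by
  classical
  set R := usedRows (k + 1) (k' + 1) w
  set R' := usedCols (k + 1) (k' + 1) w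
  set two := (Finset.range (k + 1)).filter fun i => ∃ j j', j ≠ j' ∧ w i j ≠ 0 ∧ w i j' ≠ 0
  set long := (innerPairs k k' w).filter fun e => f e.1 = l + 1 ∧ g e.2 = l + 1
  have hcover : (blocksOfLength f (k + 1) (l + 1)).filter (IsFull f (k' + 1) w) ⊆
      long.image Prod.fst ∪ (two ∪ outerRows k k' R R') := fun i hi => by
    obtain ⟨hi, hfull⟩ := Finset.mem_filter.1 hi
    obtain ⟨hik, hfi⟩ := mem_blocksOfLength.1 hi
    simp only [Finset.mem_union]
    by_cases htwo : ∃ j j', j ≠ j' ∧ w i j ≠ 0 ∧ w i j' ≠ 0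
    · exact Or.inr (Or.inl (Finset.mem_filter.2 ⟨Finset.mem_range.2 hik, htwo⟩))
    obtain ⟨j, hgj, hij⟩ := hw.exists_mem_singlePairs_of_isFull hl hf hg hopt hfi hfull htwo
    rcases mem_outerRows_or_mem_innerPairs (usedRows_subset _ _ _) (usedCols_subset _ _ _) hij
      with hout | hin
    · exact Or.inr (Or.inr hout)
    · exact Or.inl (Finset.mem_image.2 ⟨(i, j), Finset.mem_filter.2 ⟨hin, hfi, hgj⟩, rfl⟩)
  have := Finset.card_le_card hcover
  have := Finset.card_union_le (long.image Prod.fst) (two ∪ outerRows k k' R R')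
  have := Finset.card_union_le two (outerRows k k' R R')
  have : (long.image Prod.fst).card = pairCount (innerPairs k k' w) f g (l + 1) (l + 1) :=
    card_image_fst_innerPairs (Finset.filter_subset _ _)
  have : two.card ≤ (Finset.range (k' + 1) \ R').card :=
    hw.isBlockGraph.card_le_of_forall_two_edges (usedCols_subset _ _ _)
      fun i hi => (Finset.mem_filter.1 hi).2
  have := card_outerRows_le k k' R R'
  omega

lemma card_blocksOfLength_le (hw : IsPlan s t f g (k + 1) (k' + 1) w) (hl : 1 ≤ l)
    (hg : IsBlockLengths l k' g) (x : ℕ) :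
    (blocksOfLength f (k + 1) x).card ≤
      (pairCount (innerPairs k k' w) f g x (l - 1) + pairCount (innerPairs k k' w) f g x l +
        pairCount (innerPairs k k' w) f g x (l + 1)) +
      3 * (Finset.range (k + 1) \ usedRows (k + 1) (k' + 1) w).card +
      (Finset.range (k' + 1) \ usedCols (k + 1) (k' + 1) w).card + 2 := by
  refine (hw.isBlockGraph.card_le_add_card_sdiff (usedRows_subset _ _ _) (usedCols_subset _ _ _)
    (Finset.filter_subset _ _ : blocksOfLength f (k + 1) x ⊆ _)).trans ?_
  rw [pairCount_add_add _ hl]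
  gcongr with e he
  intro hi
  have := hg.mem e.2 (Finset.mem_filter.1 he).2.2
  simp only [Finset.mem_insert, Finset.mem_singleton]
  exact ⟨(mem_blocksOfLength.1 hi).2, this⟩

lemma le_card_innerPairs (hw : IsPlan s t f g (k + 1) (k' + 1) w) :
    k + 1 ≤ (innerPairs k k' w).card +
      3 * (Finset.range (k + 1) \ usedRows (k + 1) (k' + 1) w).card +
      (Finset.range (k' + 1) \ usedCols (k + 1) (k' + 1) w).card + 2 := by
  have hcard := hw.isBlockGraph.card_le_add_card_sdiff (usedRows_subset _ _ _)
    (usedCols_subset _ _ _) (subset_refl (Finset.range (k + 1)))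
  rw [Finset.card_range] at hcard
  refine hcard.trans ?_
  gcongr
  exact Finset.filter_subset _ _

end IsPlan

/-! ### Type counts -/

/-- The block lengths `l - 1`, `l`, `l + 1` for the indices `0`, `1`, `2`. -/
def lengthOf (l : ℕ) (x : Fin 3) : ℕ := l - 1 + x

section TypeCount

variable {l : ℕ}

lemma lengthOf_injective (l : ℕ) : Function.Injective (lengthOf l) := fun x y h => by
  unfold lengthOf at h
  omega

lemma lengthOf_zero : lengthOf l 0 = l - 1 := rfl

lemma lengthOf_one (hl : 1 ≤ l) : lengthOf l 1 = l := Nat.sub_add_cancel hl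

lemma lengthOf_two (hl : 1 ≤ l) : lengthOf l 2 = l + 1 := by
  simp only [lengthOf, Fin.isValue, Fin.val_two]
  omega

lemma mem_range_lengthOf_iff (hl : 1 ≤ l) {v : ℕ} :
    v ∈ Set.range (lengthOf l) ↔ v = l - 1 ∨ v = l ∨ v = l + 1 := by
  simp only [Set.mem_range, Fin.exists_fin_succ, Fin.succ_zero_eq_one, Fin.succ_one_eq_two,
    lengthOf_zero, lengthOf_one hl, lengthOf_two hl, IsEmpty.exists_iff, or_false, eq_comm]

/-- The numbers of pairs in `M` whose blocks have given lengths. -/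
def typeCount (l : ℕ) (M : Finset (ℕ × ℕ)) (f g : ℕ → ℕ) (x y : Fin 3) : ℕ :=
  pairCount M f g (lengthOf l x) (lengthOf l y)

variable {M : Finset (ℕ × ℕ)} {f g : ℕ → ℕ}

lemma sum_typeCount
    (h : ∀ e ∈ M, f e.1 ∈ Set.range (lengthOf l) ∧ g e.2 ∈ Set.range (lengthOf l)) :
    ∑ x, ∑ y, typeCount l M f g x y = M.card := by
  have hmaps : ∀ e ∈ M, (f e.1, g e.2) ∈
      (Finset.univ : Finset (Fin 3 × Fin 3)).image (Prod.map (lengthOf l) (lengthOf l)) :=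
    fun e he => by
      obtain ⟨⟨x, hx⟩, y, hy⟩ := h e he
      exact Finset.mem_image.2 ⟨(x, y), Finset.mem_univ _, Prod.ext hx hy⟩
  rw [Finset.card_eq_sum_card_fiberwise hmaps, Finset.sum_image
    ((lengthOf_injective l).prodMap (lengthOf_injective l)).injOn, Fintype.sum_prod_type]
  simp only [typeCount, pairCount, Prod.map_apply, Prod.mk.injEq]

end TypeCount

/-! ### The mean change of the longest common subsequence -/

/-- The mean change of the length of the longest common subsequence under a uniformly chosen
modification. -/
noncomputable def meanChange (l : ℕ) (x y : List Bool) : ℝ :=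
  (∑ c ∈ choices l x, ((lcsLength (modifyString l x c) y : ℝ) - lcsLength x y)) / (choices l x).card

section Modification

variable {l K K' : ℕ} {s t : Bool} {f g : ℕ → ℕ}

lemma blockLength_flatten_blockList (s : Bool) (hf : ∀ i < K, 0 < f i) {i : ℕ} (hi : i < K) :
    blockLength (blockList s f K).flatten i = f i := by
  rw [blockLength, blocks_flatten_blockList s hf, getD_blockList s f hi, List.length_replicate]

lemma choices_flatten_blockList (l : ℕ) (s : Bool) (hf : ∀ i < K, 0 < f i) :
    choices l (blockList s f K).flatten =
      blocksOfLength f K (l - 1) ×ˢ blocksOfLength f K (l + 1) := by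
  rw [blocksOfLength, blocksOfLength, ← Finset.filter_product, choices,
    blocks_flatten_blockList s hf, length_blockList]
  refine Finset.filter_congr fun c hc => ?_
  obtain ⟨hi, hj⟩ := Finset.mem_product.1 hc
  rw [blockLength_flatten_blockList s hf (Finset.mem_range.1 hi),
    blockLength_flatten_blockList s hf (Finset.mem_range.1 hj)]

lemma resizeBlock_blockList (l : ℕ) (s : Bool) {i : ℕ} (hf : 0 < f i) :
    resizeBlock l (blockList s f K) i = blockList s (Function.update f i l) K := by
  refine List.ext_getElem (by simp [resizeBlock]) fun j _ _ => ?_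
  simp only [resizeBlock, List.getElem_modify, blockList, List.getElem_map, List.getElem_range]
  rcases eq_or_ne i j with rfl | hij
  · rw [if_pos rfl, Function.update_self, List.headD_eq_head?_getD,
      List.head?_replicate, if_neg hf.ne', Option.getD_some]
  · rw [if_neg hij, Function.update_of_ne hij.symm]

lemma modifyString_flatten_blockList (hl : 1 ≤ l) (s : Bool) (hf : ∀ i < K, 0 < f i) {i j : ℕ}
    (hi : i ∈ blocksOfLength f K (l - 1)) (hj : j ∈ blocksOfLength f K (l + 1)) :
    modifyString l (blockList s f K).flatten (i, j) =
      (blockList s (Function.update (Function.update f i (f i + 1)) j (f j - 1)) K).flatten := by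
  have hmem : (i, j) ∈ choices l (blockList s f K).flatten := by
    rw [choices_flatten_blockList l s hf]
    exact Finset.mk_mem_product hi hj
  obtain ⟨hiK, hfi⟩ := mem_blocksOfLength.1 hi
  obtain ⟨hjK, hfj⟩ := mem_blocksOfLength.1 hj
  have hji : j ≠ i := fun h => by
    subst h
    omega
  have hfj' : 0 < Function.update f i l j := by
    rw [Function.update_of_ne hji]
    exact hf j hjK
  rw [modifyString, if_pos hmem, blocks_flatten_blockList s hf,
    resizeBlock_blockList l s (hf i hiK), resizeBlock_blockList l s hfj', hfi, hfj,
    Nat.sub_add_cancel hl, Nat.add_sub_cancel]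

lemma leftOutProportion_flatten_blockList (hf : ∀ i < K, 0 < f i) {S R : Finset ℕ}
    (hR : ∀ i < K, Disjoint (blockPositions (blockList s f K).flatten i) S ↔ i ∉ R) :
    leftOutProportion (blockList s f K).flatten S = ((Finset.range K \ R).card : ℝ) / K := by
  rw [leftOutProportion, blocks_flatten_blockList s hf, length_blockList,
    Finset.sdiff_eq_filter]
  congr 3
  exact Finset.filter_congr fun i hi => hR i (Finset.mem_range.1 hi)

lemma meanChange_mul_card (l : ℕ) (x y : List Bool) :
    meanChange l x y * (choices l x).card =
      ∑ c ∈ choices l x, ((lcsLength (modifyString l x c) y : ℝ) - lcsLength x y) := by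
  refine div_mul_cancel_of_imp fun h => ?_
  rw [Finset.card_eq_zero.1 (Nat.cast_eq_zero.1 h), Finset.sum_empty]

open Classical in
/-- The modification gains a letter if the short block has a free neighbor, and loses at most one
letter, none if the long block is not full. -/
theorem IsPlan.sub_le_meanChange_mul {w : ℕ → ℕ → ℕ} (hw : IsPlan s t f g K K' w) (hl : 1 ≤ l)
    (hf : ∀ i < K, 0 < f i)
    (hopt : weight K K' w = lcsLength (blockList s f K).flatten (blockList t g K').flatten) :
    (((blocksOfLength f K (l - 1)).filter (HasFreeNeighbor g K w)).card : ℝ) *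
        (blocksOfLength f K (l + 1)).card -
      ((blocksOfLength f K (l + 1)).filter (IsFull f K' w)).card *
        (blocksOfLength f K (l - 1)).card ≤
    meanChange l (blockList s f K).flatten (blockList t g K').flatten *
      ((blocksOfLength f K (l - 1)).card * (blocksOfLength f K (l + 1)).card) := by
  have hcard : ((choices l (blockList s f K).flatten).card : ℝ) =
      (blocksOfLength f K (l - 1)).card * (blocksOfLength f K (l + 1)).card := by
    rw [choices_flatten_blockList l s hf, Finset.card_product, Nat.cast_mul]
  rw [← hcard, meanChange_mul_card, choices_flatten_blockList l s hf, Finset.sum_product]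
  calc _ = ∑ i ∈ blocksOfLength f K (l - 1), ∑ j ∈ blocksOfLength f K (l + 1),
        ((if HasFreeNeighbor g K w i then (1 : ℝ) else 0) - if IsFull f K' w j then 1 else 0) := by
        simp only [Finset.sum_sub_distrib, Finset.sum_const, nsmul_eq_mul, Finset.sum_boole,
          ← Finset.mul_sum]
        ring
    _ ≤ _ := Finset.sum_le_sum fun i hi => Finset.sum_le_sum fun j hj => ?_
  obtain ⟨hjK, hfj⟩ := mem_blocksOfLength.1 hj
  have hij : i ≠ j := fun h => by
    have := (mem_blocksOfLength.1 hi).2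
    subst h
    omega
  have := Nat.cast_le (α := ℝ).2 (hw.weight_le_lcsLength_update hjK hij (hf j hjK))
  rw [modifyString_flatten_blockList hl s hf hi hj, ← hopt]
  push_cast at this
  linarith

end Modification

/-! ### Block counts -/

/-- The inequalities between the number `K` of blocks of the first string, the numbers `a` and `b`
of blocks left out by an optimal alignment in the two strings, the numbers `S` and `L` of short and
long blocks of the first string, the number `inc` of short blocks whose extension increases the
longest common subsequence, the number `dec` of long blocks whose reduction may decrease it, and the
type counts `c` of the single pairs. -/
structure IsBlockCounts (K a b S L inc dec : ℝ) (c : Fin 3 → Fin 3 → ℝ) : Prop where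
  nonneg_left : 0 ≤ a
  nonneg_right : 0 ≤ b
  nonneg : ∀ x y, 0 ≤ c x y
  short_le_inc : S ≤ inc + c 0 0 + 3 * a + 2
  le_inc : c 0 1 + c 0 2 ≤ inc
  dec_le : dec ≤ c 2 2 + b + 2
  dec_add_le : dec + (c 2 0 + c 2 1) ≤ L
  short_le : S ≤ ∑ y, c 0 y + 3 * a + b + 2
  long_le : L ≤ ∑ y, c 2 y + 3 * a + b + 2
  le_total : K ≤ ∑ x, ∑ y, c x y + 3 * a + b + 2
  total_le : ∑ x, ∑ y, c x y ≤ K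

section BlockCounts

variable {l k k' : ℕ} {s t : Bool} {f g : ℕ → ℕ}

lemma card_innerPairs_le (k k' : ℕ) (R R' : Finset ℕ) : (innerPairs k k' R R').card ≤ k := by
  rw [← card_image_fst_innerPairs (subset_refl (innerPairs k k' R R'))]
  refine (Finset.card_le_card (Finset.image_subset_iff.2 fun e he => ?_)).trans_eq
    (Finset.card_range k)
  exact Finset.mem_range.2 (Finset.mem_filter.1 he).2.1

lemma sum_typeCount_innerPairs (hl : 1 ≤ l) (hf : IsBlockLengths l k f)
    (hg : IsBlockLengths l k' g) (R R' : Finset ℕ) :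
    ∑ x, ∑ y, typeCount l (innerPairs k k' R R') f g x y = (innerPairs k k' R R').card :=
  sum_typeCount fun e he => by
    obtain ⟨-, h, h'⟩ := mem_innerPairs.1 he
    exact ⟨(mem_range_lengthOf_iff hl).2 (hf.mem _ h), (mem_range_lengthOf_iff hl).2 (hg.mem _ h')⟩

open Classical in
lemma IsPlan.isBlockCounts {w : ℕ → ℕ → ℕ} (hw : IsPlan s t f g (k + 1) (k' + 1) w) (hl : 2 ≤ l)
    (hf : IsBlockLengths l k f) (hg : IsBlockLengths l k' g)
    (hopt : lcsLength (blockList s f (k + 1)).flatten (blockList t g (k' + 1)).flatten ≤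
      weight (k + 1) (k' + 1) w) :
    IsBlockCounts (k + 1 : ℕ) (Finset.range (k + 1) \ usedRows (k + 1) (k' + 1) w).card
      (Finset.range (k' + 1) \ usedCols (k + 1) (k' + 1) w).card
      (blocksOfLength f (k + 1) (l - 1)).card (blocksOfLength f (k + 1) (l + 1)).card
      ((blocksOfLength f (k + 1) (l - 1)).filter (HasFreeNeighbor g (k + 1) w)).card
      ((blocksOfLength f (k + 1) (l + 1)).filter (IsFull f (k' + 1) w)).card
      fun x y => typeCount l (IsPlan.innerPairs k k' w) f g x y := by
  have hl1 : 1 ≤ l := one_le_two.trans hl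
  have htotal : ∑ x, ∑ y, typeCount l (IsPlan.innerPairs k k' w) f g x y =
    (IsPlan.innerPairs k k' w).card := sum_typeCount_innerPairs hl1 hf hg _ _
  have hrow := hw.card_blocksOfLength_le hl1 hg
  constructor
  case nonneg_left | nonneg_right => exact Nat.cast_nonneg _
  case nonneg => exact fun _ _ => Nat.cast_nonneg _
  case total_le => exact_mod_cast htotal.trans_le ((card_innerPairs_le k k' _ _).trans k.le_succ)
  case le_total => exact_mod_cast htotal ▸ hw.le_card_innerPairs
  all_goals
    simp only [Fin.sum_univ_three, typeCount, lengthOf_zero, lengthOf_one hl1, lengthOf_two hl1]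
    norm_cast
  case short_le_inc => exact hw.card_short_le hl hg
  case le_inc => exact hw.le_card_short_filter hl1
  case dec_le => exact hw.card_long_filter_le hl hf hg hopt
  case dec_add_le => exact hw.card_long_filter_add_le hl1
  case short_le => exact hrow (l - 1)
  case long_le => exact hrow (l + 1)

theorem exists_isBlockCounts (hl : 2 ≤ l) (hf : IsBlockLengths l k f) (hg : IsBlockLengths l k' g)
    {q : ℝ}
    (hq : LeavesOutAtMost (blockList s f (k + 1)).flatten (blockList t g (k' + 1)).flatten q) :
    ∃ R ⊆ Finset.range (k + 1), ∃ R' ⊆ Finset.range (k' + 1), ∃ inc dec : ℝ,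
      ((Finset.range (k + 1) \ R).card : ℝ) / (k + 1 : ℕ) ≤ q ∧
      ((Finset.range (k' + 1) \ R').card : ℝ) / (k' + 1 : ℕ) ≤ q ∧
      IsBlockCounts (k + 1 : ℕ) (Finset.range (k + 1) \ R).card (Finset.range (k' + 1) \ R').card
        (blocksOfLength f (k + 1) (l - 1)).card (blocksOfLength f (k + 1) (l + 1)).card inc dec
        (fun x y => typeCount l (innerPairs k k' R R') f g x y) ∧
      inc * (blocksOfLength f (k + 1) (l + 1)).card -
        dec * (blocksOfLength f (k + 1) (l - 1)).card ≤
        meanChange l (blockList s f (k + 1)).flatten (blockList t g (k' + 1)).flatten *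
          ((blocksOfLength f (k + 1) (l - 1)).card * (blocksOfLength f (k + 1) (l + 1)).card) := by
  classical
  obtain ⟨a, ha⟩ := exists_isOptimalAlignment (blockList s f (k + 1)).flatten
    (blockList t g (k' + 1)).flatten
  have hfpos := hf.pos_of_lt hl
  have hgpos := hg.pos_of_lt hl
  have hw := ha.1.isPlan_alignmentPlan
  have hopt := ha.1.weight_alignmentPlan.trans ha.card_eq_lcsLength
  obtain ⟨hqX, hqY⟩ := hq a ha
  rw [leftOutProportion_flatten_blockList hfpos fun i hi => by
    rw [ha.1.disjoint_blockPositions_image_fst_iff hfpos hi, hw.mem_usedRows, not_exists_not]]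
    at hqX
  rw [leftOutProportion_flatten_blockList hgpos fun j hj => by
    rw [ha.1.disjoint_blockPositions_image_snd_iff hgpos hj, hw.mem_usedCols, not_exists_not]]
    at hqY
  exact ⟨_, usedRows_subset _ _ _, _, usedCols_subset _ _ _, _, _, hqX, hqY,
    hw.isBlockCounts hl hf hg hopt.ge, hw.sub_le_meanChange_mul (one_le_two.trans hl) hfpos hopt⟩

end BlockCounts

/-! ### The minimisation problem -/

lemma entropyTwo_eq_binEntropy (q : ℝ) : entropyTwo q = Real.binEntropy q := by
  simp [entropyTwo, Real.binEntropy]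

lemma entropy_eq_sum_negMulLog (p : Fin 3 → Fin 3 → ℝ) :
    entropy p = ∑ x, ∑ y, Real.negMulLog (p x y) := by
  simp [entropy, Real.negMulLog, Real.log_inv]

section Distribution

variable {p : Fin 3 → Fin 3 → ℝ} (hp : ∀ x y, 0 ≤ p x y) (hsum : ∑ x, ∑ y, p x y = 1)
include hp hsum

lemma le_one_of_sum_eq_one (x y : Fin 3) : p x y ≤ 1 := by
  calc p x y ≤ ∑ y, p x y := Finset.single_le_sum (fun y _ => hp x y) (Finset.mem_univ y)
    _ ≤ ∑ x, ∑ y, p x y := Finset.single_le_sum (f := fun x => ∑ y, p x y)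
        (fun x _ => Finset.sum_nonneg fun y _ => hp x y) (Finset.mem_univ x)
    _ = 1 := hsum

lemma entropy_nonneg : 0 ≤ entropy p := by
  rw [entropy_eq_sum_negMulLog]
  exact Finset.sum_nonneg fun x _ => Finset.sum_nonneg fun y _ =>
    Real.negMulLog_nonneg (hp x y) (le_one_of_sum_eq_one hp hsum x y)

lemma log_one_div_nine_add_entropy_nonpos : Real.log (1 / 9) + entropy p ≤ 0 := by
  have gibbs : ∀ x y,
      p x y * Real.log (1 / 9) + p x y * Real.log (1 / p x y) ≤ 1 / 9 - p x y := by
    intro x y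
    rcases (hp x y).eq_or_lt with h | h
    · rw [← h]; norm_num
    · rw [← mul_add, ← Real.log_mul (by norm_num) (by positivity)]
      calc p x y * Real.log (1 / 9 * (1 / p x y)) ≤ p x y * (1 / 9 * (1 / p x y) - 1) := by
            gcongr
            exact Real.log_le_sub_one_of_pos (by positivity)
        _ = 1 / 9 - p x y := by field_simp
  calc Real.log (1 / 9) + entropy p
      = ∑ x, ∑ y, (p x y * Real.log (1 / 9) + p x y * Real.log (1 / p x y)) := by
        simp only [Finset.sum_add_distrib, ← Finset.sum_mul, hsum, entropy, one_mul]
    _ ≤ ∑ x : Fin 3, ∑ y : Fin 3, (1 / 9 - p x y) :=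
        Finset.sum_le_sum fun x _ => Finset.sum_le_sum fun y _ => gibbs x y
    _ = 0 := by
        simp only [Finset.sum_sub_distrib, hsum]
        norm_num

lemma neg_three_le_log_one_div_nine_add_entropy : -3 ≤ Real.log (1 / 9) + entropy p := by
  have h9 : Real.log 9 ≤ 3 := by
    rw [Real.log_le_iff_le_exp (by norm_num)]
    calc (9 : ℝ) ≤ 2.7 ^ 3 := by norm_num
      _ ≤ Real.exp 1 ^ 3 := by gcongr; linarith [Real.exp_one_gt_d9]
      _ = Real.exp 3 := by rw [← Real.exp_nat_mul]; norm_num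
  rw [one_div, Real.log_inv]
  linarith [entropy_nonneg hp hsum]

end Distribution

/-- The left-hand side of the constraint on the entropies. -/
noncomputable def entropySlack (p : Fin 3 → Fin 3 → ℝ) (q : ℝ) : ℝ :=
  2 * entropyTwo q + (1 - 4 * q) * (Real.log (1 / 9) + entropy p)

lemma continuous_entropySlack :
    Continuous fun z : (Fin 3 → Fin 3 → ℝ) × ℝ => entropySlack z.1 z.2 := by
  simp only [entropySlack, entropyTwo_eq_binEntropy, entropy_eq_sum_negMulLog]
  fun_prop

/-- The points that satisfy all constraints except the one on the entropies. -/
def weaklyFeasible (q₀ : ℝ) : Set ((Fin 3 → Fin 3 → ℝ) × ℝ) :=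
  {z | z.2 ∈ Set.Icc 0 q₀ ∧ (1 / 3 - q₀) / 2 ≤ ∑ y, z.1 0 y ∧ (1 / 3 - q₀) / 2 ≤ ∑ y, z.1 2 y ∧
    (∀ x y, 0 ≤ z.1 x y) ∧ ∑ x, ∑ y, z.1 x y = 1}

section Minimisation

variable {q₀ ε : ℝ}

lemma isClosed_weaklyFeasible (q₀ : ℝ) : IsClosed (weaklyFeasible q₀) := by
  have hnonneg : IsClosed {z : (Fin 3 → Fin 3 → ℝ) × ℝ | ∀ x y, 0 ≤ z.1 x y} := by
    simp only [Set.ofPred_forall]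
    exact isClosed_iInter fun x => isClosed_iInter fun y =>
      isClosed_le continuous_const (by fun_prop)
  have hmass (x : Fin 3) :
      IsClosed {z : (Fin 3 → Fin 3 → ℝ) × ℝ | (1 / 3 - q₀) / 2 ≤ ∑ y, z.1 x y} :=
    isClosed_le continuous_const (by fun_prop)
  have htotal : IsClosed {z : (Fin 3 → Fin 3 → ℝ) × ℝ | ∑ x, ∑ y, z.1 x y = 1} :=
    isClosed_eq (by fun_prop) continuous_const
  exact (isClosed_Icc.preimage continuous_snd).inter
    ((hmass 0).inter ((hmass 2).inter (hnonneg.inter htotal)))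

lemma isCompact_weaklyFeasible (q₀ : ℝ) : IsCompact (weaklyFeasible q₀) := by
  have hbox : IsCompact ((Set.univ.pi fun _ : Fin 3 => Set.univ.pi fun _ : Fin 3 =>
      Set.Icc (0 : ℝ) 1) ×ˢ Set.Icc (0 : ℝ) q₀) :=
    (isCompact_univ_pi fun _ => isCompact_univ_pi fun _ => isCompact_Icc).prod isCompact_Icc
  refine hbox.of_isClosed_subset (isClosed_weaklyFeasible q₀) ?_
  rintro ⟨p, q⟩ ⟨hq, -, -, hp, hsum⟩
  exact ⟨fun x _ y _ => ⟨hp x y, le_one_of_sum_eq_one hp hsum x y⟩, hq⟩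

lemma continuousOn_objective (hq₀ : q₀ < 1 / 3) :
    ContinuousOn (fun z : (Fin 3 → Fin 3 → ℝ) × ℝ => objective z.1 z.2) (weaklyFeasible q₀) := by
  have hshort : ∀ z ∈ weaklyFeasible q₀, z.1 0 0 + z.1 0 1 + z.1 0 2 ≠ 0 := by
    rintro z ⟨-, h, -⟩
    rw [Fin.sum_univ_three] at h
    linarith
  have hlong : ∀ z ∈ weaklyFeasible q₀, z.1 2 0 + z.1 2 1 + z.1 2 2 ≠ 0 := by
    rintro z ⟨-, -, h, -⟩
    rw [Fin.sum_univ_three] at h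
    linarith
  unfold objective
  exact (((ContinuousOn.div (by fun_prop) (by fun_prop) hshort).mul (by fun_prop)).sub
    ((ContinuousOn.div (by fun_prop) (by fun_prop) hlong).mul (by fun_prop))).sub (by fun_prop)

/-- At `q = 1 / 24` and the uniform `p` the objective vanishes and the entropy constraint holds. -/
lemma lt_of_mem_lowerBounds_feasibleValues (hε : 0 < ε)
    (hmin : 2 * ε ∈ lowerBounds (feasibleValues q₀)) : q₀ < 1 / 24 := by
  by_contra! hq₀
  have hfeas : IsFeasible q₀ (fun _ _ => 1 / 9) (1 / 24) := by
    refine ⟨⟨by norm_num, hq₀⟩, ?_, ?_, fun _ _ => by norm_num, by norm_num, ?_⟩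
    · norm_num; linarith
    · norm_num; linarith
    · have : entropy (fun _ _ => 1 / 9) = -Real.log (1 / 9) := by
        simp [entropy, Real.log_inv]
        ring
      rw [this, add_neg_cancel, mul_zero, add_zero, entropyTwo_eq_binEntropy]
      exact mul_nonneg zero_le_two (Real.binEntropy_nonneg (by norm_num) (by norm_num))
  have := hmin ⟨_, _, hfeas, rfl⟩
  norm_num [objective] at this
  linarith

lemma exists_entropySlack_objective_ge (hq₀ : q₀ < 1 / 3) (hε : 0 < ε)
    (hmin : 2 * ε ∈ lowerBounds (feasibleValues q₀)) :
    ∃ δ > 0, ∀ z ∈ weaklyFeasible q₀, -δ ≤ entropySlack z.1 z.2 →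
      3 / 2 * ε ≤ objective z.1 z.2 := by
  set S := weaklyFeasible q₀ ∩ (fun z => objective z.1 z.2) ⁻¹' Set.Iic (3 / 2 * ε)
  have hScomp : IsCompact S := (isCompact_weaklyFeasible q₀).of_isClosed_subset
    ((continuousOn_objective hq₀).preimage_isClosed_of_isClosed (isClosed_weaklyFeasible q₀)
      isClosed_Iic) Set.inter_subset_left
  have hneg : ∀ z ∈ S, entropySlack z.1 z.2 < 0 := by
    rintro ⟨p, q⟩ ⟨⟨hq, hshort, hlong, hp, hsum⟩, hobj : objective p q ≤ 3 / 2 * ε⟩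
    by_contra! hslack
    have := hmin ⟨p, q, ⟨hq, hshort, hlong, hp, hsum, hslack⟩, rfl⟩
    linarith
  obtain ⟨δ, hδ, hSδ⟩ : ∃ δ > 0, ∀ z ∈ S, entropySlack z.1 z.2 < -δ := by
    rcases S.eq_empty_or_nonempty with hempty | hne
    · exact ⟨1, one_pos, fun z hz => absurd hz (hempty ▸ Set.notMem_empty z)⟩
    · obtain ⟨z₀, hz₀, hmax⟩ := hScomp.exists_isMaxOn hne continuous_entropySlack.continuousOn
      refine ⟨-entropySlack z₀.1 z₀.2 / 2, by linarith [hneg z₀ hz₀], fun z hz => ?_⟩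
      have hle : entropySlack z.1 z.2 ≤ entropySlack z₀.1 z₀.2 := hmax hz
      linarith [hneg z₀ hz₀]
  refine ⟨δ, hδ, fun z hz hslack => ?_⟩
  by_contra! hobj
  exact (hSδ z ⟨hz, hobj.le⟩).not_ge hslack

/-- A tolerance `η` small enough that a point violating the entropy constraint by at most `8 * η`
still has an objective value of at least `3 / 2 * ε`. -/
structure IsTolerance (q₀ ε η : ℝ) : Prop where
  q_le : q₀ ≤ 1 / 24
  pos : 0 < η
  le : η ≤ 1 / 144
  le_div : η ≤ ε / 24
  objective_ge : ∀ z ∈ weaklyFeasible q₀, -(8 * η) ≤ entropySlack z.1 z.2 →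
    3 / 2 * ε ≤ objective z.1 z.2

lemma exists_isTolerance (hε : 0 < ε) (hmin : 2 * ε ∈ lowerBounds (feasibleValues q₀)) :
    ∃ η, IsTolerance q₀ ε η := by
  have hq₀ := lt_of_mem_lowerBounds_feasibleValues hε hmin
  obtain ⟨δ, hδ, hobj⟩ := exists_entropySlack_objective_ge (by linarith) hε hmin
  obtain ⟨η, hη, hle⟩ :=
    exists_between (show 0 < min (1 / 144) (min (ε / 24) (δ / 8)) by positivity)
  simp only [lt_min_iff] at hle
  obtain ⟨hη1, hηε, hηδ⟩ := hle
  exact ⟨η, hq₀.le, hη, hη1.le, hηε.le, fun z hz hslack => hobj z hz (by linarith)⟩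

end Minimisation

/-! ### From block counts to the minimisation problem -/

/-- If both `α` and `β` are replaced by a common upper bound `q` and `K'`, `N` by `K` and
`(1 - 4 * q) * K`, the total entropy drops by at most `8 * (η * K)`. -/
lemma neg_le_entropy_of_near {α β q η K K' N G : ℝ} (hα : 0 ≤ α) (hβ : 0 ≤ β) (hαq : α ≤ q)
    (hβq : β ≤ q) (hq : q ≤ 1 / 24) (hη : 0 ≤ η) (hK : 0 < K) (hK' : 0 ≤ K')
    (hKK : K' ≤ K + η * K) (hN : (1 - 4 * q) * K - 2 * (η * K) ≤ N) (hG : G ≤ 0) (hG' : -3 ≤ G)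
    (hent : -(η * K) ≤ K * Real.binEntropy α + K' * Real.binEntropy β + N * G) :
    -(8 * η) ≤ 2 * Real.binEntropy q + (1 - 4 * q) * G := by
  have hhalf : q ≤ 2⁻¹ := by norm_num; linarith
  have hmono := Real.binEntropy_strictMonoOn.monotoneOn
  have hEα : Real.binEntropy α ≤ Real.binEntropy q :=
    hmono ⟨hα, hαq.trans hhalf⟩ ⟨hα.trans hαq, hhalf⟩ hαq
  have hEβ : Real.binEntropy β ≤ Real.binEntropy q :=
    hmono ⟨hβ, hβq.trans hhalf⟩ ⟨hα.trans hαq, hhalf⟩ hβq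
  have hE0 : 0 ≤ Real.binEntropy q := Real.binEntropy_nonneg (hα.trans hαq) (by linarith)
  have hE1 : Real.binEntropy q ≤ 1 := Real.binEntropy_le_log_two.trans (by
    linarith [Real.log_two_lt_d9])
  have hηK : 0 ≤ η * K := by positivity
  have hleft : K * Real.binEntropy α ≤ K * Real.binEntropy q := by gcongr
  have hright : K' * Real.binEntropy β ≤ K * Real.binEntropy q + η * K := by
    calc K' * Real.binEntropy β ≤ K' * Real.binEntropy q := by gcongr
      _ ≤ (K + η * K) * Real.binEntropy q := by gcongr
      _ = K * Real.binEntropy q + η * K * Real.binEntropy q := by ring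
      _ ≤ K * Real.binEntropy q + η * K := by linarith [mul_le_of_le_one_right hηK hE1]
  have hpairs : N * G ≤ K * ((1 - 4 * q) * G) + 6 * (η * K) := by
    have := mul_le_mul_of_nonpos_right hN hG
    have := mul_le_mul_of_nonneg_left hG' hηK
    linarith
  have : 0 ≤ K * (2 * Real.binEntropy q + (1 - 4 * q) * G + 8 * η) := by linarith
  linarith [nonneg_of_mul_nonneg_right this hK]

/-- Among `K` blocks about a third is short and about a third is long, and about a proportion of at
most `q` is left out on both sides; the tolerance is `η`. -/
structure IsNearlyBalanced (q η K a b S L : ℝ) : Prop where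
  pos : 0 < K
  q_nonneg : 0 ≤ q
  q_le : q ≤ 1 / 24
  tolerance_pos : 0 < η
  tolerance_le : η ≤ 1 / 144
  two_le : 2 ≤ η * K
  left_le : a ≤ q * K
  right_le : b ≤ q * K + η * K / 24
  short_ge : K / 3 - η * K ≤ S
  long_ge : K / 3 - η * K ≤ L

/-- The proportions in a two-way table of counts. -/
noncomputable def proportions (c : Fin 3 → Fin 3 → ℝ) : Fin 3 → Fin 3 → ℝ :=
  fun x y => c x y / ∑ x, ∑ y, c x y

lemma sum_proportions {c : Fin 3 → Fin 3 → ℝ} (hc : ∑ x, ∑ y, c x y ≠ 0) :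
    ∑ x, ∑ y, proportions c x y = 1 := by
  simp only [proportions, ← Finset.sum_div]
  exact div_self hc

section BlockCounts

variable {q₀ q η K a b S L inc dec : ℝ} {c : Fin 3 → Fin 3 → ℝ}

namespace IsNearlyBalanced

variable (hbal : IsNearlyBalanced q η K a b S L)
include hbal

lemma q_mul_le : q * K ≤ K / 24 := by
  have := mul_le_mul_of_nonneg_right hbal.q_le hbal.pos.le
  linarith

lemma tolerance_mul_le : η * K ≤ K / 144 := by
  have := mul_le_mul_of_nonneg_right hbal.tolerance_le hbal.pos.le
  linarith

lemma short_pos : 0 < S := by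
  linarith [hbal.pos, hbal.tolerance_mul_le, hbal.short_ge]

lemma long_pos : 0 < L := by
  linarith [hbal.pos, hbal.tolerance_mul_le, hbal.long_ge]

lemma total_ge {N : ℝ} (hN : K ≤ N + 3 * a + b + 2) :
    (1 - 4 * q) * K - 2 * (η * K) ≤ N := by
  linarith [hbal.pos, hbal.tolerance_mul_le, hbal.left_le, hbal.right_le, hbal.two_le]

lemma total_pos {N : ℝ} (hN : K ≤ N + 3 * a + b + 2) : 0 < N := by
  linarith [hbal.total_ge hN, hbal.pos, hbal.q_mul_le, hbal.tolerance_mul_le]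

lemma mass_ge {T m : ℝ} (hq₀ : q₀ ≤ 1 / 24) (hq : q ≤ q₀) (hT : K / 3 - η * K ≤ T)
    (hm : T ≤ m + 3 * a + b + 2) : (1 / 3 - q₀) / 2 * K ≤ m := by
  have hq₀K : q₀ * K ≤ 1 / 24 * K := mul_le_mul_of_nonneg_right hq₀ hbal.pos.le
  have hqK : q * K ≤ q₀ * K := mul_le_mul_of_nonneg_right hq hbal.pos.le
  linarith [hbal.pos, hbal.tolerance_mul_le, hbal.left_le, hbal.right_le, hbal.two_le]

lemma left_le_short : 3 * a + 2 ≤ (9 * q + 6 * η) * S := by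
  have hqS := mul_le_mul_of_nonneg_left hbal.short_ge hbal.q_nonneg
  have hηS := mul_le_mul_of_nonneg_left hbal.short_ge hbal.tolerance_pos.le
  have hηK : 0 ≤ η * K := mul_nonneg hbal.tolerance_pos.le hbal.pos.le
  have hqη := mul_le_mul_of_nonneg_right hbal.q_le hηK
  have hηη := mul_le_mul_of_nonneg_right hbal.tolerance_le hηK
  linarith [hbal.left_le, hbal.two_le]

lemma right_le_long : b ≤ (3 * q + η) * L := by
  have hqL := mul_le_mul_of_nonneg_left hbal.long_ge hbal.q_nonneg
  have hηL := mul_le_mul_of_nonneg_left hbal.long_ge hbal.tolerance_pos.le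
  have hηK : 0 ≤ η * K := mul_nonneg hbal.tolerance_pos.le hbal.pos.le
  have hqη := mul_le_mul_of_nonneg_right hbal.q_le hηK
  have hηη := mul_le_mul_of_nonneg_right hbal.tolerance_le hηK
  linarith [hbal.right_le]

lemma two_le_long : 2 ≤ 5 * η * L := by
  have hηL := mul_le_mul_of_nonneg_left hbal.long_ge hbal.tolerance_pos.le
  have hηK : 0 ≤ η * K := mul_nonneg hbal.tolerance_pos.le hbal.pos.le
  have hηη := mul_le_mul_of_nonneg_right hbal.tolerance_le hηK
  linarith [hbal.two_le]

end IsNearlyBalanced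

namespace IsBlockCounts

variable (h : IsBlockCounts K a b S L inc dec c)
include h

lemma mul_sub_le_inc (hn : 0 < c 0 0 + c 0 1 + c 0 2) :
    (c 0 1 + c 0 2) / (c 0 0 + c 0 1 + c 0 2) * (S - 3 * a - 2) ≤ inc := by
  set n := c 0 0 + c 0 1 + c 0 2
  set r := (c 0 1 + c 0 2) / n
  have hrn : r * n = c 0 1 + c 0 2 := div_mul_cancel₀ _ hn.ne'
  have hr0 : 0 ≤ r := div_nonneg (add_nonneg (h.nonneg _ _) (h.nonneg _ _)) hn.le
  have hr1 : r ≤ 1 := (div_le_one hn).2 (by linarith [h.nonneg 0 0])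
  rcases le_or_gt (S - 3 * a - 2) n with hle | hgt
  · calc r * (S - 3 * a - 2) ≤ r * n := by gcongr
      _ ≤ inc := hrn.trans_le h.le_inc
  · have := mul_le_mul_of_nonneg_left hgt.le (sub_nonneg.2 hr1)
    linarith [h.short_le_inc]

lemma dec_le_mul_add (hn : 0 < c 2 0 + c 2 1 + c 2 2) :
    dec ≤ c 2 2 / (c 2 0 + c 2 1 + c 2 2) * (L - b) + b + 2 := by
  set n := c 2 0 + c 2 1 + c 2 2
  set r := c 2 2 / n
  have hrn : r * n = c 2 2 := div_mul_cancel₀ _ hn.ne'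
  have hr0 : 0 ≤ r := div_nonneg (h.nonneg _ _) hn.le
  have hr1 : r ≤ 1 := (div_le_one hn).2 (by linarith [h.nonneg 2 0, h.nonneg 2 1])
  rcases le_or_gt n (L - b) with hle | hgt
  · have := mul_le_mul_of_nonneg_left hle hr0
    linarith [h.dec_le]
  · have := mul_le_mul_of_nonneg_left hgt.le (sub_nonneg.2 hr1)
    linarith [h.dec_add_le, h.nonneg_right]

lemma le_inc_div (hbal : IsNearlyBalanced q η K a b S L) (hn : 0 < c 0 0 + c 0 1 + c 0 2) :
    (c 0 1 + c 0 2) / (c 0 0 + c 0 1 + c 0 2) * (1 - 9 * q) - 6 * η ≤ inc / S := by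
  have hinc := h.mul_sub_le_inc hn
  have hr0 : 0 ≤ (c 0 1 + c 0 2) / (c 0 0 + c 0 1 + c 0 2) :=
    div_nonneg (add_nonneg (h.nonneg _ _) (h.nonneg _ _)) hn.le
  have hr1 : (c 0 1 + c 0 2) / (c 0 0 + c 0 1 + c 0 2) ≤ 1 :=
    (div_le_one hn).2 (by linarith [h.nonneg 0 0])
  rw [le_div_iff₀ hbal.short_pos]
  have hηS : 0 ≤ 6 * η * S := by
    have := hbal.tolerance_pos
    have := hbal.short_pos
    positivity
  linarith [mul_le_mul_of_nonneg_left hbal.left_le_short hr0, mul_le_of_le_one_left hηS hr1]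

lemma dec_div_le (hbal : IsNearlyBalanced q η K a b S L) (hn : 0 < c 2 0 + c 2 1 + c 2 2) :
    dec / L ≤ c 2 2 / (c 2 0 + c 2 1 + c 2 2) * (1 - 3 * q) + 3 * q + 6 * η := by
  have hdec := h.dec_le_mul_add hn
  have hr0 : 0 ≤ c 2 2 / (c 2 0 + c 2 1 + c 2 2) := div_nonneg (h.nonneg _ _) hn.le
  have hr1 : c 2 2 / (c 2 0 + c 2 1 + c 2 2) ≤ 1 :=
    (div_le_one hn).2 (by linarith [h.nonneg 2 0, h.nonneg 2 1])
  rw [div_le_iff₀ hbal.long_pos]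
  have hηL : 0 ≤ η * L := mul_nonneg hbal.tolerance_pos.le hbal.long_pos.le
  linarith [mul_le_mul_of_nonneg_left hbal.right_le_long (sub_nonneg.2 hr1),
    mul_nonneg hr0 hηL, hbal.two_le_long]

lemma proportions_mem_weaklyFeasible (hbal : IsNearlyBalanced q η K a b S L)
    (hq₀ : q₀ ≤ 1 / 24) (hq : q ≤ q₀) :
    (proportions c, q) ∈ weaklyFeasible q₀ := by
  have hN := hbal.total_pos h.le_total
  have hmass : (1 / 3 - q₀) / 2 * ∑ x, ∑ y, c x y ≤ (1 / 3 - q₀) / 2 * K :=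
    mul_le_mul_of_nonneg_left h.total_le (by linarith)
  refine ⟨⟨hbal.q_nonneg, hq⟩, ?_, ?_, fun x y => div_nonneg (h.nonneg x y) hN.le,
    sum_proportions hN.ne'⟩
  · simp only [proportions, ← Finset.sum_div]
    exact (le_div_iff₀ hN).2 (hmass.trans (hbal.mass_ge hq₀ hq hbal.short_ge h.short_le))
  · simp only [proportions, ← Finset.sum_div]
    exact (le_div_iff₀ hN).2 (hmass.trans (hbal.mass_ge hq₀ hq hbal.long_ge h.long_le))

lemma objective_proportions_sub_le (hbal : IsNearlyBalanced q η K a b S L) (hq₀ : q₀ ≤ 1 / 24)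
    (hq : q ≤ q₀) :
    objective (proportions c) q - 12 * η ≤ inc / S - dec / L := by
  have hN := hbal.total_pos h.le_total
  have hmass : 0 < (1 / 3 - q₀) / 2 * K := mul_pos (by linarith) hbal.pos
  have hshort := hbal.mass_ge hq₀ hq hbal.short_ge h.short_le
  have hlong := hbal.mass_ge hq₀ hq hbal.long_ge h.long_le
  rw [Fin.sum_univ_three] at hshort hlong
  have hinc := h.le_inc_div hbal (hmass.trans_le hshort)
  have hdec := h.dec_div_le hbal (hmass.trans_le hlong)
  simp only [objective, proportions, ← add_div]
  rw [div_div_div_cancel_right₀ hN.ne', div_div_div_cancel_right₀ hN.ne']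
  linarith

lemma entropySlack_proportions_ge {α β K' : ℝ} (hbal : IsNearlyBalanced q η K a b S L)
    (hα : 0 ≤ α) (hβ : 0 ≤ β) (hαq : α ≤ q) (hβq : β ≤ q) (hK' : 0 ≤ K') (hKK : K' ≤ K + η * K)
    (hent : -(η * K) ≤ K * Real.binEntropy α + K' * Real.binEntropy β +
      (∑ x, ∑ y, c x y) * (Real.log (1 / 9) + entropy (proportions c))) :
    -(8 * η) ≤ entropySlack (proportions c) q := by
  have hN := hbal.total_pos h.le_total
  have hp : ∀ x y, 0 ≤ proportions c x y := fun x y => div_nonneg (h.nonneg x y) hN.le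
  have hsum := sum_proportions hN.ne'
  rw [entropySlack, entropyTwo_eq_binEntropy]
  exact neg_le_entropy_of_near hα hβ hαq hβq hbal.q_le hbal.tolerance_pos.le hbal.pos hK' hKK
    (hbal.total_ge h.le_total) (log_one_div_nine_add_entropy_nonpos hp hsum)
    (neg_three_le_log_one_div_nine_add_entropy hp hsum) hent

/-- The proportions of the block counts are a nearly feasible point of the minimisation problem
whose objective value is at most about `inc / S - dec / L`. -/
lemma le_inc_div_sub_dec_div {ε K' : ℝ} (hη : IsTolerance q₀ ε η)
    (hK : 0 < K) (hK' : 0 < K') (haq : a / K ≤ q₀) (hbq : b / K' ≤ q₀) (hKK : |K' - K| ≤ η * K)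
    (hK2 : 2 ≤ η * K) (hS : |S - K / 3| ≤ η * K) (hL : |L - K / 3| ≤ η * K)
    (hent : -(η * K) ≤ K * Real.binEntropy (a / K) + K' * Real.binEntropy (b / K') +
      (∑ x, ∑ y, c x y) * (Real.log (1 / 9) + entropy (proportions c))) :
    0 < S ∧ 0 < L ∧ ε ≤ inc / S - dec / L := by
  set q := max (a / K) (b / K') with hqdef
  have ha : 0 ≤ a / K := div_nonneg h.nonneg_left hK.le
  have hb : 0 ≤ b / K' := div_nonneg h.nonneg_right hK'.le
  have hq : q ≤ q₀ := max_le haq hbq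
  have hq0 : 0 ≤ q := le_max_of_le_left ha
  rw [abs_le] at hKK hS hL
  have hbK : b ≤ q * K + η * K / 24 := by
    have hηK : 0 ≤ η * K := mul_nonneg hη.pos.le hK.le
    calc b ≤ q * K' := (div_le_iff₀ hK').1 (le_max_right _ _)
      _ ≤ q * (K + η * K) := by gcongr; linarith
      _ ≤ q * K + η * K / 24 := by
        linarith [mul_le_mul_of_nonneg_right (hq.trans hη.q_le) hηK]
  have hbal : IsNearlyBalanced q η K a b S L :=
    ⟨hK, hq0, hq.trans hη.q_le, hη.pos, hη.le, hK2, (div_le_iff₀ hK).1 (le_max_left _ _), hbK,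
      by linarith, by linarith⟩
  have hslack := h.entropySlack_proportions_ge hbal ha hb (le_max_left _ _) (le_max_right _ _)
    hK'.le (by linarith) hent
  have hge := hη.objective_ge _ (h.proportions_mem_weaklyFeasible hbal hη.q_le hq) hslack
  exact ⟨hbal.short_pos, hbal.long_pos, by
    linarith [h.objective_proportions_sub_le hbal hη.q_le hq, hη.le_div]⟩

end IsBlockCounts

end BlockCounts

/-! ### Counting by entropy -/

lemma div_pow_eq_exp_neg_mul_negMulLog {m : ℕ} {N : ℝ} (hm : m ≤ N) :
    ((m : ℝ) / N) ^ m = Real.exp (-(N * Real.negMulLog (m / N))) := by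
  rcases m.eq_zero_or_pos with rfl | hpos
  · simp
  · have hm0 : (0 : ℝ) < m := Nat.cast_pos.2 hpos
    have hN : 0 < N := hm0.trans_le hm
    have : -(N * Real.negMulLog (m / N)) = m * Real.log (m / N) := by
      rw [Real.negMulLog]
      field_simp
    rw [this, Real.exp_nat_mul, Real.exp_log (by positivity)]

/-- A word with letter counts `c` has the same probability, the exponential of minus its entropy,
when its letters are drawn independently with the frequencies of `c`. -/
lemma card_words_le {ι α : Type*} [Fintype ι] [DecidableEq ι] [Fintype α] [DecidableEq α]
    (c : α → ℕ) (hc : ∑ a, c a = Fintype.card ι) :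
    (((Finset.univ : Finset (ι → α)).filter fun w =>
      ∀ a, (Finset.univ.filter fun e => w e = a).card = c a).card : ℝ) ≤
      Real.exp (Fintype.card ι * ∑ a, Real.negMulLog (c a / Fintype.card ι)) := by
  set N := (Fintype.card ι : ℝ)
  set W := (Finset.univ : Finset (ι → α)).filter fun w =>
    ∀ a, (Finset.univ.filter fun e => w e = a).card = c a
  have hprod : ∀ w ∈ W,
      ∏ e, (c (w e) : ℝ) / N = Real.exp (-(N * ∑ a, Real.negMulLog (c a / N))) := by
    intro w hw
    rw [← Finset.prod_fiberwise' Finset.univ w (fun a => (c a : ℝ) / N), Finset.mul_sum,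
      ← Finset.sum_neg_distrib, Real.exp_sum]
    refine Finset.prod_congr rfl fun a _ => ?_
    have hle : c a ≤ Fintype.card ι :=
      hc ▸ Finset.single_le_sum (fun a _ => (c a).zero_le) (Finset.mem_univ a)
    rw [Finset.prod_const, (Finset.mem_filter.1 hw).2 a,
      div_pow_eq_exp_neg_mul_negMulLog (Nat.cast_le.2 hle)]
  have hsum : ∑ w : ι → α, ∏ e, (c (w e) : ℝ) / N ≤ 1 := by
    rw [← Fintype.piFinset_univ,
      ← Finset.prod_univ_sum (fun _ => Finset.univ) (fun _ a => (c a : ℝ) / N),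
      ← Finset.sum_div, ← Nat.cast_sum, hc,
      Finset.prod_const]
    exact pow_le_one₀ (by positivity) (div_self_le_one _)
  have hW : W.card * Real.exp (-(N * ∑ a, Real.negMulLog (c a / N))) ≤ 1 :=
    calc _ = ∑ w ∈ W, ∏ e, (c (w e) : ℝ) / N := by
          rw [Finset.sum_congr rfl hprod, Finset.sum_const, nsmul_eq_mul]
      _ ≤ ∑ w : ι → α, ∏ e, (c (w e) : ℝ) / N :=
          Finset.sum_le_sum_of_subset_of_nonneg (Finset.subset_univ _) fun w _ _ => by positivity
      _ ≤ 1 := hsum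
  rwa [Real.exp_neg, ← div_eq_mul_inv, div_le_one (Real.exp_pos _)] at hW

lemma choose_le_exp_binEntropy (K m : ℕ) :
    (K.choose m : ℝ) ≤ Real.exp (K * Real.binEntropy (m / K)) := by
  rcases K.eq_zero_or_pos with rfl | hK
  · simp only [Nat.cast_zero, zero_mul, Real.exp_zero]
    cases m <;> simp
  rcases lt_or_ge K m with hKm | hmK
  · simpa [Nat.choose_eq_zero_of_lt hKm] using (Real.exp_pos _).le
  have hsub : 1 - (m : ℝ) / K = (K - m : ℕ) / K := by
    rw [Nat.cast_sub hmK]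
    field_simp
  have hexp : Real.exp (-(K * Real.binEntropy (m / K))) =
      ((m : ℝ) / K) ^ m * (1 - (m : ℝ) / K) ^ (K - m) := by
    rw [Real.binEntropy_eq_negMulLog_add_negMulLog_one_sub, hsub,
      div_pow_eq_exp_neg_mul_negMulLog (Nat.cast_le.2 hmK),
      div_pow_eq_exp_neg_mul_negMulLog (Nat.cast_le.2 (Nat.sub_le K m)), ← Real.exp_add]
    congr 1
    ring
  have hbinom := add_pow ((m : ℝ) / K) (1 - (m : ℝ) / K) K
  rw [add_sub_cancel, one_pow] at hbinom
  have hterm : Real.exp (-(K * Real.binEntropy (m / K))) * (K.choose m : ℝ) ≤ 1 := by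
    rw [hexp, hsub]
    rw [hsub] at hbinom
    refine le_of_le_of_eq ?_ hbinom.symm
    exact Finset.single_le_sum (f := fun j => ((m : ℝ) / K) ^ j *
      ((K - m : ℕ) / K : ℝ) ^ (K - j) * (K.choose j : ℝ)) (fun j _ => by positivity)
      (Finset.mem_range.2 (Nat.lt_succ_of_le hmK))
  rwa [Real.exp_neg, inv_mul_le_iff₀ (Real.exp_pos _), mul_one] at hterm

/-- The logarithmic weight of the choice of the left out blocks `range K \ R`. -/
noncomputable def leftOutEntropy (K : ℕ) (R : Finset ℕ) : ℝ :=
  K * Real.binEntropy ((Finset.range K \ R).card / K)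

lemma sum_exp_neg_leftOutEntropy_le (K : ℕ) :
    ∑ R ∈ (Finset.range K).powerset, Real.exp (-leftOutEntropy K R) ≤ K + 1 := by
  have hcompl : ∀ R ∈ (Finset.range K).powerset,
      Real.exp (-leftOutEntropy K R) = Real.exp (-(K * Real.binEntropy (R.card / K))) := by
    intro R hR
    rcases K.eq_zero_or_pos with rfl | hK
    · simp [leftOutEntropy]
    have hsub := Finset.mem_powerset.1 hR
    have hle : R.card ≤ K := by simpa using Finset.card_le_card hsub
    rw [leftOutEntropy, Finset.card_sdiff_of_subset hsub, Finset.card_range, Nat.cast_sub hle,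
      ← Real.binEntropy_one_sub ((R.card : ℝ) / K), sub_div, div_self (Nat.cast_pos.2 hK).ne']
  rw [Finset.sum_congr rfl hcompl, Finset.sum_powerset_apply_card
    (fun m => Real.exp (-(K * Real.binEntropy (m / K)))), Finset.card_range]
  calc _ ≤ ∑ _ ∈ Finset.range (K + 1), (1 : ℝ) := by
        refine Finset.sum_le_sum fun _ _ => ?_
        rw [nsmul_eq_mul, Real.exp_neg, ← div_eq_mul_inv, div_le_one (Real.exp_pos _)]
        exact choose_le_exp_binEntropy K _
    _ = K + 1 := by simp

/-! ### Probabilities of type counts -/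

/-- The logarithm of the probability, up to a polynomial factor, of the observed type counts of the
pairs of blocks in `M`. -/
noncomputable def pairEntropy (l : ℕ) (M : Finset (ℕ × ℕ)) (f g : ℕ → ℕ) : ℝ :=
  M.card * (Real.log (1 / 9) + entropy (proportions fun x y => typeCount l M f g x y))

/-- The logarithm of the expected number of ways to leave out blocks such that the inner pairs have
the observed type counts, up to a polynomial factor. -/
noncomputable def totalEntropy (l : ℕ) (f g : ℕ → ℕ) (k k' : ℕ) (R R' : Finset ℕ) : ℝ :=
  leftOutEntropy (k + 1) R + leftOutEntropy (k' + 1) R' +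
    pairEntropy l (innerPairs k k' R R') f g

/-- The event that all block lengths are `l - 1`, `l` or `l + 1`. -/
def regularLengths {Ω : Type*} (l : ℕ) (BX BY : ℕ → Ω → ℕ) : Set Ω :=
  {ω | ∀ i, BX i ω ∈ Set.range (lengthOf l) ∧ BY i ω ∈ Set.range (lengthOf l)}

lemma typeCount_eq_card_filter {l : ℕ} {M : Finset (ℕ × ℕ)} {f g : ℕ → ℕ}
    {w : M → Fin 3 × Fin 3}
    (hw : ∀ e : M, f e.1.1 = lengthOf l (w e).1 ∧ g e.1.2 = lengthOf l (w e).2) (x y : Fin 3) :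
    typeCount l M f g x y = (Finset.univ.filter fun e => w e = (x, y)).card := by
  have hiff (e : M) : f e.1.1 = lengthOf l x ∧ g e.1.2 = lengthOf l y ↔ w e = (x, y) := by
    rw [(hw e).1, (hw e).2, (lengthOf_injective l).eq_iff, (lengthOf_injective l).eq_iff,
      Prod.ext_iff]
  rw [typeCount, pairCount, ← Finset.card_map (Function.Embedding.subtype _)]
  congr 1
  ext e
  simp only [Finset.mem_filter, Finset.mem_map, Finset.mem_univ, true_and,
    Function.Embedding.coe_subtype]
  constructor
  · rintro ⟨he, hlen⟩
    exact ⟨⟨e, he⟩, (hiff ⟨e, he⟩).1 hlen, rfl⟩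
  · rintro ⟨e', he', rfl⟩
    exact ⟨e'.2, (hiff e').2 he'⟩

namespace IsBlockModel

variable {Ω : Type*} [MeasurableSpace Ω] {μ : Measure Ω} {l : ℕ} {sX sY : Ω → Bool}
  {BX BY : ℕ → Ω → ℕ} (hB : IsBlockModel μ l sX sY BX BY) (hl : 1 ≤ l)
include hB hl

lemma measure_lengths_eq {ι : Type*} [Fintype ι] {u v : ι → ℕ} (hu : Function.Injective u)
    (hv : Function.Injective v) (w : ι → Fin 3 × Fin 3) :
    μ.real {ω | ∀ e, BX (u e) ω = lengthOf l (w e).1 ∧ BY (v e) ω = lengthOf l (w e).2} =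
      (1 / 9) ^ Fintype.card ι := by
  have hmem (x : Fin 3) : lengthOf l x ∈ ({l - 1, l, l + 1} : Finset ℕ) := by
    simpa using (mem_range_lengthOf_iff hl).1 ⟨x, rfl⟩
  have hX (e : ι) : μ (BX (u e) ⁻¹' {lengthOf l (w e).1}) = 1 / 3 := hB.law_BX (u e) _ (hmem _)
  have hY (e : ι) : μ (BY (v e) ⁻¹' {lengthOf l (w e).2}) = 1 / 3 := hB.law_BY (v e) _ (hmem _)
  have hindep := (hB.indep_lengths.precomp (hu.sumMap hv)).measure_inter_preimage_eq_mul
    Finset.univ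
    (sets := fun i => {lengthOf l (Sum.elim (fun e => (w e).1) (fun e => (w e).2) i)})
    (fun i _ => MeasurableSet.singleton _)
  rw [Fintype.prod_sum_type] at hindep
  simp only [Sum.map_inl, Sum.map_inr, Sum.elim_inl, Sum.elim_inr, hX, hY, Finset.prod_const,
    Finset.card_univ, ← mul_pow] at hindep
  have hset : {ω | ∀ e, BX (u e) ω = lengthOf l (w e).1 ∧ BY (v e) ω = lengthOf l (w e).2} =
      ⋂ i ∈ (Finset.univ : Finset (ι ⊕ ι)), (Sum.elim BX BY (Sum.map u v i)) ⁻¹'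
        {lengthOf l (Sum.elim (fun e => (w e).1) (fun e => (w e).2) i)} := by
    ext ω
    simp [forall_and]
  rw [Measure.real, hset, hindep, ENNReal.toReal_pow, ENNReal.toReal_mul]
  norm_num

variable [IsProbabilityMeasure μ] {M : Finset (ℕ × ℕ)} (hfst : Set.InjOn Prod.fst (M : Set (ℕ × ℕ)))
  (hsnd : Set.InjOn Prod.snd (M : Set (ℕ × ℕ)))
include hfst hsnd

lemma measure_typeCount_eq_le (c : Fin 3 → Fin 3 → ℕ) (hc : ∑ x, ∑ y, c x y = M.card) :
    μ.real {ω ∈ regularLengths l BX BY | ∀ x y, typeCount l M (BX · ω) (BY · ω) x y = c x y} ≤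
      Real.exp (M.card * (Real.log (1 / 9) + entropy (proportions fun x y => c x y))) := by
  set W := (Finset.univ : Finset (M → Fin 3 × Fin 3)).filter fun w =>
    ∀ a, (Finset.univ.filter fun e => w e = a).card = c a.1 a.2
  set E : (M → Fin 3 × Fin 3) → Set Ω := fun w =>
    {ω | ∀ e : M, BX e.1.1 ω = lengthOf l (w e).1 ∧ BY e.1.2 ω = lengthOf l (w e).2}
  have hsub : {ω ∈ regularLengths l BX BY |
      ∀ x y, typeCount l M (BX · ω) (BY · ω) x y = c x y} ⊆ ⋃ w ∈ W, E w := by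
    rintro ω ⟨hreg, hcount⟩
    choose wX hwX using fun i => (hreg i).1
    choose wY hwY using fun i => (hreg i).2
    have hw (e : M) : BX e.1.1 ω = lengthOf l (wX e.1.1) ∧ BY e.1.2 ω = lengthOf l (wY e.1.2) :=
      ⟨(hwX _).symm, (hwY _).symm⟩
    simp only [Set.mem_iUnion]
    refine ⟨fun e => (wX e.1.1, wY e.1.2), Finset.mem_filter.2 ⟨Finset.mem_univ _, ?_⟩, hw⟩
    exact fun a => (typeCount_eq_card_filter hw a.1 a.2).symm.trans (hcount a.1 a.2)
  have hE (w : M → Fin 3 × Fin 3) : μ.real (E w) = Real.exp (M.card * Real.log (1 / 9)) := by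
    have := hB.measure_lengths_eq hl (u := fun e : M => e.1.1) (v := fun e => e.1.2)
      hfst.injective hsnd.injective w
    rw [this, Fintype.card_coe, Real.exp_nat_mul, Real.exp_log (by norm_num)]
  have hW : (W.card : ℝ) ≤ Real.exp (M.card * entropy (proportions fun x y => c x y)) := by
    have := card_words_le (ι := M) (fun a : Fin 3 × Fin 3 => c a.1 a.2)
      (by rw [Fintype.sum_prod_type, hc, Fintype.card_coe])
    simp only [Fintype.card_coe, Fintype.sum_prod_type, ← hc] at this
    simpa only [entropy_eq_sum_negMulLog, proportions, ← hc, Nat.cast_sum] using this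
  calc _ ≤ μ.real (⋃ w ∈ W, E w) := measureReal_mono hsub (measure_ne_top _ _)
    _ ≤ ∑ w ∈ W, μ.real (E w) := measureReal_biUnion_finset_le _ _
    _ = W.card * Real.exp (M.card * Real.log (1 / 9)) := by
        rw [Finset.sum_congr rfl fun w _ => hE w, Finset.sum_const, nsmul_eq_mul]
    _ ≤ Real.exp (M.card * entropy (proportions fun x y => c x y)) *
          Real.exp (M.card * Real.log (1 / 9)) := by gcongr
    _ = _ := by rw [← Real.exp_add, mul_add, add_comm]

lemma measure_pairEntropy_lt_le {n : ℕ} (hM : M.card ≤ n) (r : ℝ) :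
    μ.real {ω ∈ regularLengths l BX BY | pairEntropy l M (BX · ω) (BY · ω) < r} ≤
      ((n : ℝ) + 1) ^ 9 * Real.exp r := by
  set C := (Finset.univ : Finset (Fin 3 → Fin 3 → Fin (n + 1))).filter fun c =>
    ∑ x, ∑ y, (c x y : ℕ) = M.card ∧
      M.card * (Real.log (1 / 9) + entropy (proportions fun x y => (c x y : ℕ))) < r
  set E : (Fin 3 → Fin 3 → Fin (n + 1)) → Set Ω := fun c =>
    {ω ∈ regularLengths l BX BY | ∀ x y, typeCount l M (BX · ω) (BY · ω) x y = c x y}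
  have hsub : {ω ∈ regularLengths l BX BY | pairEntropy l M (BX · ω) (BY · ω) < r} ⊆
      ⋃ c ∈ C, E c := by
    rintro ω ⟨hreg, hlt⟩
    have hle (x y) : typeCount l M (BX · ω) (BY · ω) x y < n + 1 :=
      Nat.lt_succ_of_le ((Finset.card_filter_le _ _).trans hM)
    obtain ⟨c, hc⟩ : ∃ c : Fin 3 → Fin 3 → Fin (n + 1),
        ∀ x y, typeCount l M (BX · ω) (BY · ω) x y = c x y :=
      ⟨fun x y => ⟨_, hle x y⟩, fun _ _ => rfl⟩
    have hsum := sum_typeCount (l := l) (M := M) (f := (BX · ω)) (g := (BY · ω))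
      fun e _ => ⟨(hreg e.1).1, (hreg e.2).2⟩
    simp only [pairEntropy, hc] at hlt hsum
    simp only [Set.mem_iUnion]
    exact ⟨c, Finset.mem_filter.2 ⟨Finset.mem_univ _, hsum, hlt⟩, hreg, hc⟩
  have hE : ∀ c ∈ C, μ.real (E c) ≤ Real.exp r := by
    intro c hc
    obtain ⟨-, hsum, hlt⟩ := Finset.mem_filter.1 hc
    exact (hB.measure_typeCount_eq_le hl hfst hsnd (fun x y => c x y) hsum).trans
      (Real.exp_le_exp.2 hlt.le)
  have hC : C.card ≤ (n + 1) ^ 9 := by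
    refine (Finset.card_le_univ C).trans_eq ?_
    simp only [Fintype.card_pi, Fintype.card_fin, Finset.prod_const, Finset.card_univ, ← pow_mul]
  calc _ ≤ μ.real (⋃ c ∈ C, E c) := measureReal_mono hsub (measure_ne_top _ _)
    _ ≤ ∑ _ ∈ C, Real.exp r :=
        (measureReal_biUnion_finset_le _ _).trans (Finset.sum_le_sum hE)
    _ = C.card * Real.exp r := by rw [Finset.sum_const, nsmul_eq_mul]
    _ ≤ ((n : ℝ) + 1) ^ 9 * Real.exp r := by
        gcongr
        exact_mod_cast hC

omit hfst hsnd

lemma measure_exists_subsets_totalEntropy_lt_le {k k' n : ℕ} (hk : k < n) (hk' : k' < n) (r : ℝ) :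
    μ.real {ω ∈ regularLengths l BX BY | ∃ R ⊆ Finset.range (k + 1), ∃ R' ⊆ Finset.range (k' + 1),
      totalEntropy l (BX · ω) (BY · ω) k k' R R' < r} ≤ ((n : ℝ) + 1) ^ 11 * Real.exp r := by
  set E : Finset ℕ → Finset ℕ → Set Ω := fun R R' =>
    {ω ∈ regularLengths l BX BY | pairEntropy l (innerPairs k k' R R') (BX · ω) (BY · ω) <
      r - leftOutEntropy (k + 1) R - leftOutEntropy (k' + 1) R'}
  have hE (R R') : μ.real (E R R') ≤ ((n : ℝ) + 1) ^ 9 * Real.exp r *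
      (Real.exp (-leftOutEntropy (k + 1) R) * Real.exp (-leftOutEntropy (k' + 1) R')) := by
    refine (hB.measure_pairEntropy_lt_le hl
      ((fst_injOn_singlePairs R R').mono (Finset.coe_subset.2 (Finset.filter_subset _ _)))
      ((snd_injOn_singlePairs R R').mono (Finset.coe_subset.2 (Finset.filter_subset _ _)))
      ((card_innerPairs_le k k' R R').trans hk.le) _).trans_eq ?_
    rw [mul_assoc, ← Real.exp_add, ← Real.exp_add, sub_eq_add_neg, sub_eq_add_neg, add_assoc]
  have hsub : {ω ∈ regularLengths l BX BY | ∃ R ⊆ Finset.range (k + 1),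
      ∃ R' ⊆ Finset.range (k' + 1), totalEntropy l (BX · ω) (BY · ω) k k' R R' < r} ⊆
      ⋃ R ∈ (Finset.range (k + 1)).powerset, ⋃ R' ∈ (Finset.range (k' + 1)).powerset, E R R' := by
    rintro ω ⟨hreg, R, hR, R', hR', hlt⟩
    rw [totalEntropy] at hlt
    simp only [Set.mem_iUnion]
    exact ⟨R, Finset.mem_powerset.2 hR, R', Finset.mem_powerset.2 hR', hreg, by linarith⟩
  have hsum {k : ℕ} (hk : k < n) : ∑ R ∈ (Finset.range (k + 1)).powerset,
      Real.exp (-leftOutEntropy (k + 1) R) ≤ (n : ℝ) + 1 :=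
    (sum_exp_neg_leftOutEntropy_le (k + 1)).trans (by gcongr; exact hk)
  calc _ ≤ _ := measureReal_mono hsub (measure_ne_top _ _)
    _ ≤ ∑ R ∈ (Finset.range (k + 1)).powerset, ∑ R' ∈ (Finset.range (k' + 1)).powerset,
          ((n : ℝ) + 1) ^ 9 * Real.exp r *
            (Real.exp (-leftOutEntropy (k + 1) R) * Real.exp (-leftOutEntropy (k' + 1) R')) := by
        refine (measureReal_biUnion_finset_le _ _).trans (Finset.sum_le_sum fun R _ => ?_)
        exact (measureReal_biUnion_finset_le _ _).trans (Finset.sum_le_sum fun R' _ => hE R R')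
    _ = ((n : ℝ) + 1) ^ 9 * Real.exp r *
          ((∑ R ∈ (Finset.range (k + 1)).powerset, Real.exp (-leftOutEntropy (k + 1) R)) *
          ∑ R' ∈ (Finset.range (k' + 1)).powerset, Real.exp (-leftOutEntropy (k' + 1) R')) := by
        rw [Finset.sum_mul_sum]
        simp only [Finset.mul_sum]
    _ ≤ ((n : ℝ) + 1) ^ 9 * Real.exp r * (((n : ℝ) + 1) * ((n : ℝ) + 1)) := by
        gcongr
        exacts [hsum hk, hsum hk']
    _ = ((n : ℝ) + 1) ^ 11 * Real.exp r := by ring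

lemma measure_exists_totalEntropy_lt_le (n : ℕ) (r : ℝ) :
    μ.real {ω ∈ regularLengths l BX BY | ∃ k < n, ∃ k' < n, ∃ R ⊆ Finset.range (k + 1),
      ∃ R' ⊆ Finset.range (k' + 1), totalEntropy l (BX · ω) (BY · ω) k k' R R' < r} ≤
      ((n : ℝ) + 1) ^ 13 * Real.exp r := by
  have hsub : {ω ∈ regularLengths l BX BY | ∃ k < n, ∃ k' < n, ∃ R ⊆ Finset.range (k + 1),
      ∃ R' ⊆ Finset.range (k' + 1), totalEntropy l (BX · ω) (BY · ω) k k' R R' < r} ⊆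
      ⋃ k ∈ Finset.range n, ⋃ k' ∈ Finset.range n, {ω ∈ regularLengths l BX BY |
        ∃ R ⊆ Finset.range (k + 1), ∃ R' ⊆ Finset.range (k' + 1),
          totalEntropy l (BX · ω) (BY · ω) k k' R R' < r} := by
    rintro ω ⟨hreg, k, hk, k', hk', hlt⟩
    simp only [Set.mem_iUnion]
    exact ⟨k, Finset.mem_range.2 hk, k', Finset.mem_range.2 hk', hreg, hlt⟩
  calc _ ≤ _ := measureReal_mono hsub (measure_ne_top _ _)
    _ ≤ ∑ k ∈ Finset.range n, ∑ k' ∈ Finset.range n, ((n : ℝ) + 1) ^ 11 * Real.exp r := by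
        refine (measureReal_biUnion_finset_le _ _).trans (Finset.sum_le_sum fun k hk => ?_)
        refine (measureReal_biUnion_finset_le _ _).trans (Finset.sum_le_sum fun k' hk' => ?_)
        exact hB.measure_exists_subsets_totalEntropy_lt_le hl (Finset.mem_range.1 hk)
          (Finset.mem_range.1 hk') r
    _ = (n : ℝ) * n * (((n : ℝ) + 1) ^ 11 * Real.exp r) := by
        simp only [Finset.sum_const, Finset.card_range, nsmul_eq_mul]
        ring
    _ ≤ ((n : ℝ) + 1) * ((n : ℝ) + 1) * (((n : ℝ) + 1) ^ 11 * Real.exp r) := by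
        gcongr <;> linarith
    _ = ((n : ℝ) + 1) ^ 13 * Real.exp r := by ring

end IsBlockModel

/-! ### Deviations of the block counts -/

section Deviation

variable {Ω : Type*} [MeasurableSpace Ω] {μ : Measure Ω} [IsProbabilityMeasure μ]
  {B : ℕ → Ω → ℕ} {v : ℕ} {p : ℝ}

lemma card_blocksOfLength_sub_eq_sum (f : ℕ → ℕ) (k v : ℕ) (p : ℝ) :
    ((blocksOfLength f k v).card : ℝ) - k * p =
      ∑ i ∈ Finset.range k, ((if f i = v then 1 else 0) - p) := by
  rw [Finset.sum_sub_distrib, Finset.sum_boole, blocksOfLength, Finset.sum_const,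
    Finset.card_range, nsmul_eq_mul]

lemma hasSubgaussianMGF_ite_sub {Z : Ω → ℕ} (hZ : Measurable Z) (hp : μ.real {ω | Z ω = v} = p) :
    HasSubgaussianMGF (fun ω => (if Z ω = v then (1 : ℝ) else 0) - p) (1 / 4) μ := by
  have hmeas : Measurable fun ω => if Z ω = v then (1 : ℝ) else 0 :=
    (measurable_from_top (f := fun b => if b = v then (1 : ℝ) else 0)).comp hZ
  have hint : ∫ ω, (if Z ω = v then (1 : ℝ) else 0) ∂μ = p := by
    rw [← hp, ← integral_indicator_one (s := {ω | Z ω = v}) (hZ (MeasurableSet.singleton v))]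
    simp only [Set.indicator_apply, Set.mem_ofPred_eq, Pi.one_apply]
  have h := hasSubgaussianMGF_of_mem_Icc hmeas.aemeasurable (μ := μ) (a := 0) (b := 1)
    (Eventually.of_forall fun ω => by split_ifs <;> simp)
  rw [hint] at h
  convert h using 1
  norm_num

variable (hmeas : ∀ i, Measurable (B i)) (hindep : iIndepFun B μ)
  (hp : ∀ i, μ.real {ω | B i ω = v} = p)
include hmeas hindep hp

lemma measure_le_abs_card_blocksOfLength_sub_le (k : ℕ) {t : ℝ} (ht : 0 ≤ t) :
    μ.real {ω | t ≤ |((blocksOfLength (B · ω) k v).card : ℝ) - k * p|} ≤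
      2 * Real.exp (-(2 * t ^ 2 / k)) := by
  set D : ℕ → Ω → ℝ := fun i ω => (if B i ω = v then 1 else 0) - p
  have hD (i : ℕ) : HasSubgaussianMGF (D i) (1 / 4) μ := hasSubgaussianMGF_ite_sub (hmeas i) (hp i)
  have hindepD : iIndepFun D μ :=
    hindep.comp (fun _ b => (if b = v then (1 : ℝ) else 0) - p) fun _ => measurable_from_top
  have hexp : -t ^ 2 / (2 * k * ((1 / 4 : NNReal) : ℝ)) = -(2 * t ^ 2 / k) := by
    push_cast
    ring
  have hupper := HasSubgaussianMGF.measure_sum_range_ge_le_of_iIndepFun hindepD (n := k)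
    (fun i _ => hD i) ht
  have hlower := HasSubgaussianMGF.measure_sum_range_ge_le_of_iIndepFun
    (hindepD.comp (fun _ => Neg.neg) fun _ => measurable_neg) (n := k) (fun i _ => (hD i).neg) ht
  rw [hexp] at hupper hlower
  have hsub : {ω | t ≤ |((blocksOfLength (B · ω) k v).card : ℝ) - k * p|} ⊆
      {ω | t ≤ ∑ i ∈ Finset.range k, D i ω} ∪
        {ω | t ≤ ∑ i ∈ Finset.range k, (Neg.neg ∘ D i) ω} := by
    intro ω hω
    rw [Set.mem_ofPred_eq, card_blocksOfLength_sub_eq_sum, le_abs, ← Finset.sum_neg_distrib] at hω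
    exact hω
  have hunion := (measureReal_mono hsub (measure_ne_top μ _)).trans (measureReal_union_le _ _)
  linarith

lemma measure_exists_lt_abs_card_blocksOfLength_sub_le {δ : ℝ} (hδ : 0 ≤ δ) (n : ℕ) :
    μ.real {ω | ∃ k ≤ n, δ * n < |((blocksOfLength (B · ω) k v).card : ℝ) - k * p|} ≤
      (n + 1) * (2 * Real.exp (-(2 * δ ^ 2 * n))) := by
  have hδn : 0 ≤ δ * n := by positivity
  have hk : ∀ k ∈ Finset.range (n + 1),
      μ.real {ω | δ * n < |((blocksOfLength (B · ω) k v).card : ℝ) - k * p|} ≤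
        2 * Real.exp (-(2 * δ ^ 2 * n)) := by
    intro k hk
    rcases k.eq_zero_or_pos with rfl | hpos
    · simp only [blocksOfLength, Finset.range_zero, Finset.filter_empty, Finset.card_empty,
        Nat.cast_zero, zero_mul, sub_zero, abs_zero, hδn.not_gt, Set.ofPred_false,
        measureReal_empty]
      positivity
    · have hkn : (k : ℝ) ≤ n := by exact_mod_cast Nat.lt_succ_iff.1 (Finset.mem_range.1 hk)
      have hkpos : (0 : ℝ) < k := by exact_mod_cast hpos
      refine le_trans (measureReal_mono (fun ω (h : δ * n < _) => h.le) (measure_ne_top _ _))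
        ((measure_le_abs_card_blocksOfLength_sub_le hmeas hindep hp k hδn).trans ?_)
      gcongr
      rw [le_div_iff₀ hkpos, mul_pow, sq (n : ℝ)]
      nlinarith [mul_le_mul_of_nonneg_left hkn (by positivity : 0 ≤ δ ^ 2 * n)]
  have hsub : {ω | ∃ k ≤ n, δ * n < |((blocksOfLength (B · ω) k v).card : ℝ) - k * p|} ⊆
      ⋃ k ∈ Finset.range (n + 1),
        {ω | δ * n < |((blocksOfLength (B · ω) k v).card : ℝ) - k * p|} := by
    rintro ω ⟨k, hk, h⟩
    exact Set.mem_biUnion (Finset.mem_range.2 (Nat.lt_succ_of_le hk)) h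
  calc _ ≤ _ := measureReal_mono hsub (measure_ne_top _ _)
    _ ≤ ∑ _ ∈ Finset.range (n + 1), 2 * Real.exp (-(2 * δ ^ 2 * n)) :=
        (measureReal_biUnion_finset_le _ _).trans (Finset.sum_le_sum hk)
    _ = _ := by
        rw [Finset.sum_const, Finset.card_range, nsmul_eq_mul, Nat.cast_add_one]

end Deviation

/-! ### The conditional expectation is the mean over all choices -/

section CondExp

variable {Ω : Type*} [MeasurableSpace Ω] {μ : Measure Ω}

lemma comp_ae_eq_condExp_comap [IsFiniteMeasure μ] {α : Type*} [Countable α] {Z : Ω → α}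
    (hZ : Measurable[_, ⊤] Z) {F : Ω → ℝ} {g : α → ℝ} (hF : Integrable F μ)
    (hg : Integrable (g ∘ Z) μ)
    (h : ∀ z, ∫ ω in Z ⁻¹' {z}, g (Z ω) ∂μ = ∫ ω in Z ⁻¹' {z}, F ω ∂μ) :
    g ∘ Z =ᵐ[μ] μ[F | MeasurableSpace.comap Z ⊤] := by
  have hgmeas : Measurable[MeasurableSpace.comap Z ⊤] (g ∘ Z) := fun s _ => ⟨g ⁻¹' s, trivial, rfl⟩
  refine ae_eq_condExp_of_forall_setIntegral_eq hZ.comap_le hF (fun _ _ _ => hg.integrableOn) ?_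
    hgmeas.stronglyMeasurable.aestronglyMeasurable
  rintro _ ⟨T, -, rfl⟩ -
  have hunion : Z ⁻¹' T = ⋃ z : T, Z ⁻¹' {(z : α)} := by
    ext ω
    simp
  have hmeas (z : T) : MeasurableSet (Z ⁻¹' {(z : α)}) := hZ trivial
  have hdisj : Pairwise (Function.onFun Disjoint fun z : T => Z ⁻¹' {(z : α)}) := fun z z' hz =>
    Disjoint.preimage Z (Set.disjoint_singleton.2 (Subtype.coe_injective.ne hz))
  rw [hunion, integral_iUnion hmeas hdisj hg.integrableOn,
    integral_iUnion hmeas hdisj hF.integrableOn]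
  exact tsum_congr fun z => h z

lemma setIntegral_comp_eq_mul_mean [IsFiniteMeasure μ] {β : Type*} [MeasurableSpace β]
    [MeasurableSingletonClass β] {C : Ω → β} (hC : Measurable C) {A : Set Ω} (hA : MeasurableSet A)
    {S : Finset β} (hS : S.Nonempty) (hlaw : ∀ c ∈ S, μ (A ∩ C ⁻¹' {c}) = μ A / S.card)
    (φ : β → ℝ) : ∫ ω in A, φ (C ω) ∂μ = μ.real A * ((∑ c ∈ S, φ c) / S.card) := by
  have hmeas (c : β) : MeasurableSet (A ∩ C ⁻¹' {c}) :=
    hA.inter (hC (MeasurableSet.singleton c))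
  have hdisj : Set.PairwiseDisjoint (S : Set β) fun c => A ∩ C ⁻¹' {c} := fun c _ c' _ hcc =>
    ((Set.disjoint_singleton.2 hcc).preimage C).mono Set.inter_subset_right Set.inter_subset_right
  have hcover : (⋃ c ∈ S, A ∩ C ⁻¹' {c}) =ᵐ[μ] A := by
    refine ae_eq_of_subset_of_measure_ge (Set.iUnion₂_subset fun c _ => Set.inter_subset_left) ?_
      (Finset.measurableSet_biUnion _ fun c _ => hmeas c).nullMeasurableSet (measure_ne_top _ _)
    rw [measure_biUnion_finset hdisj fun c _ => hmeas c, Finset.sum_congr rfl hlaw,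
      Finset.sum_const, nsmul_eq_mul,
      ENNReal.mul_div_cancel (by exact_mod_cast hS.card_pos.ne') (ENNReal.natCast_ne_top _)]
  have hconst (c : β) : Set.EqOn (fun ω => φ (C ω)) (fun _ => φ c) (A ∩ C ⁻¹' {c}) :=
    fun ω hω => congrArg φ hω.2
  rw [← setIntegral_congr_set hcover, integral_biUnion_finset S (fun c _ => hmeas c) hdisj
    fun c _ => (integrableOn_congr_fun (hconst c) (hmeas c)).2 integrableOn_const,
    Finset.sum_div, Finset.mul_sum]
  refine Finset.sum_congr rfl fun c hc => ?_
  rw [setIntegral_congr_fun (hmeas c) (hconst c), setIntegral_const, smul_eq_mul, Measure.real,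
    Measure.real, hlaw c hc, ENNReal.toReal_div, ENNReal.toReal_natCast]
  ring

lemma abs_lcsLength_sub_le (x x' y : List Bool) :
    |(lcsLength x y : ℝ) - lcsLength x' y| ≤ y.length :=
  abs_sub_le_of_nonneg_of_le (Nat.cast_nonneg _) (by exact_mod_cast lcsLength_le_length x y)
    (Nat.cast_nonneg _) (by exact_mod_cast lcsLength_le_length x' y)

lemma abs_meanChange_le (l : ℕ) (x y : List Bool) : |meanChange l x y| ≤ y.length := by
  rw [meanChange, abs_div, Nat.abs_cast]
  refine div_le_of_le_mul₀ (Nat.cast_nonneg _) (Nat.cast_nonneg _) ?_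
  refine (Finset.abs_sum_le_sum_abs _ _).trans ?_
  refine (Finset.sum_le_card_nsmul _ _ _ fun c _ => abs_lcsLength_sub_le _ x y).trans_eq ?_
  rw [nsmul_eq_mul, mul_comm]

variable {l n : ℕ} {X Y : Ω → List Bool} {C : Ω → ℕ × ℕ}

lemma IsUniformChoice.setIntegral_meanChange_eq [IsFiniteMeasure μ]
    (hC : IsUniformChoice μ l X Y C)
    (hXY : Measurable[_, ⊤] fun ω => (X ω, Y ω)) (z : List Bool × List Bool) :
    ∫ ω in (fun ω => (X ω, Y ω)) ⁻¹' {z}, meanChange l (X ω) (Y ω) ∂μ =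
      ∫ ω in (fun ω => (X ω, Y ω)) ⁻¹' {z},
        ((lcsLength (modifyString l (X ω) (C ω)) (Y ω) : ℝ) - lcsLength (X ω) (Y ω)) ∂μ := by
  obtain ⟨x, y⟩ := z
  set A := (fun ω => (X ω, Y ω)) ⁻¹' {(x, y)}
  have hA : MeasurableSet A := hXY trivial
  have hAxy : A = {ω | X ω = x ∧ Y ω = y} := by
    ext ω
    simp [A]
  rw [setIntegral_congr_fun hA (g := fun _ => meanChange l x y), setIntegral_const, smul_eq_mul,
    setIntegral_congr_fun (g := fun ω => (lcsLength (modifyString l x (C ω)) y : ℝ) -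
      lcsLength x y) hA]
  · rcases (choices l x).eq_empty_or_nonempty with hempty | hne
    · simp [meanChange, modifyString, hempty]
    · refine (setIntegral_comp_eq_mul_mean hC.measurable_choice hA hne (fun c hc => ?_)
        fun c => (lcsLength (modifyString l x c) y : ℝ) - lcsLength x y).symm
      rw [hAxy, ← hC.law_choice x y c hc]
      congr 1
      ext ω
      simp [and_assoc]
  all_goals
    intro ω hω
    obtain ⟨rfl, rfl⟩ := Prod.mk.inj hω
    rfl

theorem IsUniformChoice.expectedChange_ae_eq [IsFiniteMeasure μ] (hC : IsUniformChoice μ l X Y C)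
    (hXY : Measurable[_, ⊤] fun ω => (X ω, Y ω)) (hY : ∀ ω, (Y ω).length ≤ n) :
    expectedChange μ l X Y C =ᵐ[μ] fun ω => meanChange l (X ω) (Y ω) := by
  have hYn (ω : Ω) : ((Y ω).length : ℝ) ≤ n := by exact_mod_cast hY ω
  let _ : MeasurableSpace (List Bool × List Bool) := ⊤
  have hchange := (Measurable.of_discrete (f := fun z : (List Bool × List Bool) × (ℕ × ℕ) =>
    (lcsLength (modifyString l z.1.1 z.2) z.1.2 : ℝ) - lcsLength z.1.1 z.1.2)).comp
      (Measurable.prodMk hXY hC.measurable_choice)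
  have hmean :=
    (measurable_from_top (f := fun z : List Bool × List Bool => meanChange l z.1 z.2)).comp hXY
  have hchange_int := Integrable.of_bound (μ := μ) hchange.aestronglyMeasurable (n : ℝ)
    (ae_of_all _ fun ω => (abs_lcsLength_sub_le _ _ _).trans (hYn ω))
  have hmean_int := Integrable.of_bound (μ := μ) hmean.aestronglyMeasurable (n : ℝ)
    (ae_of_all _ fun ω => (abs_meanChange_le _ _ _).trans (hYn ω))
  exact (comp_ae_eq_condExp_comap hXY hchange_int hmean_int
    (hC.setIntegral_meanChange_eq hXY)).symm

lemma IsBlockModel.measurable_blockString {sX sY : Ω → Bool} {BX BY : ℕ → Ω → ℕ}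
    (hB : IsBlockModel μ l sX sY BX BY) (n : ℕ) :
    Measurable[_, ⊤] fun ω =>
      (blockString (sX ω) (BX · ω) n, blockString (sY ω) (BY · ω) n) := by
  let _ : MeasurableSpace (List Bool) := ⊤
  have hstring {s : Ω → Bool} {B : ℕ → Ω → ℕ} (hs : Measurable s) (hB : ∀ i, Measurable (B i)) :
      Measurable fun ω => blockString (s ω) (B · ω) n := by
    have hfactor : (fun ω => blockString (s ω) (B · ω) n) =
        (fun z : Bool × (Fin n → ℕ) =>
          blockString z.1 (fun i => if h : i < n then z.2 ⟨i, h⟩ else 0) n) ∘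
          fun ω => (s ω, fun i : Fin n => B i ω) := by
      funext ω
      exact blockString_congr _ fun i hi => by simp only [dif_pos hi]
    rw [hfactor]
    exact Measurable.of_discrete.comp (hs.prodMk (measurable_pi_lambda _ fun i => hB i))
  exact fun T _ => ((hstring hB.measurable_sX hB.measurable_BX).prodMk
    (hstring hB.measurable_sY hB.measurable_BY)) (MeasurableSet.of_discrete (s := T))

end CondExp

/-! ### Typical block lengths -/

lemma sum_add_card_blocksOfLength {l k : ℕ} (hl : 1 ≤ l) {B : ℕ → ℕ}
    (hB : ∀ i < k, B i ∈ Set.range (lengthOf l)) :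
    ∑ i ∈ Finset.range k, B i + (blocksOfLength B k (l - 1)).card =
      k * l + (blocksOfLength B k (l + 1)).card := by
  have hconst : k * l = ∑ _ ∈ Finset.range k, l := by
    rw [Finset.sum_const, Finset.card_range, smul_eq_mul]
  rw [blocksOfLength, blocksOfLength, Finset.card_filter, Finset.card_filter, hconst,
    ← Finset.sum_add_distrib, ← Finset.sum_add_distrib]
  refine Finset.sum_congr rfl fun i hi => ?_
  have := (mem_range_lengthOf_iff hl).1 (hB i (Finset.mem_range.1 hi))
  split_ifs <;> omega

section Congruence

variable {l k k' : ℕ} {f g B B' : ℕ → ℕ}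

lemma blocksOfLength_congr (h : ∀ i < k, f i = B i) (v : ℕ) :
    blocksOfLength f k v = blocksOfLength B k v :=
  Finset.filter_congr fun i hi => by rw [h i (Finset.mem_range.1 hi)]

lemma card_blocksOfLength_le_succ (f : ℕ → ℕ) (k v : ℕ) :
    (blocksOfLength f k v).card ≤ (blocksOfLength f (k + 1) v).card :=
  Finset.card_le_card (Finset.filter_subset_filter _ (Finset.range_subset_range.2 k.le_succ))

lemma card_blocksOfLength_succ_le (f : ℕ → ℕ) (k v : ℕ) :
    (blocksOfLength f (k + 1) v).card ≤ (blocksOfLength f k v).card + 1 := by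
  rw [blocksOfLength, Finset.range_add_one, Finset.filter_insert]
  split_ifs
  · exact Finset.card_insert_le _ _
  · exact Nat.le_succ _

lemma totalEntropy_congr (hf : ∀ i < k, f i = B i) (hg : ∀ j < k', g j = B' j)
    (R R' : Finset ℕ) : totalEntropy l f g k k' R R' = totalEntropy l B B' k k' R R' := by
  have hcount (x y : Fin 3) : typeCount l (innerPairs k k' R R') f g x y =
      typeCount l (innerPairs k k' R R') B B' x y := by
    unfold typeCount pairCount
    congr 1
    refine Finset.filter_congr fun e he => ?_
    obtain ⟨-, hi, hj⟩ := mem_innerPairs.1 he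
    rw [hf _ hi, hg _ hj]
  simp only [totalEntropy, pairEntropy, hcount]

end Congruence

/-- Among the first `k` blocks, for every `k ≤ n`, the numbers of short and of long blocks differ
from `k / 3` by at most `θ * n`. -/
structure IsTypical (l n : ℕ) (θ : ℝ) (B : ℕ → ℕ) : Prop where
  mem : ∀ i, B i ∈ Set.range (lengthOf l)
  short : ∀ k ≤ n, |((blocksOfLength B k (l - 1)).card : ℝ) - k * (1 / 3)| ≤ θ * n
  long : ∀ k ≤ n, |((blocksOfLength B k (l + 1)).card : ℝ) - k * (1 / 3)| ≤ θ * n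

/-- The block lengths `f 0, …, f k` of the first `n` letters of a string with typical block
lengths `B`; only the last block may be truncated. -/
structure IsTypicalTruncation (l n : ℕ) (θ : ℝ) (B f : ℕ → ℕ) (k : ℕ) : Prop
    extends IsBlockLengths l k f where
  lt : k < n
  eq : ∀ i < k, f i = B i
  length : |((k + 1 : ℕ) : ℝ) * l - n| ≤ 5 / 2 * (θ * n)
  short : |((blocksOfLength f (k + 1) (l - 1)).card : ℝ) - ((k + 1 : ℕ) : ℝ) / 3| ≤ 2 * (θ * n)
  long : |((blocksOfLength f (k + 1) (l + 1)).card : ℝ) - ((k + 1 : ℕ) : ℝ) / 3| ≤ 2 * (θ * n)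

section Typical

variable {l n : ℕ} {θ : ℝ} {B f : ℕ → ℕ} {k : ℕ}

lemma IsTypical.pos (h : IsTypical l n θ B) (hl : 2 ≤ l) (i : ℕ) : 0 < B i := by
  rcases (mem_range_lengthOf_iff (one_le_two.trans hl)).1 (h.mem i) with hi | hi | hi <;> omega

lemma IsTypical.isTypicalTruncation (h : IsTypical l n θ B) (hl : 1 ≤ l)
    (hn : 2 * (l : ℝ) + 2 ≤ θ * n) (hk : k < n) (hfB : ∀ i < k, f i = B i) (hpos : 0 < f k)
    (hle : f k ≤ B k) (hsum : ∑ i ∈ Finset.range (k + 1), f i = n) :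
    IsTypicalTruncation l n θ B f k := by
  have hmem (i : ℕ) := (mem_range_lengthOf_iff hl).1 (h.mem i)
  have hfk : f k ≤ l + 1 := by
    have := hmem k
    omega
  have hfk' : (f k : ℝ) ≤ l + 1 := by exact_mod_cast hfk
  have hlength : (n : ℝ) + (blocksOfLength B k (l - 1)).card =
      k * l + (blocksOfLength B k (l + 1)).card + f k := by
    have := sum_add_card_blocksOfLength hl fun i (_ : i < k) => h.mem i
    rw [Finset.sum_range_succ,
      Finset.sum_congr rfl fun i hi => hfB i (Finset.mem_range.1 hi)] at hsum
    norm_cast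
    linarith
  have hcard (v : ℕ) : ((blocksOfLength B k v).card : ℝ) ≤ (blocksOfLength f (k + 1) v).card ∧
      ((blocksOfLength f (k + 1) v).card : ℝ) ≤ (blocksOfLength B k v).card + 1 := by
    rw [← blocksOfLength_congr hfB]
    exact_mod_cast And.intro (card_blocksOfLength_le_succ f k v) (card_blocksOfLength_succ_le f k v)
  have hshort := abs_le.1 (h.short k hk.le)
  have hlong := abs_le.1 (h.long k hk.le)
  refine ⟨⟨fun i hi => hfB i hi ▸ hmem i, hpos, hfk⟩, hk, hfB, ?_, ?_, ?_⟩ <;>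
    rw [abs_le] <;> push_cast
  · constructor <;> linarith [(f k).cast_nonneg (α := ℝ), l.cast_nonneg (α := ℝ)]
  · constructor <;> linarith [hcard (l - 1), l.cast_nonneg (α := ℝ)]
  · constructor <;> linarith [hcard (l + 1), l.cast_nonneg (α := ℝ)]

lemma IsTypical.exists_isTypicalTruncation (h : IsTypical l n θ B) (hl : 2 ≤ l)
    (hn : 2 * (l : ℝ) + 2 ≤ θ * n) (s : Bool) :
    ∃ f k, IsTypicalTruncation l n θ B f k ∧
      blockString s B n = (blockList s f (k + 1)).flatten := by
  have hn0 : 0 < n := by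
    refine n.pos_of_ne_zero fun hzero => ?_
    rw [hzero, Nat.cast_zero, mul_zero] at hn
    linarith [l.cast_nonneg (α := ℝ)]
  obtain ⟨k, f, hk, hfB, hpos, hle, hsum, hstring⟩ :=
    exists_blockString_eq_flatten_blockList s (h.pos hl) hn0
  exact ⟨f, k, h.isTypicalTruncation (one_le_two.trans hl) hn hk hfB hpos hle hsum, hstring⟩

namespace IsTypicalTruncation

variable {η : ℝ} (h : IsTypicalTruncation l n θ B f k)
include h

lemma five_mul_le (hl : 1 ≤ l) (hθ0 : 0 ≤ θ) (hθ : θ * (10 * l) ≤ η) (hη : η ≤ 1) :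
    5 * (θ * n) ≤ η * (k + 1 : ℕ) := by
  have hl1 : (1 : ℝ) ≤ l := by exact_mod_cast hl
  have hθn : θ * n ≤ 1 / 10 * n := by
    gcongr
    linarith [mul_le_mul_of_nonneg_left hl1 hθ0]
  have hnK : (n : ℝ) ≤ 2 * ((k + 1 : ℕ) * l) := by
    linarith [abs_le.1 h.length, n.cast_nonneg (α := ℝ)]
  calc 5 * (θ * n) ≤ 5 * (θ * (2 * ((k + 1 : ℕ) * l))) := by gcongr
    _ = θ * (10 * l) * (k + 1 : ℕ) := by ring
    _ ≤ η * (k + 1 : ℕ) := by gcongr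

lemma abs_sub_le {B' g : ℕ → ℕ} {k' : ℕ} (h' : IsTypicalTruncation l n θ B' g k') (hl : 1 ≤ l) :
    |((k' + 1 : ℕ) : ℝ) - (k + 1 : ℕ)| ≤ 5 * (θ * n) := by
  have hl1 : (1 : ℝ) ≤ l := by exact_mod_cast hl
  calc |((k' + 1 : ℕ) : ℝ) - (k + 1 : ℕ)| ≤ |((k' + 1 : ℕ) : ℝ) - (k + 1 : ℕ)| * l :=
        le_mul_of_one_le_right (abs_nonneg _) hl1
    _ = |((k' + 1 : ℕ) * l - n : ℝ) - ((k + 1 : ℕ) * l - n)| := by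
        rw [sub_sub_sub_cancel_right, ← sub_mul, abs_mul, Nat.abs_cast]
    _ ≤ |((k' + 1 : ℕ) * l - n : ℝ)| + |((k + 1 : ℕ) * l - n : ℝ)| := abs_sub _ _
    _ ≤ 5 * (θ * n) := by linarith [h.length, h'.length]

end IsTypicalTruncation

end Typical

lemma le_of_le_div_sub_div {ε inc dec S L m : ℝ} (hS : 0 < S) (hL : 0 < L)
    (hle : ε ≤ inc / S - dec / L) (hm : inc * L - dec * S ≤ m * (S * L)) : ε ≤ m := by
  rw [div_sub_div _ _ hS.ne' hL.ne', mul_comm S dec] at hle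
  exact hle.trans ((div_le_iff₀ (mul_pos hS hL)).2 hm)

section MeanChange

variable {l n : ℕ} {q₀ ε η θ : ℝ}

lemma IsTypicalTruncation.le_meanChange {B B' f g : ℕ → ℕ} {k k' : ℕ} (hl : 2 ≤ l)
    (hη : IsTolerance q₀ ε η) (hθ0 : 0 < θ) (hθ : θ * (10 * l) ≤ η) (hn : 2 ≤ θ * n)
    (hf : IsTypicalTruncation l n θ B f k) (hg : IsTypicalTruncation l n θ B' g k')
    (hent : ∀ R ⊆ Finset.range (k + 1), ∀ R' ⊆ Finset.range (k' + 1),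
      -(θ * n) ≤ totalEntropy l B B' k k' R R') {s t : Bool}
    (hq : LeavesOutAtMost (blockList s f (k + 1)).flatten (blockList t g (k' + 1)).flatten q₀) :
    ε ≤ meanChange l (blockList s f (k + 1)).flatten (blockList t g (k' + 1)).flatten := by
  have hl1 : 1 ≤ l := one_le_two.trans hl
  obtain ⟨R, hR, R', hR', inc, dec, hqX, hqY, hcounts, hmean⟩ :=
    exists_isBlockCounts hl hf.toIsBlockLengths hg.toIsBlockLengths hq
  have hθK := hf.five_mul_le hl1 hθ0.le hθ (hη.le.trans (by norm_num))
  have hentropy := hent R hR R' hR'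
  rw [← totalEntropy_congr hf.eq hg.eq, totalEntropy, leftOutEntropy, leftOutEntropy, pairEntropy,
    ← sum_typeCount_innerPairs hl1 hf.toIsBlockLengths hg.toIsBlockLengths] at hentropy
  simp only [Nat.cast_sum] at hentropy
  obtain ⟨hS, hL, hle⟩ := hcounts.le_inc_div_sub_dec_div hη (Nat.cast_pos.2 k.succ_pos)
    (Nat.cast_pos.2 k'.succ_pos) hqX hqY ((hf.abs_sub_le hg hl1).trans hθK) (by linarith)
    (hf.short.trans (by linarith)) (hf.long.trans (by linarith)) (by linarith)
  exact le_of_le_div_sub_div hS hL hle hmean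

theorem IsTypical.le_meanChange {B B' : ℕ → ℕ} (hl : 2 ≤ l) (hη : IsTolerance q₀ ε η)
    (hθ0 : 0 < θ) (hθ : θ * (10 * l) ≤ η) (hn : 2 * (l : ℝ) + 2 ≤ θ * n)
    (hB : IsTypical l n θ B) (hB' : IsTypical l n θ B')
    (hent : ∀ k < n, ∀ k' < n, ∀ R ⊆ Finset.range (k + 1), ∀ R' ⊆ Finset.range (k' + 1),
      -(θ * n) ≤ totalEntropy l B B' k k' R R') {s t : Bool}
    (hq : LeavesOutAtMost (blockString s B n) (blockString t B' n) q₀) :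
    ε ≤ meanChange l (blockString s B n) (blockString t B' n) := by
  obtain ⟨f, k, hf, hx⟩ := hB.exists_isTypicalTruncation hl hn s
  obtain ⟨g, k', hg, hy⟩ := hB'.exists_isTypicalTruncation hl hn t
  rw [hx, hy] at hq ⊢
  exact hf.le_meanChange hl hη hθ0 hθ (by linarith [l.cast_nonneg (α := ℝ)]) hg
    (hent k hf.lt k' hg.lt) hq

end MeanChange

/-! ### Probability of the exceptional events -/

section Probability

variable {Ω : Type*} [MeasurableSpace Ω] {μ : Measure Ω} [IsProbabilityMeasure μ] {l : ℕ}

lemma ae_forall_mem_range_lengthOf (hl : 1 ≤ l) {B : ℕ → Ω → ℕ} (hmeas : ∀ i, Measurable (B i))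
    (hlaw : ∀ i, ∀ v ∈ ({l - 1, l, l + 1} : Finset ℕ), μ {ω | B i ω = v} = 1 / 3) :
    ∀ᵐ ω ∂μ, ∀ i, B i ω ∈ Set.range (lengthOf l) := by
  refine ae_all_iff.2 fun i => ?_
  have hcard : ({l - 1, l, l + 1} : Finset ℕ).card = 3 :=
    Finset.card_eq_three.2 ⟨_, _, _, by omega, by omega, by omega, rfl⟩
  have hfiber : ∀ v ∈ ({l - 1, l, l + 1} : Finset ℕ), μ (B i ⁻¹' {v}) = 1 / 3 := hlaw i
  have hsum : μ (B i ⁻¹' ({l - 1, l, l + 1} : Finset ℕ)) = 1 := by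
    rw [← sum_measure_preimage_singleton _ fun v _ => hmeas i (MeasurableSet.singleton v),
      Finset.sum_congr rfl hfiber, Finset.sum_const, hcard, nsmul_eq_mul, one_div]
    exact ENNReal.mul_inv_cancel (by norm_num) (by norm_num)
  filter_upwards [(mem_ae_iff_prob_eq_one (hmeas i (Finset.measurableSet _))).2 hsum] with ω hω
  rw [mem_range_lengthOf_iff hl]
  simpa using hω

lemma measure_not_isTypical_le (hl : 1 ≤ l) {B : ℕ → Ω → ℕ} (hmeas : ∀ i, Measurable (B i))
    (hindep : iIndepFun B μ)
    (hlaw : ∀ i, ∀ v ∈ ({l - 1, l, l + 1} : Finset ℕ), μ {ω | B i ω = v} = 1 / 3) {θ : ℝ}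
    (hθ : 0 ≤ θ) (n : ℕ) :
    μ.real {ω | ¬IsTypical l n θ (B · ω)} ≤
      2 * ((n + 1) * (2 * Real.exp (-(2 * θ ^ 2 * n)))) := by
  set D : ℕ → Set Ω := fun v =>
    {ω | ∃ k ≤ n, θ * n < |((blocksOfLength (B · ω) k v).card : ℝ) - k * (1 / 3)|}
  have hD (v : ℕ) (hv : v ∈ ({l - 1, l, l + 1} : Finset ℕ)) :
      μ.real (D v) ≤ (n + 1) * (2 * Real.exp (-(2 * θ ^ 2 * n))) :=
    measure_exists_lt_abs_card_blocksOfLength_sub_le hmeas hindep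
      (fun i => by rw [Measure.real, hlaw i v hv]; norm_num) hθ n
  have hsub : ∀ᵐ ω ∂μ, ¬IsTypical l n θ (B · ω) → ω ∈ D (l - 1) ∪ D (l + 1) := by
    filter_upwards [ae_forall_mem_range_lengthOf hl hmeas hlaw] with ω hmem
    contrapose!
    rintro hω
    simp only [D, Set.mem_union, Set.mem_ofPred_eq, not_or, not_exists, not_and, not_lt] at hω
    exact ⟨hmem, hω.1, hω.2⟩
  calc _ ≤ μ.real (D (l - 1) ∪ D (l + 1)) :=
        ENNReal.toReal_mono (measure_ne_top _ _) (measure_mono_ae hsub)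
    _ ≤ μ.real (D (l - 1)) + μ.real (D (l + 1)) := measureReal_union_le _ _
    _ ≤ _ := by
        rw [two_mul]
        exact add_le_add (hD _ (by simp)) (hD _ (by simp))

/-- A bound for the probability that the block lengths violate the entropy constraint or are not
typical. -/
noncomputable def failureBound (θ : ℝ) (n : ℕ) : ℝ :=
  ((n : ℝ) + 1) ^ 13 * Real.exp (-(θ * n)) +
    4 * (((n : ℝ) + 1) * (2 * Real.exp (-(2 * θ ^ 2 * n))))

theorem IsBlockModel.le_measure_le_meanChange {sX sY : Ω → Bool} {BX BY : ℕ → Ω → ℕ}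
    (hB : IsBlockModel μ l sX sY BX BY) (hl : 2 ≤ l) {q₀ ε η θ : ℝ} (hη : IsTolerance q₀ ε η)
    (hθ0 : 0 < θ) (hθ : θ * (10 * l) ≤ η) {n : ℕ} (hn : 2 * (l : ℝ) + 2 ≤ θ * n) :
    1 - failureBound θ n - μ.real {ω | LeavesOutAtMost
        (blockString (sX ω) (BX · ω) n) (blockString (sY ω) (BY · ω) n) q₀}ᶜ ≤
      μ.real {ω | ε ≤ meanChange l
        (blockString (sX ω) (BX · ω) n) (blockString (sY ω) (BY · ω) n)} := by
  have hl1 : 1 ≤ l := one_le_two.trans hl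
  set G := {ω | ε ≤ meanChange l (blockString (sX ω) (BX · ω) n) (blockString (sY ω) (BY · ω) n)}
  set F := {ω | LeavesOutAtMost
    (blockString (sX ω) (BX · ω) n) (blockString (sY ω) (BY · ω) n) q₀}ᶜ
  set E := {ω ∈ regularLengths l BX BY | ∃ k < n, ∃ k' < n, ∃ R ⊆ Finset.range (k + 1),
    ∃ R' ⊆ Finset.range (k' + 1), totalEntropy l (BX · ω) (BY · ω) k k' R R' < -(θ * n)}
  set TX := {ω | ¬IsTypical l n θ (BX · ω)}
  set TY := {ω | ¬IsTypical l n θ (BY · ω)}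
  have hcover : Set.univ ⊆ G ∪ (F ∪ (E ∪ (TX ∪ TY))) := by
    intro ω _
    by_contra hω
    simp only [Set.mem_union, not_or] at hω
    obtain ⟨hG, hF, hE, hTX, hTY⟩ := hω
    have hX : IsTypical l n θ (BX · ω) := not_not.1 hTX
    have hY : IsTypical l n θ (BY · ω) := not_not.1 hTY
    exact hG <| hX.le_meanChange hl hη hθ0 hθ hn hY
      (fun k hk k' hk' R hR R' hR' => not_lt.1 fun hlt =>
        hE ⟨fun i => ⟨hX.mem i, hY.mem i⟩, k, hk, k', hk', R, hR, R', hR', hlt⟩) (not_not.1 hF)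
  have hE := hB.measure_exists_totalEntropy_lt_le hl1 n (-(θ * n))
  have hTX := measure_not_isTypical_le hl1 hB.measurable_BX
    (hB.indep_lengths.precomp (g := Sum.inl) Sum.inl_injective) hB.law_BX hθ0.le n
  have hTY := measure_not_isTypical_le hl1 hB.measurable_BY
    (hB.indep_lengths.precomp (g := Sum.inr) Sum.inr_injective) hB.law_BY hθ0.le n
  have hone : 1 ≤ μ.real G + (μ.real F + (μ.real E + (μ.real TX + μ.real TY))) :=
    calc 1 = μ.real Set.univ := probReal_univ.symm
      _ ≤ _ := measureReal_mono hcover (measure_ne_top _ _)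
      _ ≤ _ := (measureReal_union_le _ _).trans <| add_le_add_right
        ((measureReal_union_le _ _).trans <| add_le_add_right
          ((measureReal_union_le _ _).trans <| add_le_add_right (measureReal_union_le _ _) _) _) _
  rw [failureBound]
  linarith

end Probability

lemma exists_eventually_failureBound_le {θ : ℝ} (hθ : 0 < θ) :
    ∃ c > 0, ∀ᶠ n : ℕ in atTop, failureBound θ n ≤ Real.exp (-(c * n)) := by
  set c := min θ (2 * θ ^ 2)
  have hc : 0 < c := lt_min hθ (by positivity)
  have hpow : ∀ᶠ n : ℕ in atTop,
      9 * ((n : ℝ) + 1) ^ 13 ≤ Real.exp (c / 2 * n) := by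
    have hlittle := (isLittleO_pow_exp_pos_mul_atTop 13 (half_pos hc)).bound
      (show (0 : ℝ) < 1 / (9 * Real.exp (c / 2)) by positivity)
    have hcast : Tendsto (fun n : ℕ => (n : ℝ) + 1) atTop atTop :=
      tendsto_natCast_atTop_atTop.atTop_add tendsto_const_nhds
    filter_upwards [hcast.eventually hlittle] with n hn
    rw [Real.norm_of_nonneg (by positivity), Real.norm_of_nonneg (Real.exp_pos _).le, mul_add,
      mul_one, Real.exp_add] at hn
    calc 9 * ((n : ℝ) + 1) ^ 13 ≤ 9 * (1 / (9 * Real.exp (c / 2)) *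
          (Real.exp (c / 2 * n) * Real.exp (c / 2))) := by gcongr
      _ = Real.exp (c / 2 * n) := by field_simp
  refine ⟨c / 2, half_pos hc, hpow.mono fun n hn => ?_⟩
  have hθc : Real.exp (-(θ * n)) ≤ Real.exp (-(c * n)) := by
    gcongr
    exact min_le_left _ _
  have hθc' : Real.exp (-(2 * θ ^ 2 * n)) ≤ Real.exp (-(c * n)) := by
    gcongr
    exact min_le_right _ _
  have hle : (n : ℝ) + 1 ≤ ((n : ℝ) + 1) ^ 13 :=
    le_self_pow₀ (le_add_of_nonneg_left n.cast_nonneg) (by norm_num)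
  calc failureBound θ n ≤ ((n : ℝ) + 1) ^ 13 * Real.exp (-(c * n)) +
        4 * (((n : ℝ) + 1) ^ 13 * (2 * Real.exp (-(c * n)))) := by rw [failureBound]; gcongr
    _ = 9 * ((n : ℝ) + 1) ^ 13 * Real.exp (-(c * n)) := by ring
    _ ≤ Real.exp (c / 2 * n) * Real.exp (-(c * n)) := by gcongr
    _ = Real.exp (-(c / 2 * n)) := by
        rw [← Real.exp_add]
        ring_nf

lemma eventually_exp_neg_mul_le {c : ℝ} (hc : 0 < c) :
    ∀ᶠ n : ℕ in atTop, Real.exp (-(c * n)) ≤ Real.exp (-((n : ℝ) ^ (1 / 2 : ℝ))) := by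
  filter_upwards [tendsto_natCast_atTop_atTop.eventually_ge_atTop (1 / c ^ 2)] with n hn
  have hn' : 1 ≤ n * c ^ 2 := (div_le_iff₀ (by positivity)).1 hn
  rw [Real.exp_le_exp, neg_le_neg_iff, ← Real.sqrt_eq_rpow, Real.sqrt_le_left (by positivity)]
  nlinarith [mul_le_mul_of_nonneg_left hn' (n.cast_nonneg (α := ℝ))]

end BlockLCS

theorem theorem3_general {Ω : Type*} [MeasurableSpace Ω] (μ : Measure Ω) [IsProbabilityMeasure μ]
    (l : ℕ) (hl : 2 ≤ l)
    (sX sY : Ω → Bool) (BX BY : ℕ → Ω → ℕ) (hB : IsBlockModel μ l sX sY BX BY)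
    (X Y : ℕ → Ω → List Bool)
    (hX : ∀ n ω, X n ω = blockString (sX ω) (fun i => BX i ω) n)
    (hY : ∀ n ω, Y n ω = blockString (sY ω) (fun i => BY i ω) n)
    (C : ℕ → Ω → ℕ × ℕ) (hC : ∀ n, IsUniformChoice μ l (X n) (Y n) (C n))
    (q₀ : ℝ) (ε : ℝ) (hε : 0 < ε) (hmin : 2 * ε ∈ lowerBounds (feasibleValues q₀)) :
    ∃ c : ℝ, 0 < c ∧ ∀ᶠ n : ℕ in atTop,
      1 - Real.exp (-(c * n)) - μ.real {ω | LeavesOutAtMost (X n ω) (Y n ω) q₀}ᶜ ≤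
        μ.real {ω | ε ≤ expectedChange μ l (X n) (Y n) (C n) ω} := by
  obtain ⟨η, hη⟩ := exists_isTolerance hε hmin
  obtain ⟨θ, hθ0, hθ⟩ : ∃ θ > 0, θ * (10 * l) ≤ η :=
    ⟨η / (10 * l), by have := hη.pos; positivity, by field_simp; rfl⟩
  obtain ⟨c, hc, hbound⟩ := exists_eventually_failureBound_le hθ0
  have hlarge : ∀ᶠ n : ℕ in atTop, 2 * (l : ℝ) + 2 ≤ θ * n :=
    (tendsto_natCast_atTop_atTop.const_mul_atTop hθ0).eventually_ge_atTop _
  refine ⟨c, hc, ?_⟩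
  filter_upwards [hbound, hlarge] with n hbound hlarge
  have hmeas := hB.measurable_blockString n
  have hmean := hB.le_measure_le_meanChange hl hη hθ0 hθ hlarge
  simp only [← hX, ← hY] at hmeas hmean
  have hchange := (hC n).expectedChange_ae_eq hmeas fun ω => by
    rw [hY]
    exact length_blockString_le _ _ n
  have hcongr : μ.real {ω | ε ≤ meanChange l (X n ω) (Y n ω)} =
      μ.real {ω | ε ≤ expectedChange μ l (X n) (Y n) (C n) ω} :=
    measureReal_congr (hchange.symm.mono fun ω hω => congrArg (ε ≤ ·) hω)
  linarith

theorem theorem3 {Ω : Type*} [MeasurableSpace Ω] (μ : Measure Ω) [IsProbabilityMeasure μ]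
    (l : ℕ) (hl : 2 ≤ l)
    (sX sY : Ω → Bool) (BX BY : ℕ → Ω → ℕ) (hB : IsBlockModel μ l sX sY BX BY)
    (X Y : ℕ → Ω → List Bool)
    (hX : ∀ n ω, X n ω = blockString (sX ω) (fun i => BX i ω) n)
    (hY : ∀ n ω, Y n ω = blockString (sY ω) (fun i => BY i ω) n)
    (C : ℕ → Ω → ℕ × ℕ) (hC : ∀ n, IsUniformChoice μ l (X n) (Y n) (C n))
    (q₀ : ℝ) (hq₀ : q₀ ∈ Set.Ico (0 : ℝ) (1 / 3))
    (ε : ℝ) (hε : 0 < ε) (hmin : IsLeast (feasibleValues q₀) (2 * ε)) :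
    ∃ β : ℝ, 0 < β ∧ ∀ᶠ n : ℕ in atTop,
      1 - Real.exp (-((n : ℝ) ^ β)) - μ.real {ω | LeavesOutAtMost (X n ω) (Y n ω) q₀}ᶜ ≤
        μ.real {ω | ε ≤ expectedChange μ l (X n) (Y n) (C n) ω} := by
  obtain ⟨c, hc, hbound⟩ := theorem3_general μ l hl sX sY BX BY hB X Y hX hY C hC q₀ ε hε hmin.2
  exact ⟨1 / 2, one_half_pos,
    (hbound.and (eventually_exp_neg_mul_le hc)).mono fun n hn => by linarith [hn.1, hn.2]⟩
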